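/- Let $2<\gamma\le 3$ and let $C_\gamma\subset(-\tfrac12,\tfrac12)^2$ be a compact convex set whose boundary $\partial C_\gamma$ coincides, in a disc $U=\{|x|<r\}$ of some radius $r>0$ centred at the origin, with the graph of $x\mapsto|x|^{\gamma}$, and such that outside the disc $\tfrac12U=\{|x|<r/2\}$ the boundary $\partial C_\gamma$ is smooth with curvature $\ge\kappa$ for some constant $\kappa>0$. For $R>0$, $\sigma\in SO(2)$ and $t\in\mathbb{R}^2$ let \[ \mathcal{D}(R\sigma(C_\gamma)+t)=-R^{2}|C_\gamma|+\mathrm{card}\big((R\sigma(C_\gamma)+t)\cap\mathbb{Z}^2\big) \] be the discrepancy, where $|C_\gamma|$ is the area of $C_\gamma$. Identify $\mathbb{T}^2=\mathbb{R}^2/\mathbb{Z}^2$ with $[-\tfrac12,\tfrac12)^2$ equipped with Lebesgue measure $dt$, and let $d\sigma$ be the normalized Haar measure on $SO(2)$, that is $d\theta/2\pi$ in terms of the angle of rotation $\theta\in[0,2\pi)$. Let $0<p<4$ (hence $p\le(2\gamma-2)/(\gamma-2)$). Then there is a constant $c>0$, depending on $p$, $\gamma$ and the body $C_\gamma$ but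 not on $R$, such that for every $R>0$ \[ \left\{\int_{SO(2)}\int_{\mathbb{T}^2}\left|\mathcal{D}(R\sigma(C_\gamma)+t)\right|^{p}\,dt\,d\sigma\right\}^{1/p}\le c\,R^{1/2}. \] -/

import Mathlib

open MeasureTheory Set
open scoped ContDiff

/-- The Euclidean plane. -/
abbrev Plane : Type := EuclideanSpace ℝ (Fin 2)

/-- Near the point `P` the boundary of `C` is a smooth regular arc, parametrized by its arc length
through a smooth injective curve `Γ` with `Γ 0 = P`, and the curvature at `P`
(the norm of the second derivative with respect to arc length) is at least `κ`. -/
def SmoothBoundaryAt (C : Set Plane) (κ : ℝ) (P : Plane) : Prop :=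
  ∃ (Γ : ℝ → Plane) (ε : ℝ) (V : Set Plane), 0 < ε ∧ IsOpen V ∧
    ContDiffOn ℝ ∞ Γ (Ioo (-ε) ε) ∧ InjOn Γ (Ioo (-ε) ε) ∧
    (∀ s ∈ Ioo (-ε) ε, ‖deriv Γ s‖ = 1) ∧
    Γ '' Ioo (-ε) ε = frontier C ∩ V ∧
    Γ 0 = P ∧ κ ≤ ‖deriv (deriv Γ) 0‖

/-- `C` is one of the bodies `C_γ`: a compact convex set inside the open unit square
`(-1/2, 1/2)²`, whose boundary coincides, in a disc `U` of radius `r` centred at the origin, with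
the graph of `x ↦ |x| ^ γ`, and whose boundary is smooth with curvature bounded below by a positive
constant outside the disc `U / 2`. -/
def IsFlatBody (γ : ℝ) (C : Set Plane) : Prop :=
  IsCompact C ∧ Convex ℝ C ∧ (∀ x ∈ C, ∀ i, x i ∈ Ioo (-1 / 2 : ℝ) (1 / 2)) ∧
    ∃ r : ℝ, 0 < r ∧
      frontier C ∩ Metric.ball 0 r = {x : Plane | x 1 = |x 0| ^ γ} ∩ Metric.ball 0 r ∧
      ∃ κ : ℝ, 0 < κ ∧
        ∀ P ∈ frontier C, P ∉ Metric.ball (0 : Plane) (r / 2) → SmoothBoundaryAt C κ P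

/-- The rotation of the plane by the angle `θ`. -/
noncomputable def rot (θ : ℝ) (x : Plane) : Plane :=
  !₂[Real.cos θ * x 0 - Real.sin θ * x 1, Real.sin θ * x 0 + Real.cos θ * x 1]

/-- The normalized Haar measure of `SO(2)`, in the coordinate `θ ∈ [0, 2π)` given by the angle of
rotation. -/
noncomputable def angleMeasure : Measure ℝ :=
  (ENNReal.ofReal (2 * Real.pi))⁻¹ • volume.restrict (Ico 0 (2 * Real.pi))

/-- The unit square `[-1/2, 1/2)²`, with which the torus `ℝ² / ℤ²` is identified. -/
def unitSquare : Set Plane := {t | ∀ i, t i ∈ Ico (-1 / 2 : ℝ) (1 / 2)}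

/-- The integer points of the plane. -/
def integerPoints : Set Plane := {n | ∀ i, ∃ k : ℤ, n i = k}

/-- The discrepancy `-R² |C| + card ((R σ(C) + t) ∩ ℤ²)`, where `σ` is the rotation by `θ`. -/
noncomputable def discrepancy (C : Set Plane) (R θ : ℝ) (t : Plane) : ℝ :=
  -(R ^ 2 * volume.real C) +
    (((fun x : Plane => R • rot θ x + t) '' C ∩ integerPoints).ncard : ℝ)

/-! The discrepancy is the mean-zero periodic function of `t` whose nonzero Fourier coefficients
are, up to signs of the frequency, values of the Fourier transform of the indicator of the rotated
dilate `R σ(C)`. Everything rests on the decay of that transform.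

Decay comes from convexity and one-sided quadratic estimates. `QuadSupport` says that in direction
`θ` the body recedes from its supporting line at least quadratically, with constant `c`. A slice at
depth `h` below that line then has length at most `2 √(h / c)`; slice lengths are concave, and a
second-difference argument (`norm_integral_mul_exp_le_of_concave`) bounds the transform at frequency
`ρ` by a multiple of `c ^ (-1/2) ρ ^ (-3/2)`. No stationary phase is needed.

The geometric input is `IsFlatBody.exists_quadSupport`. Where the curvature is positive the constant
is locally bounded below. On the flat arc the direction of slope `m` touches at `x₀` with `|x₀| ^ (γ
- 1)` proportional to `|m|`, and the constant is of order `|x₀| ^ (γ - 2)`, so it degenerates only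
like `|cos θ| ^ e` with `e = (γ - 2) / (γ - 1)`. The transform at `n` thus loses a factor `|cos| ^
(-e/2)` of the angle between `n` and the rotated body.

For `2 ≤ p < 4` the Fourier series is cut into dyadic shells. On each shell Parseval and the trivial
sup bound give an `L ^ p` estimate (`lintegral_trigPoly_rpow_le`) by the `p`-th powers of the
coefficients. Averaging over rotations makes the angular factor harmless: `e ≤ 1/2` because `γ ≤ 3`,
hence `e p / 2 < 1` and `|cos| ^ (-e p / 2)` is integrable. The shell sums then decay geometrically
precisely because `p < 4`. Since `R ^ 2 (R |n|) ^ (-3/2) = R ^ (1/2) |n| ^ (-3/2)`, the power of `R`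
is the claimed one. Smaller `p` follow from a pointwise comparison with `p = 2`. -/

/-! ### Supporting lines and quadratic support. -/

/-- The body `C` has a support point in the direction of angle `θ`, near which the distance to the
supporting line grows at least like `c` times the square of the tangential coordinate. -/
def QuadSupport (C : Set Plane) (θ c : ℝ) : Prop :=
  ∃ Q ∈ C, ∀ y ∈ C,
    c * (-(y 0 - Q 0) * Real.sin θ + (y 1 - Q 1) * Real.cos θ) ^ 2 ≤
      (Q 0 - y 0) * Real.cos θ + (Q 1 - y 1) * Real.sin θ

theorem QuadSupport.mono {C : Set Plane} {θ c c' : ℝ} (h : QuadSupport C θ c) (hc : c' ≤ c) :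
    QuadSupport C θ c' := by
  obtain ⟨Q, hQ, h⟩ := h
  exact ⟨Q, hQ, fun y hy => le_trans (by gcongr) (h y hy)⟩

theorem plane_continuousLinearMap_apply (f : Plane →L[ℝ] ℝ) (y : Plane) :
    f y = f !₂[1, 0] * y 0 + f !₂[0, 1] * y 1 := by
  have : y = y 0 • (!₂[1, 0] : Plane) + y 1 • (!₂[0, 1] : Plane) := by
    ext i
    fin_cases i <;> simp
  conv_lhs => rw [this]
  rw [map_add, map_smul, map_smul]
  simp [mul_comm]

/-- A supporting line at a boundary point of a planar convex body. -/
theorem exists_supporting_line {C : Set Plane} (hconv : Convex ℝ C)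
    (hint : (interior C).Nonempty) {P : Plane} (hP : P ∈ frontier C) :
    ∃ a b : ℝ, (∀ y ∈ C, a * (y 0 - P 0) + b * (y 1 - P 1) ≤ 0) ∧
      ∀ z ∈ interior C, a * (z 0 - P 0) + b * (z 1 - P 1) < 0 := by
  have hP' : P ∉ interior C := hP.2
  obtain ⟨f, hf⟩ := geometric_hahn_banach_open_point hconv.interior isOpen_interior hP'
  have key : ∀ y, f y - f P = f !₂[1, 0] * (y 0 - P 0) + f !₂[0, 1] * (y 1 - P 1) := by
    intro y
    rw [plane_continuousLinearMap_apply f y, plane_continuousLinearMap_apply f P]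
    ring
  refine ⟨f !₂[1, 0], f !₂[0, 1], fun y hy => ?_, fun z hz => ?_⟩
  · rw [← key]
    have hy' : y ∈ closure (interior C) := by
      rw [hconv.closure_interior_eq_closure_of_nonempty_interior hint]
      exact subset_closure hy
    have : closure (interior C) ⊆ {y | f y ≤ f P} :=
      closure_minimal (fun z hz => (hf z hz).le) (isClosed_le f.continuous continuous_const)
    have := this hy'
    simp only [mem_ofPred_eq] at this
    linarith
  · rw [← key]
    linarith [hf z hz]

/-- Bernoulli's inequality with exponent `γ / 2 ≥ 1`, applied to `x ^ 2 / a ^ 2`, bounds `|x| ^ γ -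
|a| ^ γ` below by a multiple of `x ^ 2 - a ^ 2 = (x - a) ^ 2 + 2 a (x - a)`. The linear term is the
tangent; the square is the gain. -/
theorem abs_rpow_sub_tangent_ge {γ : ℝ} (hγ : 2 < γ) (a x : ℝ) :
    γ / 2 * |a| ^ (γ - 2) * (x - a) ^ 2 ≤
      |x| ^ γ - |a| ^ γ - γ * |a| ^ (γ - 2) * a * (x - a) := by
  rcases eq_or_ne a 0 with rfl | ha
  · simp only [abs_zero, Real.zero_rpow (by linarith : γ - 2 ≠ 0), Real.zero_rpow (by linarith : γ ≠ 0)]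
    have : 0 ≤ |x| ^ γ := by positivity
    linarith
  have ha' : 0 < |a| := abs_pos.mpr ha
  have h1 : 1 + γ / 2 * (x ^ 2 / a ^ 2 - 1) ≤ (1 + (x ^ 2 / a ^ 2 - 1)) ^ (γ / 2) := by
    apply one_add_mul_self_le_rpow_one_add _ (by linarith)
    have : 0 ≤ x ^ 2 / a ^ 2 := by positivity
    linarith
  have h2 : (1 + (x ^ 2 / a ^ 2 - 1)) ^ (γ / 2) = |x| ^ γ / |a| ^ γ := by
    rw [← Real.div_rpow (abs_nonneg _) (abs_nonneg _), ← abs_div]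
    have : 1 + (x ^ 2 / a ^ 2 - 1) = |x / a| ^ (2 : ℝ) := by
      rw [Real.rpow_two, sq_abs, div_pow]; ring
    rw [this, ← Real.rpow_mul (abs_nonneg _)]
    congr 1; ring
  have h3 : |a| ^ γ = |a| ^ (γ - 2) * a ^ 2 := by
    rw [← sq_abs a, ← Real.rpow_two, ← Real.rpow_add ha']; congr 1; ring
  have hp : 0 < |a| ^ (γ - 2) := by positivity
  rw [h2, le_div_iff₀ (by positivity), h3] at h1
  have h4 : (1 + γ / 2 * (x ^ 2 / a ^ 2 - 1)) * (|a| ^ (γ - 2) * a ^ 2) =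
      |a| ^ (γ - 2) * (a ^ 2 + γ / 2 * (x ^ 2 - a ^ 2)) := by
    field_simp
  rw [h4] at h1
  rw [h3]
  nlinarith [h1]

theorem plane_mem_ball_zero {r : ℝ} (hr : 0 < r) (y : Plane) :
    y ∈ Metric.ball (0 : Plane) r ↔ y 0 ^ 2 + y 1 ^ 2 < r ^ 2 := by
  rw [mem_ball_zero_iff, EuclideanSpace.norm_eq, Fin.sum_univ_two, Real.sqrt_lt' hr]
  simp

/-! ### The flat arc: tangent lines and distance to them. -/

section FlatArc

variable {γ r : ℝ} {C : Set Plane}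

theorem graph_point_mem_frontier (hr : 0 < r)
    (hg : frontier C ∩ Metric.ball 0 r = {x : Plane | x 1 = |x 0| ^ γ} ∩ Metric.ball 0 r)
    {a : ℝ} (ha : a ^ 2 + (|a| ^ γ) ^ 2 < r ^ 2) : !₂[a, |a| ^ γ] ∈ frontier C := by
  have : (!₂[a, |a| ^ γ] : Plane) ∈ {x : Plane | x 1 = |x 0| ^ γ} ∩ Metric.ball 0 r := by
    refine ⟨by simp, ?_⟩
    rw [plane_mem_ball_zero hr]
    simpa using ha
  rw [← hg] at this
  exact this.1

theorem exists_pos_graph_radius (hγ : 2 < γ) (hr : 0 < r) :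
    ∃ a : ℝ, 0 < a ∧ a ^ 2 + (|a| ^ γ) ^ 2 < r ^ 2 := by
  have hc : Filter.Tendsto (fun a : ℝ => a ^ 2 + (|a| ^ γ) ^ 2) (nhds 0) (nhds 0) := by
    have : Continuous (fun a : ℝ => a ^ 2 + (|a| ^ γ) ^ 2) := by
      have := (continuous_abs (G := ℝ)).rpow_const (p := γ) (fun x => Or.inr (by linarith))
      fun_prop
    have h := this.tendsto 0
    simpa [Real.zero_rpow (by linarith : γ ≠ 0)] using h
  have h1 := (hc.eventually (gt_mem_nhds (by positivity : 0 < r ^ 2)))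
  have h2 := (h1.filter_mono nhdsWithin_le_nhds).and (self_mem_nhdsWithin (a := (0 : ℝ)) (s := Ioi 0))
  obtain ⟨a, ha, ha'⟩ := h2.exists
  exact ⟨a, ha', ha⟩

/-- A closed set without interior is its own frontier. The midpoint of two symmetric points of the
arc would then lie in the frontier above the origin, off the graph. -/
theorem interior_nonempty_of_flat (hγ : 2 < γ) (hconv : Convex ℝ C) (hcl : IsClosed C) (hr : 0 < r)
    (hg : frontier C ∩ Metric.ball 0 r = {x : Plane | x 1 = |x 0| ^ γ} ∩ Metric.ball 0 r) :
    (interior C).Nonempty := by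
  by_contra hne
  rw [not_nonempty_iff_eq_empty] at hne
  have hfr : frontier C = C := by rw [frontier, hne, hcl.closure_eq, sdiff_empty]
  obtain ⟨a, ha, har⟩ := exists_pos_graph_radius hγ hr
  have h1 := graph_point_mem_frontier hr hg har
  have h2 := graph_point_mem_frontier (a := -a) hr hg (by simpa using har)
  rw [hfr] at h1 h2
  have h3 := hconv h1 h2 (by norm_num : (0 : ℝ) ≤ 1 / 2) (by norm_num : (0 : ℝ) ≤ 1 / 2) (by norm_num)
  have h4 : ((1 / 2 : ℝ) • (!₂[a, |a| ^ γ] : Plane) + (1 / 2 : ℝ) • !₂[-a, |-a| ^ γ]) =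
      !₂[0, |a| ^ γ] := by
    ext i
    fin_cases i <;> simp; ring
  rw [h4, ← hfr] at h3
  have h5 : (!₂[0, |a| ^ γ] : Plane) ∈ frontier C ∩ Metric.ball 0 r := by
    refine ⟨h3, ?_⟩
    rw [plane_mem_ball_zero hr]
    simp only [Matrix.cons_val_zero, Matrix.cons_val_one, Matrix.cons_val_fin_one]
    nlinarith
  rw [hg] at h5
  have h6 := h5.1
  simp only [mem_ofPred_eq, Matrix.cons_val_zero, Matrix.cons_val_one,
    Matrix.cons_val_fin_one, abs_zero, Real.zero_rpow (by linarith : γ ≠ 0)] at h6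
  have : 0 < |a| ^ γ := by positivity
  linarith

/-- A line supporting `C` at a point of its flat arc is the tangent line of the arc, and `C` lies
above it. -/
theorem supporting_line_graph_point (hγ : 2 < γ) (hcl : IsClosed C) (hr : 0 < r)
    (hg : frontier C ∩ Metric.ball 0 r = {x : Plane | x 1 = |x 0| ^ γ} ∩ Metric.ball 0 r)
    {a : ℝ} (ha : a ^ 2 + (|a| ^ γ) ^ 2 < r ^ 2) {m n : ℝ} (hmn : m ≠ 0 ∨ n ≠ 0)
    (h : ∀ y ∈ C, m * (y 0 - a) + n * (y 1 - |a| ^ γ) ≤ 0) :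
    n < 0 ∧ m + n * (γ * |a| ^ (γ - 2) * a) = 0 := by
  have hev : ∀ᶠ x in nhds a, x ^ 2 + (|x| ^ γ) ^ 2 < r ^ 2 := by
    have : Continuous (fun a : ℝ => a ^ 2 + (|a| ^ γ) ^ 2) := by
      have := (continuous_abs (G := ℝ)).rpow_const (p := γ) (fun x => Or.inr (by linarith))
      fun_prop
    exact this.continuousAt.eventually (gt_mem_nhds ha)
  have hev2 : ∀ᶠ x in nhds a, m * (x - a) + n * (|x| ^ γ - |a| ^ γ) ≤ 0 := by
    filter_upwards [hev] with x hx
    have := h _ (hcl.frontier_subset (graph_point_mem_frontier hr hg hx))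
    simpa using this
  have hd : HasDerivAt (fun x => m * (x - a) + n * (|x| ^ γ - |a| ^ γ))
      (m * 1 + n * (γ * |a| ^ (γ - 2) * a)) a :=
    (((hasDerivAt_id a).sub_const a).const_mul m).add
      (((hasDerivAt_abs_rpow a (by linarith : 1 < γ)).sub_const _).const_mul n)
  -- The arc lies in `C`, so the supporting functional restricted to it has a local maximum at `a`.
  have hz : m * 1 + n * (γ * |a| ^ (γ - 2) * a) = 0 := by
    apply IsLocalMax.hasDerivAt_eq_zero _ hd
    filter_upwards [hev2] with x hx
    simpa using hx
  rw [mul_one] at hz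
  refine ⟨?_, hz⟩
  have hn : n ≠ 0 := by
    rintro rfl
    rcases hmn with h | h
    · apply h; linarith
    · exact h rfl
  -- With `n > 0` tangency would put the body below the tangent, while the arc just to the right of
  -- `a` is strictly above it.
  by_contra hcon
  have hn' : 0 < n := lt_of_le_of_ne (not_lt.mp hcon) (Ne.symm hn)
  obtain ⟨x, ⟨hx1, hx2⟩⟩ := ((hev2.filter_mono nhdsWithin_le_nhds).and
    (self_mem_nhdsWithin (a := a) (s := Ioi a))).exists
  have hx2 : a < x := hx2
  have hgap := abs_rpow_sub_tangent_ge hγ a x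
  have hm : m = - n * (γ * |a| ^ (γ - 2) * a) := by linarith
  have : 0 < |x| ^ γ - |a| ^ γ - γ * |a| ^ (γ - 2) * a * (x - a) := by
    rcases eq_or_ne a 0 with rfl | ha0
    · simp only [abs_zero, Real.zero_rpow (by linarith : γ ≠ 0)]
      have : 0 < |x| ^ γ := Real.rpow_pos_of_pos (abs_pos.mpr hx2.ne') _
      linarith
    · refine lt_of_lt_of_le ?_ hgap
      have : 0 < |a| := abs_pos.mpr ha0
      have : 0 < x - a := by linarith
      positivity
  rw [hm] at hx1
  nlinarith

/-- The separating functional is nonzero because it is strict on the interior; it is therefore the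
downward normal of the arc, and dividing by `-n` gives the inequality. -/
theorem above_tangent_line (hγ : 2 < γ) (hconv : Convex ℝ C) (hcl : IsClosed C) (hr : 0 < r)
    (hg : frontier C ∩ Metric.ball 0 r = {x : Plane | x 1 = |x 0| ^ γ} ∩ Metric.ball 0 r)
    {a : ℝ} (ha : a ^ 2 + (|a| ^ γ) ^ 2 < r ^ 2) {y : Plane} (hy : y ∈ C) :
    |a| ^ γ + γ * |a| ^ (γ - 2) * a * (y 0 - a) ≤ y 1 := by
  have hint := interior_nonempty_of_flat hγ hconv hcl hr hg
  obtain ⟨m, n, h1, h2⟩ := exists_supporting_line hconv hint (graph_point_mem_frontier hr hg ha)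
  simp only [Matrix.cons_val_zero, Matrix.cons_val_one,
    Matrix.cons_val_fin_one] at h1 h2
  have hmn : m ≠ 0 ∨ n ≠ 0 := by
    by_contra! hcon
    obtain ⟨z, hz⟩ := hint
    have := h2 z hz
    rw [hcon.1, hcon.2] at this
    linarith
  obtain ⟨hn, hm⟩ := supporting_line_graph_point hγ hcl hr hg ha hmn h1
  have := h1 y hy
  have hm' : m = - n * (γ * |a| ^ (γ - 2) * a) := by linarith
  rw [hm'] at this
  nlinarith

/-- Lower bound for the vertical distance between `C` and a tangent line to its flat arc. -/
theorem vertical_gap_ge (hγ : 2 < γ) (hconv : Convex ℝ C) (hcl : IsClosed C) (hr : 0 < r)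
    (hbox : ∀ x ∈ C, ∀ i, x i ∈ Ioo (-1 / 2 : ℝ) (1 / 2))
    (hg : frontier C ∩ Metric.ball 0 r = {x : Plane | x 1 = |x 0| ^ γ} ∩ Metric.ball 0 r)
    {a b : ℝ} (hab : b < a) (ha : a ^ 2 + (|a| ^ γ) ^ 2 < r ^ 2) (ha1 : a - b ≤ 1)
    {x : ℝ} (hx : |x| ≤ b) {y : Plane} (hy : y ∈ C) :
    γ / 2 * (a - b) ^ 2 * |x| ^ (γ - 2) * (y 0 - x) ^ 2 ≤
      y 1 - |x| ^ γ - γ * |x| ^ (γ - 2) * x * (y 0 - x) := by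
  have hx0 := abs_nonneg x
  have hb0 : 0 ≤ b := hx0.trans hx
  have ha0 : 0 < a := by linarith
  have hxb := abs_le.mp hx
  have hq : 0 ≤ γ / 2 * |x| ^ (γ - 2) := by positivity
  have hyb := hbox y hy 0
  have hxC : !₂[x, |x| ^ γ] ∈ C := by
    apply hcl.frontier_subset
    apply graph_point_mem_frontier hr hg
    have h1 : |x| ^ γ ≤ |a| ^ γ := by
      rw [abs_of_pos ha0]; gcongr; linarith
    have h2 : 0 ≤ |x| ^ γ := by positivity
    have h3 : x ^ 2 ≤ a ^ 2 := by rw [← sq_abs x]; gcongr; linarith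
    nlinarith
  have hxb1 := hbox _ hxC 0
  simp only [Matrix.cons_val_zero] at hxb1
  -- The body has width less than one, so beyond the arc the quadratic lower bound can be replaced
  -- by the constant gain `(a - b) ^ 2`.
  have hd1 : (y 0 - x) ^ 2 ≤ 1 := by
    obtain ⟨h1, h2⟩ := hyb
    obtain ⟨h3, h4⟩ := hxb1
    nlinarith
  have hab2 : (a - b) ^ 2 ≤ 1 := by nlinarith
  have mono : ∀ s t : ℝ, 0 ≤ s → s ≤ t → |s| ^ (γ - 2) * s ≤ |t| ^ (γ - 2) * t := by
    intro s t hs hst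
    have ht := hs.trans hst
    rw [abs_of_nonneg hs, abs_of_nonneg ht]
    exact mul_le_mul (Real.rpow_le_rpow hs hst (by linarith)) hst hs (by positivity)
  have hfx : |x| ^ (γ - 2) * |x| ≤ |a| ^ (γ - 2) * a := by
    have := mono |x| a hx0 (by linarith)
    rwa [abs_abs] at this
  have hpx : 0 ≤ |x| ^ (γ - 2) := by positivity
  -- Over the arc, the tangent at abscissa `y 0` itself shows that `y` lies above the graph.
  by_cases hya : |y 0| ≤ a
  · have h1 : |y 0| ^ γ ≤ y 1 := by
      have h2 : (y 0) ^ 2 + (|y 0| ^ γ) ^ 2 < r ^ 2 := by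
        refine lt_of_le_of_lt ?_ ha
        rw [← sq_abs (y 0), abs_of_pos ha0]
        gcongr
      have := above_tangent_line hγ hconv hcl hr hg h2 hy
      simpa using this
    have h2 := abs_rpow_sub_tangent_ge hγ x (y 0)
    have h3 : γ / 2 * (a - b) ^ 2 * |x| ^ (γ - 2) * (y 0 - x) ^ 2 ≤
        γ / 2 * |x| ^ (γ - 2) * (y 0 - x) ^ 2 := by
      have : 0 ≤ γ / 2 * |x| ^ (γ - 2) * (y 0 - x) ^ 2 := by positivity
      nlinarith
    linarith
  · -- far from the arc: compare with the tangent line at one end of a larger arc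
    -- With `e` the end on the side of `y`, the tangent at `e` is above the tangent at `x` when
    -- evaluated at `e`, by at least a multiple of `(e - x) ^ 2 ≥ (a - b) ^ 2`. Monotonicity of
    -- slopes, encoded in the sign hypothesis, keeps it so out to `y 0`.
    have aux : ∀ e : ℝ, (e = a ∨ e = -a) → 0 ≤ (|e| ^ (γ - 2) * e - |x| ^ (γ - 2) * x) * (y 0 - e) →
        γ / 2 * (a - b) ^ 2 * |x| ^ (γ - 2) * (y 0 - x) ^ 2 ≤
          y 1 - |x| ^ γ - γ * |x| ^ (γ - 2) * x * (y 0 - x) := by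
      intro e he hpos
      have hae : |e| = a := by
        rcases he with rfl | rfl
        · exact abs_of_pos ha0
        · rw [abs_neg, abs_of_pos ha0]
      have h1 := above_tangent_line (a := e) hγ hconv hcl hr hg (by
        rw [← sq_abs e, hae]; rwa [abs_of_pos ha0] at ha) hy
      have h2 := abs_rpow_sub_tangent_ge hγ x e
      have h3 : (a - b) ^ 2 ≤ (e - x) ^ 2 := by
        rcases he with rfl | rfl <;> nlinarith
      have h4 : γ / 2 * (a - b) ^ 2 * |x| ^ (γ - 2) * (y 0 - x) ^ 2 ≤
          γ / 2 * |x| ^ (γ - 2) * (e - x) ^ 2 := by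
        have : (a - b) ^ 2 * (y 0 - x) ^ 2 ≤ (e - x) ^ 2 := by nlinarith [sq_nonneg (a - b)]
        nlinarith
      have h5 : 0 ≤ γ * ((|e| ^ (γ - 2) * e - |x| ^ (γ - 2) * x) * (y 0 - e)) :=
        mul_nonneg (by linarith) hpos
      nlinarith
    have hxx1 : |x| ^ (γ - 2) * x ≤ |x| ^ (γ - 2) * |x| := by gcongr; exact le_abs_self x
    have hxx2 : -(|x| ^ (γ - 2) * |x|) ≤ |x| ^ (γ - 2) * x := by
      rw [← mul_neg]; gcongr; exact neg_abs_le x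
    rcases lt_or_ge (y 0) 0 with hneg | hpos
    · rw [abs_of_neg hneg] at hya
      refine aux (-a) (Or.inr rfl) ?_
      rw [abs_neg]
      apply mul_nonneg_of_nonpos_of_nonpos <;> linarith
    · rw [abs_of_nonneg hpos] at hya
      refine aux a (Or.inl rfl) ?_
      apply mul_nonneg <;> linarith

end FlatArc

/-- Passage from the vertical gap to the rotated frame: `d` is the horizontal displacement, `g` the
height above the tangent of slope `m`, and `S = -sin θ`. Then `S g` is the distance to the
supporting line and `S ((1 + m²) d + m g)` the tangential coordinate, whose square is at most `2 (1
+ m²) d² + 2 g²`. The first term is absorbed by the gap estimate, the second by boundedness of the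
body, each costing half of `S g`. -/
theorem quadSupport_flat_estimate {c B c₁ s₀ K W S m d g : ℝ} (hcpos : 0 < c) (hBnn : 0 ≤ B)
    (hB1 : B ≤ 1) (hc₁pos : 0 < c₁) (hs₀pos : 0 < s₀) (hKpos : 0 < K) (hWnn : 0 ≤ W)
    (hgnn : 0 ≤ g) (hS : s₀ < S) (hc1 : c ≤ c₁ * s₀ ^ 3 / (4 * K)) (hc2 : c ≤ s₀ ^ 2 / 8)
    (hcospow : B ≤ K * W) (hgy : c₁ * W * d ^ 2 ≤ g) (hdep2 : S * g ≤ 2)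
    (hS2 : S ^ 2 * (1 + m ^ 2) = 1) :
    c * B * (S * ((1 + m ^ 2) * d + m * g)) ^ 2 ≤ S * g := by
  have hSpos : 0 < S := by linarith
  have hsq : (S * ((1 + m ^ 2) * d + m * g)) ^ 2 ≤ 2 * (1 + m ^ 2) * d ^ 2 + 2 * g ^ 2 := by
    have e1 : (S * ((1 + m ^ 2) * d + m * g)) ^ 2 =
        S ^ 2 * ((1 + m ^ 2) * d + m * g) ^ 2 := by ring
    have e2 : ((1 + m ^ 2) * d + m * g) ^ 2 ≤ 2 * ((1 + m ^ 2) * d) ^ 2 + 2 * (m * g) ^ 2 := by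
      nlinarith [sq_nonneg ((1 + m ^ 2) * d - m * g)]
    have e3 : S ^ 2 * (2 * ((1 + m ^ 2) * d) ^ 2 + 2 * (m * g) ^ 2) =
        2 * (S ^ 2 * (1 + m ^ 2)) * (1 + m ^ 2) * d ^ 2 + 2 * (S ^ 2 * m ^ 2) * g ^ 2 := by ring
    have e4 : S ^ 2 * m ^ 2 ≤ 1 := by nlinarith
    rw [e1]
    calc _ ≤ _ := mul_le_mul_of_nonneg_left e2 (by positivity)
      _ = _ := e3
      _ ≤ _ := by rw [hS2]; nlinarith [sq_nonneg g]
  have hd2 : c * B * (2 * (1 + m ^ 2) * d ^ 2) ≤ S * g / 2 := by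
    have h1 : c ≤ c₁ * s₀ ^ 3 / (4 * K) := hc1
    have h2 : c * B ≤ c₁ * s₀ ^ 3 / 4 * W := by
      calc c * B ≤ c₁ * s₀ ^ 3 / (4 * K) * (K * W) := by gcongr
        _ = _ := by field_simp
    have h3 : s₀ ^ 2 * (1 + m ^ 2) ≤ 1 := by
      calc _ ≤ S ^ 2 * (1 + m ^ 2) := by gcongr
      _ = 1 := hS2
    calc c * B * (2 * (1 + m ^ 2) * d ^ 2) ≤ c₁ * s₀ ^ 3 / 4 * W * (2 * (1 + m ^ 2) * d ^ 2) := by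
          gcongr
      _ = (s₀ ^ 2 * (1 + m ^ 2)) * (s₀ / 2 * (c₁ * W * d ^ 2)) := by ring
      _ ≤ 1 * (s₀ / 2 * (c₁ * W * d ^ 2)) := by gcongr
      _ ≤ 1 * (S / 2 * g) := by gcongr
      _ = _ := by ring
  have hg2 : c * B * (2 * g ^ 2) ≤ S * g / 2 := by
    have h1 : c ≤ s₀ ^ 2 / 8 := hc2
    have h2 : s₀ * g ≤ 2 := le_trans (by gcongr) hdep2
    calc c * B * (2 * g ^ 2) ≤ s₀ ^ 2 / 8 * 1 * (2 * g ^ 2) := by gcongr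
      _ = s₀ * g * (s₀ * g) / 4 := by ring
      _ ≤ 2 * (S * g) / 4 := by gcongr
      _ = _ := by ring
  calc _ ≤ c * B * (2 * (1 + m ^ 2) * d ^ 2 + 2 * g ^ 2) := by gcongr
    _ ≤ S * g := by linarith


section FlatLocal

variable {γ r : ℝ} {C : Set Plane}

/-- Directions near `θ₀` touch the arc at the `x₀` where its slope is `-cot θ`. Inverting the slope
gives `|x₀| ^ (γ - 2)` as a multiple of `|m| ^ ((γ - 2) / (γ - 1))`, and `|m| ≥ |cos θ|`; this is
the source of the exponent. -/
theorem quadSupport_near_flat (hγ : 2 < γ) (hconv : Convex ℝ C) (hcl : IsClosed C) (hr : 0 < r)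
    (hbox : ∀ x ∈ C, ∀ i, x i ∈ Ioo (-1 / 2 : ℝ) (1 / 2))
    (hg : frontier C ∩ Metric.ball 0 r = {x : Plane | x 1 = |x 0| ^ γ} ∩ Metric.ball 0 r)
    {P : Plane} (hP : P ∈ frontier C) (hPr : P ∈ Metric.ball (0 : Plane) r) {θ₀ : ℝ}
    (hsupp : ∀ y ∈ C, Real.cos θ₀ * (y 0 - P 0) + Real.sin θ₀ * (y 1 - P 1) ≤ 0) :
    ∃ c : ℝ, 0 < c ∧ ∀ᶠ θ in nhds θ₀,
      QuadSupport C θ (c * |Real.cos θ| ^ ((γ - 2) / (γ - 1))) := by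
  have hPg : P 1 = |P 0| ^ γ := by
    have : P ∈ {x : Plane | x 1 = |x 0| ^ γ} ∩ Metric.ball 0 r := by rw [← hg]; exact ⟨hP, hPr⟩
    exact this.1
  rw [plane_mem_ball_zero hr, hPg] at hPr
  rw [hPg] at hsupp
  have hcs : Real.cos θ₀ ≠ 0 ∨ Real.sin θ₀ ≠ 0 := by
    by_contra! h
    have := Real.sin_sq_add_cos_sq θ₀
    rw [h.1, h.2] at this
    norm_num at this
  obtain ⟨hs, hm⟩ := supporting_line_graph_point hγ hcl hr hg hPr hcs hsupp
  set x := P 0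
  -- Room on the arc beyond the contact abscissa: contact points for nearby directions stay within
  -- `b`, the midpoint of `|x|` and `a`, while tangents out to `a` remain available.
  obtain ⟨a, ⟨har, ha1⟩, hxa⟩ : ∃ a, (a ^ 2 + (|a| ^ γ) ^ 2 < r ^ 2 ∧ a < |x| + 1) ∧ |x| < a := by
    have hc : Continuous (fun a : ℝ => a ^ 2 + (|a| ^ γ) ^ 2) := by
      have := (continuous_abs (G := ℝ)).rpow_const (p := γ) (fun x => Or.inr (by linarith))
      fun_prop
    have h1 : ∀ᶠ a in nhds |x|, a ^ 2 + (|a| ^ γ) ^ 2 < r ^ 2 := by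
      apply hc.continuousAt.eventually (gt_mem_nhds _)
      simpa using hPr
    have h2 : ∀ᶠ a in nhds |x|, a < |x| + 1 := gt_mem_nhds (by linarith)
    exact (((h1.and h2).filter_mono nhdsWithin_le_nhds).and
      (self_mem_nhdsWithin (a := |x|) (s := Ioi |x|))).exists
  set b := (|x| + a) / 2 with hb
  set c₁ := γ / 2 * (a - b) ^ 2 with hc₁
  have hab : b < a := by rw [hb]; linarith
  have hab' : 0 < a - b := by linarith
  have hc₁pos : 0 < c₁ := by positivity
  set s₀ := - Real.sin θ₀ / 2 with hs₀
  have hs₀pos : 0 < s₀ := by rw [hs₀]; linarith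
  set K := γ ^ ((γ - 2) / (γ - 1)) with hK
  have hKpos : 0 < K := by positivity
  set c := min (c₁ * s₀ ^ 3 / (4 * K)) (s₀ ^ 2 / 8) with hc
  have hcpos : 0 < c := by positivity
  refine ⟨c, hcpos, ?_⟩
  have hγ1 : γ - 1 ≠ 0 := by linarith
  have ev1 : ∀ᶠ θ in nhds θ₀, s₀ < - Real.sin θ := by
    have : Continuous (fun θ => - Real.sin θ) := by fun_prop
    apply this.continuousAt.eventually (lt_mem_nhds _)
    rw [hs₀]; linarith
  -- The left side is the modulus of the contact abscissa for direction `θ`; at `θ₀` it equals `|x|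
  -- < b`.
  have ev2 : ∀ᶠ θ in nhds θ₀, (|-Real.cos θ / Real.sin θ| / γ) ^ (1 / (γ - 1)) < b := by
    have hcont : ContinuousAt (fun θ => (|-Real.cos θ / Real.sin θ| / γ) ^ (1 / (γ - 1))) θ₀ := by
      apply ContinuousAt.rpow_const
      · apply ContinuousAt.div_const
        apply ContinuousAt.abs
        apply ContinuousAt.div₀ (by fun_prop) (by fun_prop) hs.ne
      · right
        have : 0 < γ - 1 := by linarith
        positivity
    apply hcont.eventually (gt_mem_nhds _)
    have h1 : -Real.cos θ₀ / Real.sin θ₀ = γ * |x| ^ (γ - 2) * x := by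
      rw [div_eq_iff hs.ne]; linarith
    have h2 : |γ * |x| ^ (γ - 2) * x| / γ = |x| ^ (γ - 1) := by
      rw [abs_mul, abs_mul, abs_of_pos (by linarith : 0 < γ), abs_of_nonneg (by positivity : 0 ≤ |x| ^ (γ - 2))]
      rw [mul_assoc, mul_div_cancel_left₀ _ (by linarith : γ ≠ 0)]
      rw [← Real.rpow_add_one' (abs_nonneg x) (by linarith)]
      congr 1; ring
    beta_reduce
    rw [h1, h2, ← Real.rpow_mul (abs_nonneg x), mul_one_div_cancel hγ1, Real.rpow_one]
    rw [hb]; linarith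
  filter_upwards [ev1, ev2] with θ hθ1 hθ2
  have hsn : Real.sin θ < 0 := by linarith
  set m := -Real.cos θ / Real.sin θ with hmdef
  have hmcos : Real.cos θ = - m * Real.sin θ := by rw [hmdef]; field_simp [hsn.ne]
  set w := (|m| / γ) ^ (1 / (γ - 1)) with hw
  have hwnn : 0 ≤ w := by positivity
  have hwpow : w ^ (γ - 1) = |m| / γ := by
    rw [hw, ← Real.rpow_mul (by positivity), one_div_mul_cancel hγ1, Real.rpow_one]
  obtain ⟨x₀, hx₀, hx₀m⟩ : ∃ x₀ : ℝ, |x₀| = w ∧ γ * |x₀| ^ (γ - 2) * x₀ = m := by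
    have h1 : γ * w ^ (γ - 2) * w = |m| := by
      rw [mul_assoc, ← Real.rpow_add_one' hwnn (by linarith), (by ring : γ - 2 + 1 = γ - 1), hwpow]
      field_simp
    rcases le_or_gt 0 m with h | h
    · refine ⟨w, abs_of_nonneg hwnn, ?_⟩
      rw [abs_of_nonneg hwnn, h1, abs_of_nonneg h]
    · refine ⟨-w, by rw [abs_neg, abs_of_nonneg hwnn], ?_⟩
      rw [abs_neg, abs_of_nonneg hwnn, mul_neg, h1, abs_of_neg h, neg_neg]
  have hx₀b : |x₀| ≤ b := by rw [hx₀]; exact hθ2.le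
  have hgap : ∀ y ∈ C, c₁ * |x₀| ^ (γ - 2) * (y 0 - x₀) ^ 2 ≤ y 1 - |x₀| ^ γ - m * (y 0 - x₀) := by
    intro y hy
    have := vertical_gap_ge hγ hconv hcl hr hbox hg hab har (by rw [hb]; linarith) hx₀b hy
    rwa [hx₀m] at this
  have hcospow : |Real.cos θ| ^ ((γ - 2) / (γ - 1)) ≤ K * |x₀| ^ (γ - 2) := by
    have hcm : |Real.cos θ| ≤ |m| := by
      rw [hmcos, abs_mul, abs_neg]
      exact mul_le_of_le_one_right (abs_nonneg _) (Real.abs_sin_le_one θ)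
    have he : 0 ≤ (γ - 2) / (γ - 1) := div_nonneg (by linarith) (by linarith)
    calc |Real.cos θ| ^ ((γ - 2) / (γ - 1)) ≤ |m| ^ ((γ - 2) / (γ - 1)) := by gcongr
      _ = (γ * w ^ (γ - 1)) ^ ((γ - 2) / (γ - 1)) := by rw [hwpow]; congr 1; field_simp
      _ = K * |x₀| ^ (γ - 2) := by
        rw [Real.mul_rpow (by linarith) (by positivity), ← Real.rpow_mul hwnn, hx₀,
          mul_div_cancel₀ _ hγ1]
  have hQC : !₂[x₀, |x₀| ^ γ] ∈ C := by
    apply hcl.frontier_subset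
    apply graph_point_mem_frontier hr hg
    refine lt_of_le_of_lt ?_ har
    have : 0 < a := lt_of_le_of_lt (abs_nonneg x) hxa
    rw [← sq_abs x₀, abs_of_pos this]
    gcongr <;> linarith
  refine ⟨_, hQC, fun y hy => ?_⟩
  have hQ0 := hbox _ hQC 0
  have hQ1 := hbox _ hQC 1
  have hy0 := hbox _ hy 0
  have hy1 := hbox _ hy 1
  have hgy := hgap y hy
  simp only [Matrix.cons_val_zero, Matrix.cons_val_one, Matrix.cons_val_fin_one] at hQ0 hQ1 ⊢
  set q := |x₀| ^ γ
  set W := |x₀| ^ (γ - 2) with hW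
  have hWnn : 0 ≤ W := by positivity
  set B := |Real.cos θ| ^ ((γ - 2) / (γ - 1))
  have hBnn : 0 ≤ B := by positivity
  have hB1 : B ≤ 1 := Real.rpow_le_one (abs_nonneg _) (Real.abs_cos_le_one θ)
    (div_nonneg (by linarith) (by linarith))
  set S := - Real.sin θ with hS
  have hsin : Real.sin θ = - S := by rw [hS]; ring
  have hsc := Real.sin_sq_add_cos_sq θ
  have hS1 : S ≤ 1 := by linarith [Real.neg_one_le_sin θ]
  rw [hsin] at hmcos hsc
  rw [hsin, hmcos]
  rw [hmcos] at hsc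
  set d := y 0 - x₀ with hd
  set g := y 1 - q - m * d with hg'
  have hgnn : 0 ≤ g := le_trans (by positivity) hgy
  have hdep : (x₀ - y 0) * (-m * -S) + (q - y 1) * -S = S * g := by rw [hg', hd]; ring
  have htan : -(y 0 - x₀) * -S + (y 1 - q) * (-m * -S) = S * ((1 + m ^ 2) * d + m * g) := by
    rw [hg', hd]; ring
  rw [hdep, htan]
  have hdep2 : S * g ≤ 2 := by
    rw [← hdep, ← hmcos]
    have h1 := Real.abs_cos_le_one θ
    have h2 : |x₀ - y 0| ≤ 1 := by rw [abs_le]; constructor <;> linarith [hQ0.1, hQ0.2, hy0.1, hy0.2]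
    have h3 : |q - y 1| ≤ 1 := by rw [abs_le]; constructor <;> linarith [hQ1.1, hQ1.2, hy1.1, hy1.2]
    have h4 : |S| ≤ 1 := by rw [abs_of_pos (by linarith)]; exact hS1
    calc (x₀ - y 0) * Real.cos θ + (q - y 1) * -S ≤ |x₀ - y 0| * |Real.cos θ| + |q - y 1| * |S| := by
          rw [← abs_mul, ← abs_mul, mul_neg]
          exact add_le_add (le_abs_self _) (neg_le_abs _)
      _ ≤ 1 * 1 + 1 * 1 := by gcongr
      _ = 2 := by norm_num
  have hS2 : S ^ 2 * (1 + m ^ 2) = 1 := by linarith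
  exact quadSupport_flat_estimate hcpos hBnn hB1 hc₁pos hs₀pos hKpos hWnn hgnn hθ1
    (min_le_left _ _) (min_le_right _ _) hcospow hgy hdep2 hS2

end FlatLocal

/-! ### Quadratic support on arcs of positive curvature. -/

/-- The data of an arc of the boundary of a convex body that is parametrized by its arc length. -/
structure UnitSpeedArc (C : Set Plane) (ε : ℝ) (X Y T U N V : ℝ → ℝ) : Prop where
  mem : ∀ s ∈ Ioo (-ε) ε, !₂[X s, Y s] ∈ frontier C
  derivX : ∀ s ∈ Ioo (-ε) ε, HasDerivAt X (T s) s
  derivY : ∀ s ∈ Ioo (-ε) ε, HasDerivAt Y (U s) s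
  derivT : ∀ s ∈ Ioo (-ε) ε, HasDerivAt T (N s) s
  derivU : ∀ s ∈ Ioo (-ε) ε, HasDerivAt U (V s) s
  contN : ContinuousOn N (Ioo (-ε) ε)
  contV : ContinuousOn V (Ioo (-ε) ε)
  unit : ∀ s ∈ Ioo (-ε) ε, T s ^ 2 + U s ^ 2 = 1

theorem SmoothBoundaryAt.exists_arc {C : Set Plane} {κ : ℝ} {P : Plane}
    (h : SmoothBoundaryAt C κ P) (hκ : 0 < κ) :
    ∃ (ε : ℝ) (X Y T U N V : ℝ → ℝ), 0 < ε ∧ UnitSpeedArc C ε X Y T U N V ∧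
      X 0 = P 0 ∧ Y 0 = P 1 ∧ κ ^ 2 ≤ N 0 ^ 2 + V 0 ^ 2 := by
  obtain ⟨Γ, ε, W, hε, -, hsm, -, hunit, himg, h0, hk⟩ := h
  have hsm1 : ContDiffOn ℝ ∞ (deriv Γ) (Ioo (-ε) ε) :=
    hsm.deriv_of_isOpen isOpen_Ioo (by simp)
  have hsm2 : ContDiffOn ℝ ∞ (deriv (deriv Γ)) (Ioo (-ε) ε) :=
    hsm1.deriv_of_isOpen isOpen_Ioo (by simp)
  have hd : ∀ s ∈ Ioo (-ε) ε, HasDerivAt Γ (deriv Γ s) s := fun s hs =>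
    ((hsm.differentiableOn (by simp)).differentiableAt (isOpen_Ioo.mem_nhds hs)).hasDerivAt
  have hd1 : ∀ s ∈ Ioo (-ε) ε, HasDerivAt (deriv Γ) (deriv (deriv Γ) s) s := fun s hs =>
    ((hsm1.differentiableOn (by simp)).differentiableAt (isOpen_Ioo.mem_nhds hs)).hasDerivAt
  have proj : ∀ (i : Fin 2) (f : ℝ → Plane) (f' : Plane) (s : ℝ), HasDerivAt f f' s →
      HasDerivAt (fun s => f s i) (f' i) s := fun i f f' s hf =>
    (EuclideanSpace.proj (𝕜 := ℝ) i : Plane →L[ℝ] ℝ).hasFDerivAt.comp_hasDerivAt s hf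
  have norm2 : ∀ y : Plane, ‖y‖ ^ 2 = y 0 ^ 2 + y 1 ^ 2 := by
    intro y
    rw [EuclideanSpace.norm_sq_eq, Fin.sum_univ_two]
    simp
  have hcont : ∀ i : Fin 2, ContinuousOn (fun s => deriv (deriv Γ) s i) (Ioo (-ε) ε) := fun i =>
    (EuclideanSpace.proj (𝕜 := ℝ) i : Plane →L[ℝ] ℝ).continuous.comp_continuousOn hsm2.continuousOn
  refine ⟨ε, fun s => Γ s 0, fun s => Γ s 1, fun s => deriv Γ s 0, fun s => deriv Γ s 1,
    fun s => deriv (deriv Γ) s 0, fun s => deriv (deriv Γ) s 1, hε, ⟨?_, ?_, ?_, ?_, ?_, ?_, ?_, ?_⟩,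
    by simp only [h0], by simp only [h0], ?_⟩
  · intro s hs
    have h1 : Γ s ∈ frontier C ∩ W := himg ▸ mem_image_of_mem Γ hs
    have h2 : (!₂[Γ s 0, Γ s 1] : Plane) = Γ s := by ext i; fin_cases i <;> simp
    rw [h2]; exact h1.1
  · exact fun s hs => proj 0 _ _ _ (hd s hs)
  · exact fun s hs => proj 1 _ _ _ (hd s hs)
  · exact fun s hs => proj 0 _ _ _ (hd1 s hs)
  · exact fun s hs => proj 1 _ _ _ (hd1 s hs)
  · exact hcont 0
  · exact hcont 1
  · intro s hs
    rw [← norm2, hunit s hs, one_pow]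
  · rw [← norm2]; gcongr

/-- Strict support at interior points. -/
theorem support_lt_of_mem_interior {C : Set Plane} {P z : Plane} {θ : ℝ}
    (hsupp : ∀ y ∈ C, Real.cos θ * (y 0 - P 0) + Real.sin θ * (y 1 - P 1) ≤ 0)
    (hz : z ∈ interior C) : Real.cos θ * (z 0 - P 0) + Real.sin θ * (z 1 - P 1) < 0 := by
  have hc : Continuous (fun t : ℝ => z + t • (!₂[Real.cos θ, Real.sin θ] : Plane)) := by fun_prop
  have h1 : ∀ᶠ t in nhds (0 : ℝ), z + t • (!₂[Real.cos θ, Real.sin θ] : Plane) ∈ interior C := by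
    apply hc.continuousAt.eventually
    simp only [zero_smul, add_zero]
    exact isOpen_interior.mem_nhds hz
  obtain ⟨t, ht, ht0⟩ := ((h1.filter_mono nhdsWithin_le_nhds).and
    (self_mem_nhdsWithin (a := (0 : ℝ)) (s := Ioi 0))).exists
  have := hsupp _ (interior_subset ht)
  simp only [PiLp.add_apply, PiLp.smul_apply, Matrix.cons_val_zero, Matrix.cons_val_one,
    Matrix.cons_val_fin_one, smul_eq_mul] at this
  have ht0 : 0 < t := ht0
  have hsc := Real.sin_sq_add_cos_sq θ
  nlinarith

section Arc

variable {C : Set Plane} {ε : ℝ} {X Y T U N V : ℝ → ℝ}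

theorem UnitSpeedArc.velocity_orthogonal_support (h : UnitSpeedArc C ε X Y T U N V)
    (hcl : IsClosed C) {s : ℝ} (hs : s ∈ Ioo (-ε) ε) {a b : ℝ}
    (hsupp : ∀ y ∈ C, a * (y 0 - X s) + b * (y 1 - Y s) ≤ 0) : a * T s + b * U s = 0 := by
  have hd : HasDerivAt (fun u => a * (X u - X s) + b * (Y u - Y s)) (a * T s + b * U s) s :=
    (((h.derivX s hs).sub_const _).const_mul a).add (((h.derivY s hs).sub_const _).const_mul b)
  apply IsLocalMax.hasDerivAt_eq_zero _ hd
  filter_upwards [isOpen_Ioo.mem_nhds hs] with u hu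
  have := hsupp _ (hcl.frontier_subset (h.mem u hu))
  simpa using this

theorem UnitSpeedArc.velocity_orthogonal_acceleration (h : UnitSpeedArc C ε X Y T U N V)
    {s : ℝ} (hs : s ∈ Ioo (-ε) ε) : T s * N s + U s * V s = 0 := by
  have hd : HasDerivAt (fun u => T u ^ 2 + U u ^ 2) (2 * T s ^ 1 * N s + 2 * U s ^ 1 * V s) s :=
    ((h.derivT s hs).pow 2).add ((h.derivU s hs).pow 2)
  have hc : HasDerivAt (fun u => T u ^ 2 + U u ^ 2) 0 s := by
    apply (hasDerivAt_const s (1 : ℝ)).congr_of_eventuallyEq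
    filter_upwards [isOpen_Ioo.mem_nhds hs] with u hu using h.unit u hu
  have := hd.unique hc
  linarith

/-- Velocity is orthogonal both to the outer normal and to the acceleration, so in the plane the
acceleration is a multiple of the normal, of modulus at least `κ`. Its sign is fixed by the
second-order condition at the maximum of the support functional along the arc. -/
theorem UnitSpeedArc.acceleration_le (h : UnitSpeedArc C ε X Y T U N V) (hε : 0 < ε)
    (hcl : IsClosed C) {κ : ℝ} (hκ : 0 < κ) (hk : κ ^ 2 ≤ N 0 ^ 2 + V 0 ^ 2) {θ : ℝ}
    (hsupp : ∀ y ∈ C, Real.cos θ * (y 0 - X 0) + Real.sin θ * (y 1 - Y 0) ≤ 0) :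
    Real.cos θ * N 0 + Real.sin θ * V 0 ≤ -κ := by
  have h0 : (0 : ℝ) ∈ Ioo (-ε) ε := ⟨by linarith, hε⟩
  have hT := h.velocity_orthogonal_support hcl h0 hsupp
  have hTN := h.velocity_orthogonal_acceleration h0
  have hTU := h.unit 0 h0
  have hsc := Real.sin_sq_add_cos_sq θ
  set φ := fun u => Real.cos θ * X u + Real.sin θ * Y u with hφ
  have hI := isOpen_Ioo.mem_nhds h0
  have hdφ : ∀ u ∈ Ioo (-ε) ε, HasDerivAt φ (Real.cos θ * T u + Real.sin θ * U u) u := fun u hu =>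
    ((h.derivX u hu).const_mul _).add ((h.derivY u hu).const_mul _)
  have hdφ' : deriv φ =ᶠ[nhds 0] fun u => Real.cos θ * T u + Real.sin θ * U u := by
    filter_upwards [hI] with u hu using (hdφ u hu).deriv
  have hdd : deriv (deriv φ) 0 = Real.cos θ * N 0 + Real.sin θ * V 0 := by
    rw [hdφ'.deriv_eq]
    exact (((h.derivT 0 h0).const_mul _).add ((h.derivU 0 h0).const_mul _)).deriv
  have hmax : IsLocalMax φ 0 := by
    filter_upwards [hI] with u hu
    have := hsupp _ (hcl.frontier_subset (h.mem u hu))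
    simp only [Matrix.cons_val_zero, Matrix.cons_val_one, Matrix.cons_val_fin_one] at this
    simp only [hφ]; linarith
  have hle : Real.cos θ * N 0 + Real.sin θ * V 0 ≤ 0 := by
    -- A positive second derivative would make `0` a local minimum as well as a local maximum, so
    -- `φ` would be locally constant.
    by_contra! hcon
    rw [← hdd] at hcon
    have hmin : IsLocalMin φ 0 := isLocalMin_of_deriv_deriv_pos hcon
      (by rw [hdφ'.eq_of_nhds]; exact hT) (hdφ 0 h0).continuousAt
    have hcst : φ =ᶠ[nhds 0] fun _ => φ 0 := by
      filter_upwards [hmax, hmin] with u h1 h2 using le_antisymm h1 h2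
    have h1 : deriv φ =ᶠ[nhds 0] fun _ => 0 := by
      have := hcst.deriv
      simpa using this
    have h2 : deriv (deriv φ) 0 = 0 := by rw [h1.deriv_eq]; simp
    linarith
  have hE : -Real.sin θ * N 0 + Real.cos θ * V 0 = 0 := by
    have hTe : (T 0 * -Real.sin θ + U 0 * Real.cos θ) ^ 2 = 1 := by
      have : (T 0 * -Real.sin θ + U 0 * Real.cos θ) ^ 2 + (Real.cos θ * T 0 + Real.sin θ * U 0) ^ 2
          = (T 0 ^ 2 + U 0 ^ 2) * (Real.sin θ ^ 2 + Real.cos θ ^ 2) := by ring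
      rw [hT, hTU, hsc] at this
      linarith
    have hprod : (T 0 * -Real.sin θ + U 0 * Real.cos θ) * (-Real.sin θ * N 0 + Real.cos θ * V 0) = 0 := by
      have : (T 0 * -Real.sin θ + U 0 * Real.cos θ) * (-Real.sin θ * N 0 + Real.cos θ * V 0) =
        (T 0 * N 0 + U 0 * V 0) * (Real.sin θ ^ 2 + Real.cos θ ^ 2) - 
          (Real.cos θ * T 0 + Real.sin θ * U 0) * (Real.cos θ * N 0 + Real.sin θ * V 0) := by ring
      rw [this, hTN, hT]; ring
    rcases mul_eq_zero.mp hprod with h1 | h1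
    · rw [h1] at hTe; norm_num at hTe
    · exact h1
  have hsq : (Real.cos θ * N 0 + Real.sin θ * V 0) ^ 2 = N 0 ^ 2 + V 0 ^ 2 := by
    have : (Real.cos θ * N 0 + Real.sin θ * V 0) ^ 2 + (-Real.sin θ * N 0 + Real.cos θ * V 0) ^ 2 =
      (N 0 ^ 2 + V 0 ^ 2) * (Real.sin θ ^ 2 + Real.cos θ ^ 2) := by ring
    rw [hE, hsc] at this
    linarith
  nlinarith

/-- Near a point of the arc, the body lies on a constant side of the tangent lines. -/
theorem UnitSpeedArc.eventually_tangent_support (h : UnitSpeedArc C ε X Y T U N V) (hε : 0 < ε)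
    (hconv : Convex ℝ C) (hcl : IsClosed C) (hint : (interior C).Nonempty) {θ : ℝ}
    (hsupp : ∀ y ∈ C, Real.cos θ * (y 0 - X 0) + Real.sin θ * (y 1 - Y 0) ≤ 0) :
    ∃ σ : ℝ, σ ^ 2 = 1 ∧ σ * U 0 = Real.cos θ ∧ -σ * T 0 = Real.sin θ ∧
      ∀ᶠ u in nhds (0 : ℝ), ∀ y ∈ C, σ * U u * (y 0 - X u) + -σ * T u * (y 1 - Y u) ≤ 0 := by
  have h0 : (0 : ℝ) ∈ Ioo (-ε) ε := ⟨by linarith, hε⟩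
  have hT := h.velocity_orthogonal_support hcl h0 hsupp
  have hTU := h.unit 0 h0
  have hsc := Real.sin_sq_add_cos_sq θ
  have hI := isOpen_Ioo.mem_nhds h0
  -- The orientation sign: `σ (U, -T)` is the outer unit normal at parameter `0`.
  set σ := U 0 * Real.cos θ - T 0 * Real.sin θ with hσ
  have hσ1 : σ * U 0 = Real.cos θ := by
    rw [hσ]
    linear_combination (-T 0) * hT + Real.cos θ * hTU
  have hσ2 : -σ * T 0 = Real.sin θ := by
    rw [hσ]
    linear_combination (-U 0) * hT + Real.sin θ * hTU
  have hσ3 : σ ^ 2 = 1 := by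
    have : σ ^ 2 * (T 0 ^ 2 + U 0 ^ 2) = (σ * U 0) ^ 2 + (-σ * T 0) ^ 2 := by ring
    rw [hTU, hσ1, hσ2] at this
    linarith
  refine ⟨σ, hσ3, hσ1, hσ2, ?_⟩
  obtain ⟨z, hz⟩ := hint
  have hz0 := support_lt_of_mem_interior (P := !₂[X 0, Y 0]) (θ := θ) (by simpa using hsupp) hz
  simp only [Matrix.cons_val_zero, Matrix.cons_val_one, Matrix.cons_val_fin_one] at hz0
  have hG : ContinuousAt (fun u => σ * U u * (z 0 - X u) + -σ * T u * (z 1 - Y u)) 0 := by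
    have h1 := (h.derivX 0 h0).continuousAt
    have h2 := (h.derivY 0 h0).continuousAt
    have h3 := (h.derivT 0 h0).continuousAt
    have h4 := (h.derivU 0 h0).continuousAt
    fun_prop
  -- One interior point, strictly on the inner side at parameter `0`, remains so nearby by
  -- continuity. It forces the supporting normal at `u` to be a positive multiple of `σ (U u, -T
  -- u)`.
  have hG0 : ∀ᶠ u in nhds (0 : ℝ), σ * U u * (z 0 - X u) + -σ * T u * (z 1 - Y u) < 0 := by
    apply hG.eventually (gt_mem_nhds _)
    simpa [hσ1, hσ2] using hz0
  filter_upwards [hG0, hI] with u hGu hu y hy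
  obtain ⟨a, b, h1, h2⟩ := exists_supporting_line hconv ⟨z, hz⟩ (h.mem u hu)
  simp only [Matrix.cons_val_zero, Matrix.cons_val_one, Matrix.cons_val_fin_one] at h1 h2
  have hab := h.velocity_orthogonal_support hcl hu h1
  have hu1 := h.unit u hu
  have ha : a = (a * U u - b * T u) * U u := by
    linear_combination T u * hab - a * hu1
  have hb : b = -(a * U u - b * T u) * T u := by
    linear_combination U u * hab - b * hu1
  set l := a * U u - b * T u
  have key : ∀ w : Plane, a * (w 0 - X u) + b * (w 1 - Y u) =
      (σ * l) * (σ * U u * (w 0 - X u) + -σ * T u * (w 1 - Y u)) := by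
    intro w
    rw [ha, hb]
    linear_combination (-l * (U u * (w 0 - X u) - T u * (w 1 - Y u))) * hσ3
  have hl : 0 < σ * l := by
    have := h2 z hz
    rw [key z] at this
    by_contra! hcon
    nlinarith
  have := h1 y hy
  rw [key y] at this
  by_contra! hcon
  nlinarith

end Arc

theorem le_neg_of_mul_le {κ μ a A D p q : ℝ} (hκ : 0 < κ) (hμ : 0 ≤ μ) (ha : 0 ≤ a) (hA : 0 < A)
    (hA1 : A ≤ 1) (h : A * D ≤ p * q) (hp : p ≤ -κ / 2 * μ) (hq : a / 2 ≤ q) :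
    D ≤ -(κ / 4 * (μ * a)) := by
  have hnn : 0 ≤ κ / 4 * (μ * a) := by positivity
  have h3 : 0 ≤ κ / 2 * μ := by positivity
  have h2 : p * q ≤ (-κ / 2 * μ) * (a / 2) := by nlinarith
  have hB : A * D ≤ -(κ / 4 * (μ * a)) := by linarith
  have : D ≤ 0 := by
    by_contra! hcon
    have := mul_pos hA hcon
    linarith
  nlinarith

section ArcSupport

variable {C : Set Plane} {ε : ℝ} {X Y T U N V : ℝ → ℝ}

set_option maxHeartbeats 800000 in
/-- The chord estimate at a point `s` of an arc, in the direction normal to the arc at `s`, when the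
tangential velocity `φ'` in that direction is strictly decreasing. -/
theorem quadSupport_of_arc (h : UnitSpeedArc C ε X Y T U N V) (hcl : IsClosed C)
    (hbox : ∀ x ∈ C, ∀ i, x i ∈ Ioo (-1 / 2 : ℝ) (1 / 2)) {κ η s σ θ : ℝ} (hκ : 0 < κ) (hη : 0 < η)
    (hηε : η < ε) (hσ : σ ^ 2 = 1)
    (hsup : ∀ u ∈ Icc (-η) η, ∀ y ∈ C, σ * U u * (y 0 - X u) + -σ * T u * (y 1 - Y u) ≤ 0)
    (hpos : ∀ u ∈ Icc (-η) η, 0 < σ * U u * Real.cos θ + -σ * T u * Real.sin θ)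
    (hdec : ∀ u ∈ Icc (-η) η, ∀ v ∈ Icc (-η) η, u ≤ v →
      (Real.cos θ * T v + Real.sin θ * U v) - (Real.cos θ * T u + Real.sin θ * U u) ≤
        -κ / 2 * (v - u))
    (hs : s ∈ Icc (-(η / 2)) (η / 2)) (hs0 : Real.cos θ * T s + Real.sin θ * U s = 0) :
    QuadSupport C θ (κ / 8 * min 1 (η / 2)) := by
  have hsI : s ∈ Icc (-η) η := ⟨by linarith [hs.1], by linarith [hs.2]⟩
  have hIε : ∀ u ∈ Icc (-η) η, u ∈ Ioo (-ε) ε := fun u hu => ⟨by linarith [hu.1], by linarith [hu.2]⟩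
  have hsc := Real.sin_sq_add_cos_sq θ
  -- the normal at `s`
  have hTUs := h.unit s (hIε s hsI)
  have hA1 : σ * U s * Real.cos θ + -σ * T s * Real.sin θ = 1 := by
    have h1 : (σ * U s * Real.cos θ + -σ * T s * Real.sin θ) ^ 2 = 1 := by
      have : (σ * U s * Real.cos θ + -σ * T s * Real.sin θ) ^ 2 =
          σ ^ 2 * ((T s ^ 2 + U s ^ 2) * (Real.sin θ ^ 2 + Real.cos θ ^ 2) -
            (Real.cos θ * T s + Real.sin θ * U s) ^ 2) := by ring
      rw [this, hσ, hTUs, hsc, hs0]; norm_num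
    have h2 := hpos s hsI
    nlinarith
  have hM0 : σ * U s = Real.cos θ := by
    linear_combination Real.cos θ * hA1 + σ * Real.sin θ * hs0 - σ * U s * hsc
  have hM1 : -σ * T s = Real.sin θ := by
    linear_combination Real.sin θ * hA1 - σ * Real.cos θ * hs0 + σ * T s * hsc
  have hsup_s := hsup s hsI
  rw [hM0, hM1] at hsup_s
  have hPC : !₂[X s, Y s] ∈ C := hcl.frontier_subset (h.mem s (hIε s hsI))
  refine ⟨_, hPC, fun y hy => ?_⟩
  have hQ0 := hbox _ hPC 0
  have hQ1 := hbox _ hPC 1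
  have hy0 := hbox _ hy 0
  have hy1 := hbox _ hy 1
  simp only [Matrix.cons_val_zero, Matrix.cons_val_one, Matrix.cons_val_fin_one] at hQ0 hQ1 ⊢
  set t := -(y 0 - X s) * Real.sin θ + (y 1 - Y s) * Real.cos θ with ht
  have ht2 : |t| ≤ 2 := by
    have h1 : |-(y 0 - X s)| ≤ 1 := by
      rw [abs_le]; constructor <;> linarith [hQ0.1, hQ0.2, hy0.1, hy0.2]
    have h2 : |y 1 - Y s| ≤ 1 := by
      rw [abs_le]; constructor <;> linarith [hQ1.1, hQ1.2, hy1.1, hy1.2]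
    calc |t| ≤ |-(y 0 - X s) * Real.sin θ| + |(y 1 - Y s) * Real.cos θ| := abs_add_le _ _
      _ = |-(y 0 - X s)| * |Real.sin θ| + |y 1 - Y s| * |Real.cos θ| := by rw [abs_mul, abs_mul]
      _ ≤ 1 * 1 + 1 * 1 := by
        gcongr
        · exact Real.abs_sin_le_one θ
        · exact Real.abs_cos_le_one θ
      _ = 2 := by norm_num
  -- The distance to travel along the arc towards `y`: at most `|t| / 2`, so that `y` still lies
  -- `|t| / 2` ahead tangentially, and at most `η / 2`, so that `u` stays in the interval.
  set μ := min |t| η / 2 with hμ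
  have hμ0 : 0 ≤ μ := by positivity
  have hμt : μ ≤ |t| / 2 := by rw [hμ]; gcongr; exact min_le_left _ _
  have hμη : μ ≤ η / 2 := by rw [hμ]; gcongr; exact min_le_right _ _
  obtain ⟨ς, hς2, hςt⟩ : ∃ ς : ℝ, (ς = 1 ∨ ς = -1) ∧ ς * (σ * t) = |t| := by
    have : |t| = |σ * t| := by
      rw [abs_mul]
      have : |σ| = 1 := by rw [← sq_eq_sq₀ (abs_nonneg _) zero_le_one, sq_abs, hσ, one_pow]
      rw [this, one_mul]
    rw [this]
    rcases le_or_gt 0 (σ * t) with h1 | h1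
    · exact ⟨1, Or.inl rfl, by rw [abs_of_nonneg h1, one_mul]⟩
    · exact ⟨-1, Or.inr rfl, by rw [abs_of_neg h1]; ring⟩
  set u := s + ς * μ with hu
  have huI : u ∈ Icc (-η) η := by
    rcases hς2 with rfl | rfl <;> constructor <;> rw [hu] <;> linarith [hs.1, hs.2]
  have hφu : ς * (Real.cos θ * T u + Real.sin θ * U u) ≤ -κ / 2 * μ := by
    rcases hς2 with rfl | rfl
    · have := hdec s hsI u huI (by rw [hu]; linarith)
      rw [hs0] at this
      have e : u - s = μ := by rw [hu]; ring
      rw [e] at this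
      linarith
    · have := hdec u huI s hsI (by rw [hu]; linarith)
      rw [hs0] at this
      have e : s - u = μ := by rw [hu]; ring
      rw [e] at this
      linarith
  -- the arc has unit speed
  have harc : |(-(X u - X s) * Real.sin θ + (Y u - Y s) * Real.cos θ)| ≤ μ := by
    have hder : ∀ w ∈ Icc (-η) η, HasDerivWithinAt (fun w => -X w * Real.sin θ + Y w * Real.cos θ)
        (-T w * Real.sin θ + U w * Real.cos θ) (Icc (-η) η) w := fun w hw =>
      ((((h.derivX w (hIε w hw)).neg).mul_const _).add
        ((h.derivY w (hIε w hw)).mul_const _)).hasDerivWithinAt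
    have hb : ∀ w ∈ Icc (-η) η, ‖-T w * Real.sin θ + U w * Real.cos θ‖ ≤ 1 := by
      intro w hw
      rw [Real.norm_eq_abs]
      apply abs_le_one_iff_mul_self_le_one.mpr
      have h1 := h.unit w (hIε w hw)
      have : (-T w * Real.sin θ + U w * Real.cos θ) ^ 2 + (Real.cos θ * T w + Real.sin θ * U w) ^ 2
          = (T w ^ 2 + U w ^ 2) * (Real.sin θ ^ 2 + Real.cos θ ^ 2) := by ring
      rw [h1, hsc] at this
      nlinarith [sq_nonneg (Real.cos θ * T w + Real.sin θ * U w)]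
    have := (convex_Icc (-η) η).norm_image_sub_le_of_norm_hasDerivWithin_le hder hb hsI huI
    rw [Real.norm_eq_abs, Real.norm_eq_abs, one_mul] at this
    have e1 : |u - s| = μ := by
      rw [hu, add_sub_cancel_left, abs_mul, abs_of_nonneg hμ0]
      rcases hς2 with rfl | rfl <;> simp
    rw [e1] at this
    convert this using 2
    ring
  set e := -(y 0 - X u) * Real.sin θ + (y 1 - Y u) * Real.cos θ with he
  have hee : |t| - μ ≤ ς * (σ * e) := by
    have h1 : ς * (σ * e) = |t| - ς * (σ * (-(X u - X s) * Real.sin θ + (Y u - Y s) * Real.cos θ)) := by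
      rw [← hςt, he, ht]; ring
    have h2 : |ς * (σ * (-(X u - X s) * Real.sin θ + (Y u - Y s) * Real.cos θ))| ≤ μ := by
      have h3 : |σ| = 1 := by rw [← sq_eq_sq₀ (abs_nonneg _) zero_le_one, sq_abs, hσ, one_pow]
      have h4 : |ς| = 1 := by rcases hς2 with rfl | rfl <;> simp
      rw [abs_mul, abs_mul, h3, h4, one_mul, one_mul]
      exact harc
    have h3 := (abs_le.mp h2).2
    linarith
  set D := (y 0 - X u) * Real.cos θ + (y 1 - Y u) * Real.sin θ with hD
  set A := σ * U u * Real.cos θ + -σ * T u * Real.sin θ with hA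
  -- The support inequality at `u`, written in the normal and tangent frame of direction `θ`. The
  -- tangent line at `u` has turned by an amount proportional to `μ`, so lying below it pushes `y`
  -- down by a multiple of `μ |t|`.
  have hAD : A * D ≤ (ς * (Real.cos θ * T u + Real.sin θ * U u)) * (ς * (σ * e)) := by
    have hς3 : ς ^ 2 = 1 := by rcases hς2 with rfl | rfl <;> norm_num
    have h1 := hsup u huI y hy
    have h2 : A * D - (ς * (Real.cos θ * T u + Real.sin θ * U u)) * (ς * (σ * e)) =
        σ * U u * (y 0 - X u) + -σ * T u * (y 1 - Y u) := by
      rw [hA, hD, he]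
      linear_combination (σ * U u * (y 0 - X u) + -σ * T u * (y 1 - Y u)) * hsc -
        ((Real.cos θ * T u + Real.sin θ * U u) * σ *
          (-(y 0 - X u) * Real.sin θ + (y 1 - Y u) * Real.cos θ)) * hς3
    linarith
  have hA0 : 0 < A := hpos u huI
  have hA1 : A ≤ 1 := by
    have h1 := h.unit u (hIε u huI)
    have : A ^ 2 + (Real.cos θ * T u + Real.sin θ * U u) ^ 2 = 1 := by
      have : A ^ 2 + σ ^ 2 * (Real.cos θ * T u + Real.sin θ * U u) ^ 2
          = σ ^ 2 * ((T u ^ 2 + U u ^ 2) * (Real.sin θ ^ 2 + Real.cos θ ^ 2)) := by rw [hA]; ring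
      rw [hσ, h1, hsc] at this
      linarith
    nlinarith [sq_nonneg (Real.cos θ * T u + Real.sin θ * U u)]
  have hD1 : D ≤ -(κ / 4 * (μ * |t|)) :=
    le_neg_of_mul_le hκ hμ0 (abs_nonneg t) hA0 hA1 hAD hφu (by linarith)
  -- The arc point at `u` is itself below the supporting line at `s`, so the drop measured from `u`
  -- bounds the drop measured from `s`.
  have hPu := hsup_s _ (hcl.frontier_subset (h.mem u (hIε u huI)))
  simp only [Matrix.cons_val_zero, Matrix.cons_val_one, Matrix.cons_val_fin_one] at hPu
  have hfin : (X s - y 0) * Real.cos θ + (Y s - y 1) * Real.sin θ ≥ κ / 4 * (μ * |t|) := by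
    rw [hD] at hD1
    linarith
  refine le_trans ?_ hfin
  have hmin : min 1 (η / 2) * |t| ≤ 2 * μ := by
    rw [hμ, mul_div_cancel₀ _ two_ne_zero]
    apply le_min
    · exact mul_le_of_le_one_left (abs_nonneg _) (min_le_left _ _)
    · calc min 1 (η / 2) * |t| ≤ η / 2 * 2 := by gcongr; exact min_le_right _ _
        _ = η := by ring
  calc κ / 8 * min 1 (η / 2) * t ^ 2 = κ / 8 * (min 1 (η / 2) * |t|) * |t| := by
        rw [← sq_abs t]; ring
    _ ≤ κ / 8 * (2 * μ) * |t| := by gcongr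
    _ = κ / 4 * (μ * |t|) := by ring

/-- By continuity the normal acceleration stays below `-κ / 2` for nearby points and directions. The
derivative of the support functional along the arc is then strictly decreasing, with a zero near `0`
by the intermediate value theorem; that zero is the contact point. -/
theorem quadSupport_near_arc (h : UnitSpeedArc C ε X Y T U N V) (hε : 0 < ε) (hconv : Convex ℝ C)
    (hcl : IsClosed C) (hint : (interior C).Nonempty)
    (hbox : ∀ x ∈ C, ∀ i, x i ∈ Ioo (-1 / 2 : ℝ) (1 / 2)) {κ : ℝ} (hκ : 0 < κ)
    (hk : κ ^ 2 ≤ N 0 ^ 2 + V 0 ^ 2) {θ₀ : ℝ}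
    (hsupp : ∀ y ∈ C, Real.cos θ₀ * (y 0 - X 0) + Real.sin θ₀ * (y 1 - Y 0) ≤ 0) :
    ∃ c : ℝ, 0 < c ∧ ∀ᶠ θ in nhds θ₀, QuadSupport C θ c := by
  have h0 : (0 : ℝ) ∈ Ioo (-ε) ε := ⟨by linarith, hε⟩
  have hI := isOpen_Ioo.mem_nhds h0
  have hsc := Real.sin_sq_add_cos_sq θ₀
  have hacc := h.acceleration_le hε hcl hκ hk hsupp
  have hT0 := h.velocity_orthogonal_support hcl h0 hsupp
  obtain ⟨σ, hσ, hσU, hσT, hev⟩ := h.eventually_tangent_support hε hconv hcl hint hsupp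
  have cT : ContinuousAt (fun p : ℝ × ℝ => T p.1) (0, θ₀) :=
    ContinuousAt.comp (f := Prod.fst) (h.derivT 0 h0).continuousAt continuousAt_fst
  have cU : ContinuousAt (fun p : ℝ × ℝ => U p.1) (0, θ₀) :=
    ContinuousAt.comp (f := Prod.fst) (h.derivU 0 h0).continuousAt continuousAt_fst
  have cN : ContinuousAt (fun p : ℝ × ℝ => N p.1) (0, θ₀) :=
    ContinuousAt.comp (f := Prod.fst) (h.contN.continuousAt hI) continuousAt_fst
  have cV : ContinuousAt (fun p : ℝ × ℝ => V p.1) (0, θ₀) :=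
    ContinuousAt.comp (f := Prod.fst) (h.contV.continuousAt hI) continuousAt_fst
  have cc : ContinuousAt (fun p : ℝ × ℝ => Real.cos p.2) (0, θ₀) := by fun_prop
  have cs : ContinuousAt (fun p : ℝ × ℝ => Real.sin p.2) (0, θ₀) := by fun_prop
  have ev1 : ∀ᶠ p : ℝ × ℝ in nhds (0, θ₀),
      0 < σ * U p.1 * Real.cos p.2 + -σ * T p.1 * Real.sin p.2 := by
    have : ContinuousAt (fun p : ℝ × ℝ => σ * U p.1 * Real.cos p.2 + -σ * T p.1 * Real.sin p.2)
        (0, θ₀) :=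
      ((continuousAt_const.mul cU).mul cc).add ((continuousAt_const.mul cT).mul cs)
    apply this.eventually (lt_mem_nhds _)
    simp only [hσU, hσT]
    nlinarith
  have ev2 : ∀ᶠ p : ℝ × ℝ in nhds (0, θ₀),
      Real.cos p.2 * N p.1 + Real.sin p.2 * V p.1 < -κ / 2 := by
    have : ContinuousAt (fun p : ℝ × ℝ => Real.cos p.2 * N p.1 + Real.sin p.2 * V p.1)
        (0, θ₀) :=
      (cc.mul cN).add (cs.mul cV)
    apply this.eventually (gt_mem_nhds _)
    simp only
    linarith
  obtain ⟨pa, hpa, pb, hpb, hpab⟩ := Filter.eventually_prod_iff.mp (nhds_prod_eq (x := (0:ℝ)) (y := θ₀) ▸ (ev1.and ev2))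
  obtain ⟨ρ, hρ, hball⟩ := Metric.eventually_nhds_iff.mp (hpa.and (hev.and hI))
  set η := ρ / 2 with hη
  have hη0 : 0 < η := by positivity
  have hηI : ∀ u ∈ Icc (-η) η, dist u 0 < ρ := by
    intro u hu
    rw [Real.dist_eq, sub_zero]
    have := abs_le.mpr hu
    linarith
  have hηε : η < ε := (hball (hηI η ⟨by linarith, le_rfl⟩)).2.2.2
  refine ⟨κ / 8 * min 1 (η / 2), by positivity, ?_⟩
  -- The threshold is what a decrease at rate `κ / 2` overcomes within `η / 2`, so the derivative
  -- changes sign on `[-η/2, η/2]`.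
  have ev3 : ∀ᶠ θ in nhds θ₀, |Real.cos θ * T 0 + Real.sin θ * U 0| < κ / 2 * (η / 2) := by
    have : Continuous (fun θ => |Real.cos θ * T 0 + Real.sin θ * U 0|) := by fun_prop
    apply this.continuousAt.eventually (gt_mem_nhds _)
    simp only [hT0, abs_zero]
    positivity
  filter_upwards [hpb, ev3] with θ hθ hθ3
  have hIε : ∀ u ∈ Icc (-η) η, u ∈ Ioo (-ε) ε := fun u hu => ⟨by linarith [hu.1], by linarith [hu.2]⟩
  have hder : ∀ u ∈ Icc (-η) η, HasDerivAt (fun u => Real.cos θ * T u + Real.sin θ * U u)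
      (Real.cos θ * N u + Real.sin θ * V u) u := fun u hu =>
    ((h.derivT u (hIε u hu)).const_mul _).add ((h.derivU u (hIε u hu)).const_mul _)
  have hcontφ : ContinuousOn (fun u => Real.cos θ * T u + Real.sin θ * U u) (Icc (-η) η) :=
    fun u hu => (hder u hu).continuousAt.continuousWithinAt
  have hdec : ∀ u ∈ Icc (-η) η, ∀ v ∈ Icc (-η) η, u ≤ v →
      (Real.cos θ * T v + Real.sin θ * U v) - (Real.cos θ * T u + Real.sin θ * U u) ≤
        -κ / 2 * (v - u) := by
    apply (convex_Icc (-η) η).image_sub_le_mul_sub_of_deriv_le hcontφ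
    · intro u hu
      exact (hder u (interior_subset hu)).differentiableAt.differentiableWithinAt
    · intro u hu
      rw [(hder u (interior_subset hu)).deriv]
      exact (hpab (hball (hηI u (interior_subset hu))).1 hθ).2.le
  have h00 : (0 : ℝ) ∈ Icc (-η) η := ⟨by linarith, hη0.le⟩
  have hpl : η / 2 ∈ Icc (-η) η := ⟨by linarith, by linarith⟩
  have hmi : -(η / 2) ∈ Icc (-η) η := ⟨by linarith, by linarith⟩
  have hθ3' := abs_lt.mp hθ3
  obtain ⟨s, hs, hs0⟩ : (0 : ℝ) ∈ (fun u => Real.cos θ * T u + Real.sin θ * U u) ''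
      Icc (-(η / 2)) (η / 2) := by
    apply intermediate_value_Icc' (by linarith)
      (hcontφ.mono (Icc_subset_Icc (by linarith) (by linarith)))
    have h1 := hdec 0 h00 _ hpl (by linarith)
    have h2 := hdec _ hmi 0 h00 (by linarith)
    constructor
    · linarith [hθ3'.2]
    · linarith [hθ3'.1]
  exact quadSupport_of_arc h hcl hbox hκ hη0 hηε hσ
    (fun u hu => (hball (hηI u hu)).2.1) (fun u hu => (hpab (hball (hηI u hu)).1 hθ).1) hdec hs hs0

end ArcSupport

/-! ### Quadratic support in all directions, by compactness. -/

/-- A flat body has support points of quadratic type in all directions, with a constant that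
degenerates only in the direction normal to the flat point. -/
theorem IsFlatBody.exists_quadSupport {γ : ℝ} (hγ : 2 < γ) {C : Set Plane} (hC : IsFlatBody γ C) :
    ∃ c : ℝ, 0 < c ∧ ∀ θ, QuadSupport C θ (c * |Real.cos θ| ^ ((γ - 2) / (γ - 1))) := by
  obtain ⟨hcomp, hconv, hbox, r, hr, hg, κ, hκ, hsm⟩ := hC
  have hcl := hcomp.isClosed
  have hint := interior_nonempty_of_flat hγ hconv hcl hr hg
  have hne : C.Nonempty := hint.mono interior_subset
  have he : 0 ≤ (γ - 2) / (γ - 1) := div_nonneg (by linarith) (by linarith)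
  have hlocal : ∀ θ₀ : ℝ, ∃ c : ℝ, 0 < c ∧ ∀ᶠ θ in nhds θ₀,
      QuadSupport C θ (c * |Real.cos θ| ^ ((γ - 2) / (γ - 1))) := by
    intro θ₀
    obtain ⟨P, hPC, hP⟩ := hcomp.exists_isMaxOn hne
      (f := fun y : Plane => Real.cos θ₀ * y 0 + Real.sin θ₀ * y 1) (by fun_prop)
    have hsupp : ∀ y ∈ C, Real.cos θ₀ * (y 0 - P 0) + Real.sin θ₀ * (y 1 - P 1) ≤ 0 := by
      intro y hy
      have := hP hy
      simp only [mem_ofPred_eq] at this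
      linarith
    have hPf : P ∈ frontier C := by
      rw [hcl.frontier_eq]
      refine ⟨hPC, fun hPi => ?_⟩
      have := support_lt_of_mem_interior hsupp hPi
      simp at this
    by_cases hPr : P ∈ Metric.ball (0 : Plane) (r / 2)
    · exact quadSupport_near_flat hγ hconv hcl hr hbox hg hPf
        (Metric.ball_subset_ball (by linarith) hPr) hsupp
    · obtain ⟨ε, X, Y, T, U, N, V, hε, harc, hX, hY, hk⟩ := (hsm P hPf hPr).exists_arc hκ
      rw [← hX, ← hY] at hsupp
      obtain ⟨c, hc, hev⟩ := quadSupport_near_arc harc hε hconv hcl hint hbox hκ hk hsupp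
      refine ⟨c, hc, hev.mono fun θ hθ => hθ.mono ?_⟩
      apply mul_le_of_le_one_right hc.le
      exact Real.rpow_le_one (abs_nonneg _) (Real.abs_cos_le_one θ) he
  choose f hf hev using hlocal
  obtain ⟨t, -, ht⟩ := (isCompact_Icc (a := (0 : ℝ)) (b := 2 * Real.pi)).elim_nhds_subcover
    (fun θ₀ => {θ | QuadSupport C θ (f θ₀ * |Real.cos θ| ^ ((γ - 2) / (γ - 1)))})
    (fun θ₀ _ => hev θ₀)
  obtain ⟨c, hc, hct⟩ : ∃ c : ℝ, 0 < c ∧ ∀ x ∈ t, c ≤ f x := by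
    rcases t.eq_empty_or_nonempty with rfl | htn
    · exact ⟨1, one_pos, by simp⟩
    · obtain ⟨x, hx, hmin⟩ := t.exists_min_image f htn
      exact ⟨f x, hf x, hmin⟩
  refine ⟨c, hc, fun θ => ?_⟩
  obtain ⟨θ', hθ', n, hn⟩ : ∃ θ' ∈ Icc (0 : ℝ) (2 * Real.pi), ∃ n : ℤ, θ = θ' + n * (2 * Real.pi) := by
    refine ⟨toIcoMod Real.two_pi_pos 0 θ, ?_, toIcoDiv Real.two_pi_pos 0 θ, ?_⟩
    · have := toIcoMod_mem_Ico Real.two_pi_pos 0 θ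
      rw [zero_add] at this
      exact Ico_subset_Icc_self this
    · have := toIcoMod_add_toIcoDiv_zsmul Real.two_pi_pos 0 θ
      rw [zsmul_eq_mul] at this
      exact this.symm
  have hq : QuadSupport C θ' (c * |Real.cos θ'| ^ ((γ - 2) / (γ - 1))) := by
    obtain ⟨x, hx⟩ := mem_iUnion.mp (ht hθ')
    obtain ⟨hxt, hx⟩ := mem_iUnion.mp hx
    exact QuadSupport.mono hx (by gcongr; exact hct x hxt)
  subst hn
  unfold QuadSupport at hq ⊢
  simpa only [Real.cos_add_int_mul_two_pi, Real.sin_add_int_mul_two_pi] using hq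

/-! ### Fourier decay from convexity and slices. -/

/-- Decay of the Fourier transform of a function that is midpoint concave on `[a, b]`, vanishes
outside, and behaves like a square root at the end points. -/
theorem norm_integral_mul_exp_le_of_concave {h : ℝ → ℝ} {a b M ρ : ℝ} (hρ : 0 < ρ) (hM : 0 ≤ M)
    (hint : Integrable h) (hnn : ∀ s, 0 ≤ h s)
    (hmid : ∀ s d, 0 ≤ d → a ≤ s → s + 2 * d ≤ b → h s + h (s + 2 * d) ≤ 2 * h (s + d))
    (ha : ∀ s, h s ≤ M * √(s - a)) (hb : ∀ s, h s ≤ M * √(b - s)) :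
    ‖∫ s, (h s : ℂ) * Complex.exp (((-2 * Real.pi * ρ * s : ℝ) : ℂ) * Complex.I)‖ ≤
      4 * M / ρ * √(1 / ρ) := by
  -- Half a period of the exponential: a shift by `d` changes its sign, so the second difference `Δ`
  -- of step `d` has transform four times that of `h`.
  set d := 1 / (2 * ρ) with hd
  have hd0 : 0 < d := by positivity
  have h2d : 2 * d = 1 / ρ := by rw [hd]; field_simp
  set e : ℝ → ℂ := fun s => Complex.exp (((-2 * Real.pi * ρ * s : ℝ) : ℂ) * Complex.I) with he
  have henorm : ∀ s, ‖e s‖ = 1 := fun s => Complex.norm_exp_ofReal_mul_I _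
  have hecont : Continuous e := by rw [he]; fun_prop
  have heshift : ∀ s, e (s - d) = - e s := by
    intro s
    have : ((-2 * Real.pi * ρ * (s - d) : ℝ) : ℂ) * Complex.I =
        ((-2 * Real.pi * ρ * s : ℝ) : ℂ) * Complex.I + Real.pi * Complex.I := by
      rw [← add_mul, ← Complex.ofReal_add]
      congr 2
      rw [hd]; field_simp; ring
    simp only [he]
    rw [this, Complex.exp_add, Complex.exp_pi_mul_I]; ring
  have hmul : ∀ f : ℝ → ℝ, Integrable f → Integrable fun s => (f s : ℂ) * e s := by
    intro f hf
    apply (hf.ofReal (𝕜 := ℂ)).mul_bdd (c := 1) hecont.aestronglyMeasurable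
    exact Filter.Eventually.of_forall fun s => (henorm s).le
  have hi1 : Integrable fun s => h (s + d) := hint.comp_add_right d
  have hi2 : Integrable fun s => h (s + 2 * d) := hint.comp_add_right (2 * d)
  have hs1 : ∫ s, (h (s + d) : ℂ) * e s = - ∫ s, (h s : ℂ) * e s := by
    rw [← integral_neg, ← integral_add_right_eq_self (fun s => -((h s : ℂ) * e s)) d]
    congr 1
    ext s
    rw [← mul_neg, ← heshift, add_sub_cancel_right]
  have hs2 : ∫ s, (h (s + 2 * d) : ℂ) * e s = ∫ s, (h s : ℂ) * e s := by
    rw [← integral_add_right_eq_self (fun s => ((h s : ℂ) * e s)) (2 * d)]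
    congr 1
    ext s
    have h1 := heshift (s + 2 * d)
    have h2 := heshift (s + d)
    rw [show s + 2 * d - d = s + d by ring] at h1
    rw [show s + d - d = s by ring] at h2
    rw [h2, h1, neg_neg]
  set Δ : ℝ → ℝ := fun s => h s - 2 * h (s + d) + h (s + 2 * d) with hΔ
  have hi1' : Integrable fun s => 2 * h (s + d) := hi1.const_mul 2
  have hi3 : Integrable fun s => h s - 2 * h (s + d) := hint.sub hi1'
  have hΔint : Integrable Δ := hi3.add hi2
  have hΔ0 : ∫ s, Δ s = 0 := by
    simp only [hΔ]
    rw [integral_add hi3 hi2, integral_sub hint hi1', integral_const_mul, integral_add_right_eq_self h, integral_add_right_eq_self h]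
    ring
  have hΔe : ∫ s, (Δ s : ℂ) * e s = 4 * ∫ s, (h s : ℂ) * e s := by
    have : ∀ s, (Δ s : ℂ) * e s = (h s : ℂ) * e s - 2 * ((h (s + d) : ℂ) * e s) +
        (h (s + 2 * d) : ℂ) * e s := by
      intro s; simp only [hΔ]; push_cast; ring
    simp_rw [this]
    have hc1 : Integrable fun s => 2 * ((h (s + d) : ℂ) * e s) := (hmul _ hi1).const_mul 2
    have hc2 : Integrable fun s => (h s : ℂ) * e s - 2 * ((h (s + d) : ℂ) * e s) :=
      (hmul _ hint).sub hc1
    rw [integral_add hc2 (hmul _ hi2), integral_sub (hmul _ hint) hc1, integral_const_mul, hs1, hs2]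
    ring
  set W := 4 * M * √(2 * d) with hW
  have hW0 : 0 ≤ W := by positivity
  -- Concavity makes `Δ ≤ 0` except on two end intervals of length `2 d`, where square-root growth
  -- gives `|Δ| ≤ W`. As `Δ` has integral zero, its `L¹` norm is controlled by these intervals
  -- alone.
  have hpt : ∀ s, |Δ s| ≤ -Δ s + ((Icc (a - 2 * d) a).indicator (fun _ => 2 * W) s +
      (Icc (b - 2 * d) b).indicator (fun _ => 2 * W) s) := by
    intro s
    have hi : ∀ u v : ℝ, 0 ≤ (Icc u v).indicator (fun _ => 2 * W) s := fun u v =>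
      indicator_nonneg (fun _ _ => by positivity) s
    have hza : ∀ u, u ≤ a → h u = 0 := fun u hu => by
      apply le_antisymm _ (hnn u)
      have := ha u
      rwa [Real.sqrt_eq_zero_of_nonpos (by linarith), mul_zero] at this
    have hzb : ∀ u, b ≤ u → h u = 0 := fun u hu => by
      apply le_antisymm _ (hnn u)
      have := hb u
      rwa [Real.sqrt_eq_zero_of_nonpos (by linarith), mul_zero] at this
    have hsm : ∀ u, u ≤ a + 2 * d ∨ b - 2 * d ≤ u → h u ≤ M * √(2 * d) := by
      rintro u (hu | hu)
      · exact (ha u).trans (by gcongr; linarith)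
      · exact (hb u).trans (by gcongr; linarith)
    have hsum : h s ≤ M * √(2 * d) → h (s + d) ≤ M * √(2 * d) → h (s + 2 * d) ≤ M * √(2 * d) →
        |Δ s| ≤ -Δ s + 2 * W := by
      intro h1 h2 h3
      have h4 : |Δ s| ≤ W := by
        rw [abs_le]
        simp only [hΔ, hW]
        constructor <;> linarith [hnn s, hnn (s + d), hnn (s + 2 * d)]
      linarith [le_abs_self (Δ s)]
    by_cases hsa : s < a
    · by_cases hsa2 : s < a - 2 * d
      · have : Δ s = 0 := by
          simp only [hΔ]
          rw [hza s (by linarith), hza (s + d) (by linarith), hza (s + 2 * d) (by linarith)]; ring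
        rw [this]
        simpa using add_nonneg (hi _ _) (hi _ _)
      · have hmem : s ∈ Icc (a - 2 * d) a := ⟨by linarith, hsa.le⟩
        have := hsum (hsm _ (Or.inl (by linarith))) (hsm _ (Or.inl (by linarith)))
          (hsm _ (Or.inl (by linarith)))
        rw [indicator_of_mem hmem]
        linarith [hi (b - 2 * d) b]
    · push Not at hsa
      by_cases hsb : s + 2 * d ≤ b
      · have h1 := hmid s d hd0.le hsa hsb
        have h2 : Δ s ≤ 0 := by simp only [hΔ]; linarith
        rw [abs_of_nonpos h2]
        linarith [hi (a - 2 * d) a, hi (b - 2 * d) b]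
      · push Not at hsb
        by_cases hsb2 : s ≤ b
        · have hmem : s ∈ Icc (b - 2 * d) b := ⟨by linarith, hsb2⟩
          have := hsum (hsm _ (Or.inr (by linarith))) (hsm _ (Or.inr (by linarith)))
            (hsm _ (Or.inr (by linarith)))
          rw [indicator_of_mem hmem]
          linarith [hi (a - 2 * d) a]
        · have : Δ s = 0 := by
            simp only [hΔ]
            rw [hzb s (by linarith), hzb (s + d) (by linarith), hzb (s + 2 * d) (by linarith)]; ring
          rw [this]
          simpa using add_nonneg (hi _ _) (hi _ _)
  have hind : ∀ u v : ℝ, Integrable ((Icc u v).indicator (fun _ => 2 * W)) := fun u v =>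
    (integrable_indicator_iff measurableSet_Icc).mpr (integrableOn_const (by simp))
  have hindval : ∀ u : ℝ, ∫ s, (Icc (u - 2 * d) u).indicator (fun _ => 2 * W) s = 2 * d * (2 * W) := by
    intro u
    rw [integral_indicator measurableSet_Icc, setIntegral_const, Real.volume_real_Icc,
      smul_eq_mul, max_eq_left (by linarith)]
    ring
  have hind2 : Integrable fun s => (Icc (a - 2 * d) a).indicator (fun _ => 2 * W) s +
      (Icc (b - 2 * d) b).indicator (fun _ => 2 * W) s := (hind _ _).add (hind _ _)
  have hΔneg : Integrable fun s => -Δ s := hΔint.neg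
  have hbound : ∫ s, |Δ s| ≤ 8 * W * d := by
    calc ∫ s, |Δ s| ≤ ∫ s, (-Δ s + ((Icc (a - 2 * d) a).indicator (fun _ => 2 * W) s +
        (Icc (b - 2 * d) b).indicator (fun _ => 2 * W) s)) :=
          integral_mono hΔint.abs (hΔneg.add hind2) hpt
      _ = 8 * W * d := by
        rw [integral_add hΔneg hind2, integral_add (hind _ _) (hind _ _),
          integral_neg, hΔ0, hindval, hindval]
        ring
  have hfin : 4 * ‖∫ s, (h s : ℂ) * e s‖ ≤ 8 * W * d := by
    have h4 : (4 : ℝ) * ‖∫ s, (h s : ℂ) * e s‖ = ‖∫ s, (Δ s : ℂ) * e s‖ := by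
      rw [hΔe, norm_mul]; norm_num
    rw [h4]
    refine (norm_integral_le_integral_norm _).trans (le_trans (le_of_eq ?_) hbound)
    congr 1
    ext s
    rw [norm_mul, henorm, mul_one, Complex.norm_real, Real.norm_eq_abs]
  have hWd : 8 * W * d = 4 * (4 * M / ρ * √(1 / ρ)) := by
    rw [hW, h2d, hd]; field_simp; ring
  linarith

/-- The rotation `rot θ` as a linear isometry equivalence. -/
noncomputable def rotIso (θ : ℝ) : Plane ≃ₗᵢ[ℝ] Plane where
  toFun := rot θ
  invFun := rot (-θ)
  map_add' x y := by
    ext i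
    fin_cases i <;> simp [rot] <;> ring
  map_smul' c x := by
    ext i
    fin_cases i <;> simp [rot] <;> ring
  left_inv x := by
    have hsc := Real.sin_sq_add_cos_sq θ
    ext i
    fin_cases i
    · simp [rot]; linear_combination x 0 * hsc
    · simp [rot]; linear_combination x 1 * hsc
  right_inv x := by
    have hsc := Real.sin_sq_add_cos_sq θ
    ext i
    fin_cases i
    · simp [rot]; linear_combination x 0 * hsc
    · simp [rot]; linear_combination x 1 * hsc
  norm_map' x := by
    have hsc := Real.sin_sq_add_cos_sq θ
    change ‖rot θ x‖ = ‖x‖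
    rw [EuclideanSpace.norm_eq, EuclideanSpace.norm_eq, Fin.sum_univ_two, Fin.sum_univ_two]
    congr 1
    simp only [rot, Real.norm_eq_abs, sq_abs, Matrix.cons_val_zero, Matrix.cons_val_one,
      Matrix.cons_val_fin_one]
    linear_combination (x 0 ^ 2 + x 1 ^ 2) * hsc

theorem measurePreserving_rot_pair (θ : ℝ) :
    MeasurePreserving (fun z : ℝ × ℝ => rot θ !₂[z.1, z.2]) := by
  have h1 := (volume_preserving_finTwoArrow ℝ).symm
  have h2 := PiLp.volume_preserving_toLp (Fin 2)
  have h3 := (rotIso θ).measurePreserving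
  exact h3.comp (h2.comp h1)

section Slices

variable {C : Set Plane} {θ : ℝ}

/-- The length of the slice of `C` by the line `{x | ⟪x, Θ⟫ = s}`, where `Θ = (cos θ, sin θ)`. -/
noncomputable def sliceLength (C : Set Plane) (θ s : ℝ) : ℝ :=
  volume.real {u : ℝ | rot θ !₂[s, u] ∈ C}

theorem continuous_rot_pair (θ : ℝ) : Continuous (fun z : ℝ × ℝ => rot θ !₂[z.1, z.2]) := by
  unfold rot
  fun_prop

theorem measurableSet_rot_pair (hC : MeasurableSet C) :
    MeasurableSet {z : ℝ × ℝ | rot θ !₂[z.1, z.2] ∈ C} :=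
  (continuous_rot_pair θ).measurable hC

theorem volume_rot_pair (hC : MeasurableSet C) :
    volume {z : ℝ × ℝ | rot θ !₂[z.1, z.2] ∈ C} = volume C :=
  (measurePreserving_rot_pair θ).measure_preimage hC.nullMeasurableSet

theorem integrable_sliceLength (hC : MeasurableSet C) (hfin : volume C ≠ ⊤) :
    Integrable (sliceLength C θ) := by
  have := Measure.integrable_measure_prodMk_left (μ := (volume : Measure ℝ)) (ν := (volume : Measure ℝ))
    (measurableSet_rot_pair (θ := θ) hC) (by
      rw [← Measure.volume_eq_prod, volume_rot_pair hC]; exact hfin)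
  exact this

/-- Fubini in coordinates rotated so that the phase depends on the first variable only. -/
theorem integral_eq_integral_sliceLength (hC : MeasurableSet C) (hfin : volume C ≠ ⊤) {F : ℝ → ℂ}
    (hF : Continuous F) {K : ℝ} (hK : ∀ s, ‖F s‖ ≤ K) :
    ∫ x in C, F (x 0 * Real.cos θ + x 1 * Real.sin θ) =
      ∫ s, (sliceLength C θ s : ℂ) * F s := by
  set Φ : ℝ × ℝ → Plane := fun z => rot θ !₂[z.1, z.2] with hΦ
  have hmp : MeasurePreserving Φ := measurePreserving_rot_pair θ
  have hG : Continuous fun x : Plane => F (x 0 * Real.cos θ + x 1 * Real.sin θ) := by fun_prop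
  have hGF : ∀ z : ℝ × ℝ, F (Φ z 0 * Real.cos θ + Φ z 1 * Real.sin θ) = F z.1 := by
    intro z
    congr 1
    simp only [hΦ, rot, Matrix.cons_val_zero, Matrix.cons_val_one, Matrix.cons_val_fin_one]
    linear_combination z.1 * Real.sin_sq_add_cos_sq θ
  set A : Set (ℝ × ℝ) := Φ ⁻¹' C with hAdef
  have hA : MeasurableSet A := measurableSet_rot_pair hC
  have hAfin : volume A ≠ ⊤ := by
    have := volume_rot_pair (θ := θ) hC
    rw [hAdef]
    exact this.trans_ne hfin
  have h1 : ∫ x in C, F (x 0 * Real.cos θ + x 1 * Real.sin θ) = ∫ z in A, F z.1 := by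
    have := hmp.map_eq
    calc ∫ x in C, F (x 0 * Real.cos θ + x 1 * Real.sin θ) =
        ∫ x in C, F (x 0 * Real.cos θ + x 1 * Real.sin θ) ∂(Measure.map Φ volume) := by rw [this]
      _ = ∫ z in A, F (Φ z 0 * Real.cos θ + Φ z 1 * Real.sin θ) :=
        setIntegral_map hC hG.aestronglyMeasurable hmp.aemeasurable
      _ = ∫ z in A, F z.1 := by simp_rw [hGF]
  have hint : Integrable (A.indicator fun z => F z.1) := by
    rw [integrable_indicator_iff hA]
    refine Measure.integrableOn_of_bounded (M := K) hAfin ?_ ?_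
    · exact (hF.comp continuous_fst).aestronglyMeasurable
    · exact Filter.Eventually.of_forall fun z => hK z.1
  rw [h1, ← integral_indicator hA, Measure.volume_eq_prod, integral_prod _ hint]
  congr 1
  ext s
  have h2 : ∀ u, A.indicator (fun z : ℝ × ℝ => F z.1) (s, u) =
      (Prod.mk s ⁻¹' A).indicator (fun _ => F s) u := by
    intro u
    rfl
  simp_rw [h2]
  rw [integral_indicator (measurable_prodMk_left hA), setIntegral_const]
  simp only [Complex.real_smul]
  rfl

theorem rot_pair_convex_mem (hconv : Convex ℝ C) {s s' u u' a b : ℝ} (h : rot θ !₂[s, u] ∈ C)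
    (h' : rot θ !₂[s', u'] ∈ C) (ha : 0 ≤ a) (hb : 0 ≤ b) (hab : a + b = 1) :
    rot θ !₂[a * s + b * s', a * u + b * u'] ∈ C := by
  have := hconv h h' ha hb hab
  convert this using 1
  ext i
  fin_cases i <;> simp [rot] <;> ring

theorem isCompact_slice (hC : IsCompact C) (s : ℝ) : IsCompact {u : ℝ | rot θ !₂[s, u] ∈ C} := by
  have hcl : IsClosed {u : ℝ | rot θ !₂[s, u] ∈ C} :=
    hC.isClosed.preimage ((continuous_rot_pair θ).comp (by fun_prop : Continuous fun u : ℝ => (s, u)))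
  have hcont : Continuous fun x : Plane => rot (-θ) x 1 := by unfold rot; fun_prop
  refine (hC.image hcont).of_isClosed_subset hcl fun u hu => ⟨_, hu, ?_⟩
  have := (rotIso θ).left_inv !₂[s, u]
  change rot (-θ) (rot θ !₂[s, u]) = _ at this
  simp [this]

/-- One-dimensional Brunn–Minkowski inequality for the slices of a convex body. -/
theorem sliceLength_add_le (hC : IsCompact C) (hconv : Convex ℝ C) {s s' : ℝ}
    (hs : {u : ℝ | rot θ !₂[s, u] ∈ C}.Nonempty) (hs' : {u : ℝ | rot θ !₂[s', u] ∈ C}.Nonempty) :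
    sliceLength C θ s + sliceLength C θ s' ≤ 2 * sliceLength C θ ((s + s') / 2) := by
  have hval : ∀ t : ℝ, {u : ℝ | rot θ !₂[t, u] ∈ C}.Nonempty →
      ∃ l m : ℝ, l ≤ m ∧ rot θ !₂[t, l] ∈ C ∧ rot θ !₂[t, m] ∈ C ∧ sliceLength C θ t ≤ m - l := by
    intro t ht
    have hcomp := isCompact_slice (θ := θ) hC t
    obtain ⟨l, hl, hlmin⟩ := hcomp.exists_isLeast ht
    obtain ⟨m, hm, hmmax⟩ := hcomp.exists_isGreatest ht
    refine ⟨l, m, hlmin hm, hl, hm, ?_⟩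
    have hsub : {u : ℝ | rot θ !₂[t, u] ∈ C} ⊆ Icc l m := fun u hu => ⟨hlmin hu, hmmax hu⟩
    calc sliceLength C θ t ≤ volume.real (Icc l m) := measureReal_mono hsub (by simp)
      _ = m - l := by rw [Real.volume_real_Icc, max_eq_left (by linarith [hlmin hm])]
  obtain ⟨l, m, hlm, hl, hm, hle⟩ := hval s hs
  obtain ⟨l', m', hlm', hl', hm', hle'⟩ := hval s' hs'
  have h1 := rot_pair_convex_mem hconv hl hl' (by norm_num : (0 : ℝ) ≤ 1 / 2) (by norm_num : (0 : ℝ) ≤ 1 / 2) (by norm_num)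
  have h2 := rot_pair_convex_mem hconv hm hm' (by norm_num : (0 : ℝ) ≤ 1 / 2) (by norm_num : (0 : ℝ) ≤ 1 / 2) (by norm_num)
  have e : 1 / 2 * s + 1 / 2 * s' = (s + s') / 2 := by ring
  rw [e] at h1 h2
  have hsub : Icc (1 / 2 * l + 1 / 2 * l') (1 / 2 * m + 1 / 2 * m') ⊆
      {u : ℝ | rot θ !₂[(s + s') / 2, u] ∈ C} := by
    have hoc : Convex ℝ {u : ℝ | rot θ !₂[(s + s') / 2, u] ∈ C} := by
      intro u hu u' hu' a b ha hb hab
      have := rot_pair_convex_mem hconv hu hu' ha hb hab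
      rw [← add_mul, hab, one_mul] at this
      exact this
    exact hoc.ordConnected.out h1 h2
  have h3 : (1 / 2 * m + 1 / 2 * m') - (1 / 2 * l + 1 / 2 * l') ≤ sliceLength C θ ((s + s') / 2) := by
    calc _ = volume.real (Icc (1 / 2 * l + 1 / 2 * l') (1 / 2 * m + 1 / 2 * m')) := by
          rw [Real.volume_real_Icc, max_eq_left (by linarith)]
      _ ≤ _ := measureReal_mono hsub (isCompact_slice hC _).measure_lt_top.ne
  linarith

theorem rot_pair_coord (θ s u : ℝ) :
    rot θ !₂[s, u] 0 * Real.cos θ + rot θ !₂[s, u] 1 * Real.sin θ = s ∧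
      -rot θ !₂[s, u] 0 * Real.sin θ + rot θ !₂[s, u] 1 * Real.cos θ = u := by
  have hsc := Real.sin_sq_add_cos_sq θ
  simp only [rot, Matrix.cons_val_zero, Matrix.cons_val_one, Matrix.cons_val_fin_one]
  constructor
  · linear_combination s * hsc
  · linear_combination u * hsc

theorem sliceLength_le_of_abs_sub_le {s q w : ℝ} (hw : 0 ≤ w)
    (h : ∀ u, rot θ !₂[s, u] ∈ C → |u - q| ≤ w) : sliceLength C θ s ≤ 2 * w := by
  have hsub : {u : ℝ | rot θ !₂[s, u] ∈ C} ⊆ Icc (q - w) (q + w) := by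
    intro u hu
    have := abs_le.mp (h u hu)
    constructor <;> linarith
  calc sliceLength C θ s ≤ volume.real (Icc (q - w) (q + w)) := measureReal_mono hsub (by simp)
    _ = 2 * w := by rw [Real.volume_real_Icc, max_eq_left (by linarith)]; ring

/-- Decay of the Fourier transform of the indicator function of a planar convex body in a direction
in which the supporting lines satisfy a quadratic estimate. -/
theorem norm_setIntegral_exp_le (hC : IsCompact C) (hconv : Convex ℝ C) {c ρ : ℝ} (hc : 0 < c)
    (hρ : 0 < ρ) (h : QuadSupport C θ c) (h' : QuadSupport C (θ + Real.pi) c) :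
    ‖∫ x in C, Complex.exp (((-2 * Real.pi * ρ * (x 0 * Real.cos θ + x 1 * Real.sin θ) : ℝ) : ℂ) *
      Complex.I)‖ ≤ 8 / √c / ρ * √(1 / ρ) := by
  have hmeas := hC.isClosed.measurableSet
  have hfin : volume C ≠ ⊤ := hC.measure_lt_top.ne
  rw [integral_eq_integral_sliceLength hmeas hfin
    (F := fun s => Complex.exp (((-2 * Real.pi * ρ * s : ℝ) : ℂ) * Complex.I)) (K := 1)
    (by fun_prop) (fun s => (Complex.norm_exp_ofReal_mul_I _).le)]
  obtain ⟨Q, hQ, hq⟩ := h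
  obtain ⟨Q', hQ', hq'⟩ := h'
  simp only [Real.cos_add_pi, Real.sin_add_pi] at hq'
  -- The slices meeting `C` are those with `a ≤ s ≤ b`; quadratic support at the two opposite
  -- contact points gives the square-root bounds with `M = 2 / √c`. Outside this range the real
  -- square root is zero, so the same bounds say that slices have length zero.
  set b := Q 0 * Real.cos θ + Q 1 * Real.sin θ with hb
  set a := Q' 0 * Real.cos θ + Q' 1 * Real.sin θ with ha
  have hsc := Real.sin_sq_add_cos_sq θ
  have hrep : ∀ y : Plane, rot θ !₂[y 0 * Real.cos θ + y 1 * Real.sin θ,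
      -y 0 * Real.sin θ + y 1 * Real.cos θ] = y := by
    intro y
    ext i
    fin_cases i
    · simp [rot]; linear_combination y 0 * hsc
    · simp [rot]; linear_combination y 1 * hsc
  have hne : ∀ s, a ≤ s → s ≤ b → {u : ℝ | rot θ !₂[s, u] ∈ C}.Nonempty := by
    intro s has hsb
    have h1 := hQ
    have h2 := hQ'
    rw [← hrep Q, ← hb] at h1
    rw [← hrep Q', ← ha] at h2
    have hs : s ∈ segment ℝ a b := by rw [segment_eq_Icc (has.trans hsb)]; exact ⟨has, hsb⟩
    obtain ⟨k, l, hk, hl, hkl, rfl⟩ := hs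
    exact ⟨_, rot_pair_convex_mem hconv h2 h1 hk hl hkl⟩
  have hw : ∀ t, (2 : ℝ) / √c * √t = 2 * √(t / c) := by
    intro t; rw [Real.sqrt_div' _ hc.le]; ring
  have key := norm_integral_mul_exp_le_of_concave (h := sliceLength C θ) (a := a) (b := b)
    (M := 2 / √c) hρ (by positivity) (integrable_sliceLength hmeas hfin)
    (fun s => measureReal_nonneg) ?_ ?_ ?_
  · refine key.trans (le_of_eq ?_)
    ring
  · intro s d hd has hsb
    have := sliceLength_add_le hC hconv (θ := θ) (hne s has (by linarith))
      (hne (s + 2 * d) (by linarith) hsb)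
    convert this using 3
    ring
  · intro s
    rw [hw]
    apply sliceLength_le_of_abs_sub_le (q := -Q' 0 * Real.sin θ + Q' 1 * Real.cos θ) (by positivity)
    intro u hu
    have := hq' _ hu
    obtain ⟨e1, e2⟩ := rot_pair_coord θ s u
    apply Real.abs_le_sqrt
    rw [le_div_iff₀ hc, ha, ← e1]
    conv_lhs => rw [← e2]
    linarith
  · intro s
    rw [hw]
    apply sliceLength_le_of_abs_sub_le (q := -Q 0 * Real.sin θ + Q 1 * Real.cos θ) (by positivity)
    intro u hu
    have := hq _ hu
    obtain ⟨e1, e2⟩ := rot_pair_coord θ s u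
    apply Real.abs_le_sqrt
    rw [le_div_iff₀ hc, hb, ← e1]
    conv_lhs => rw [← e2]
    linarith

end Slices

/-! ### Finite inequalities and dyadic shells of frequencies. -/

/-- Both factors are compared with `∑ g ^ p` by the power mean inequality and recombined with
exponents `2 / p` and `(p - 2) / p`, which sum to one. -/
theorem sum_sq_mul_rpow_sum_le {ι : Type*} (S : Finset ι) (g : ι → ℝ) (hg : ∀ i ∈ S, 0 ≤ g i) {p : ℝ}
    (hp : 2 ≤ p) :
    (∑ i ∈ S, g i ^ 2) * (∑ i ∈ S, g i) ^ (p - 2) ≤ (S.card : ℝ) ^ (p - 2) * ∑ i ∈ S, g i ^ p := by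
  have hp0 : 0 < p := by linarith
  set G := ∑ i ∈ S, g i ^ p with hG
  have hn : (0 : ℝ) ≤ S.card := Nat.cast_nonneg _
  have hG0 : 0 ≤ G := Finset.sum_nonneg fun i hi => Real.rpow_nonneg (hg i hi) _
  have hs1 : 0 ≤ ∑ i ∈ S, g i := Finset.sum_nonneg hg
  have hs2 : 0 ≤ ∑ i ∈ S, g i ^ 2 := Finset.sum_nonneg fun i _ => sq_nonneg _
  have h1 : (∑ i ∈ S, g i) ^ p ≤ (S.card : ℝ) ^ (p - 1) * G :=
    Real.rpow_sum_le_const_mul_sum_rpow_of_nonneg S (by linarith) hg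
  have h2 : (∑ i ∈ S, g i ^ 2) ^ (p / 2) ≤ (S.card : ℝ) ^ (p / 2 - 1) * G := by
    have := Real.rpow_sum_le_const_mul_sum_rpow_of_nonneg S (f := fun i => g i ^ 2) (p := p / 2)
      (by linarith) (fun i _ => sq_nonneg _)
    refine this.trans (le_of_eq ?_)
    congr 1
    refine Finset.sum_congr rfl fun i hi => ?_
    rw [← Real.rpow_natCast, ← Real.rpow_mul (hg i hi)]
    congr 1; push_cast; ring
  generalize (S.card : ℝ) = n at hn h1 h2 ⊢
  have e1 : ∑ i ∈ S, g i ^ 2 = ((∑ i ∈ S, g i ^ 2) ^ (p / 2)) ^ (2 / p) := by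
    rw [← Real.rpow_mul hs2]
    have : p / 2 * (2 / p) = 1 := by field_simp
    rw [this, Real.rpow_one]
  have e2 : (∑ i ∈ S, g i) ^ (p - 2) = ((∑ i ∈ S, g i) ^ p) ^ ((p - 2) / p) := by
    rw [← Real.rpow_mul hs1]
    congr 1; field_simp
  have hq : 0 ≤ (p - 2) / p := div_nonneg (by linarith) hp0.le
  rw [e1, e2]
  calc ((∑ i ∈ S, g i ^ 2) ^ (p / 2)) ^ (2 / p) * ((∑ i ∈ S, g i) ^ p) ^ ((p - 2) / p)
      ≤ (n ^ (p / 2 - 1) * G) ^ (2 / p) * (n ^ (p - 1) * G) ^ ((p - 2) / p) := by gcongr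
    _ = (n ^ ((p / 2 - 1) * (2 / p)) * n ^ ((p - 1) * ((p - 2) / p))) *
        (G ^ (2 / p) * G ^ ((p - 2) / p)) := by
      rw [Real.mul_rpow (by positivity) hG0, Real.mul_rpow (by positivity) hG0,
        ← Real.rpow_mul hn, ← Real.rpow_mul hn]
      ring
    _ = n ^ (p - 2) * G := by
      rw [← Real.rpow_add_of_nonneg hn (mul_nonneg (by linarith) (by positivity))
        (mul_nonneg (by linarith) hq), ← Real.rpow_add_of_nonneg hG0 (by positivity) hq]
      have h3 : (p / 2 - 1) * (2 / p) + (p - 1) * ((p - 2) / p) = p - 2 := by field_simp; ring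
      have h4 : 2 / p + (p - 2) / p = 1 := by field_simp; ring
      rw [h3, h4, Real.rpow_one]

/-- Weighted convexity of `x ↦ x ^ p`. -/
theorem rpow_sum_le_weighted {ι : Type*} (S : Finset ι) {l x : ι → ℝ} (hl : ∀ i, 0 < l i)
    (hx : ∀ i, 0 ≤ x i) {p L : ℝ} (hp : 1 ≤ p) (hL : ∑ i ∈ S, l i ≤ L) :
    (∑ i ∈ S, x i) ^ p ≤ L ^ (p - 1) * ∑ i ∈ S, l i ^ (1 - p) * x i ^ p := by
  have hp0 : 0 < p := by linarith
  have hl0 : 0 ≤ ∑ i ∈ S, l i := Finset.sum_nonneg fun i _ => (hl i).le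
  have h := Real.inner_le_weight_mul_Lp_of_nonneg S hp l (fun i => x i / l i) (fun i => (hl i).le)
    (fun i => div_nonneg (hx i) (hl i).le)
  have e1 : ∑ i ∈ S, l i * (x i / l i) = ∑ i ∈ S, x i :=
    Finset.sum_congr rfl fun i _ => by field_simp [(hl i).ne']
  have e2 : ∀ i, l i * (x i / l i) ^ p = l i ^ (1 - p) * x i ^ p := by
    intro i
    rw [Real.div_rpow (hx i) (hl i).le, Real.rpow_sub (hl i), Real.rpow_one]
    ring
  simp_rw [e1, e2] at h
  have hR : 0 ≤ ∑ i ∈ S, l i ^ (1 - p) * x i ^ p := Finset.sum_nonneg fun i _ =>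
    mul_nonneg (Real.rpow_nonneg (hl i).le _) (Real.rpow_nonneg (hx i) _)
  calc (∑ i ∈ S, x i) ^ p ≤
      ((∑ i ∈ S, l i) ^ (1 - p⁻¹) * (∑ i ∈ S, l i ^ (1 - p) * x i ^ p) ^ p⁻¹) ^ p := by
        gcongr
        exact Finset.sum_nonneg fun i _ => hx i
    _ = (∑ i ∈ S, l i) ^ (p - 1) * ∑ i ∈ S, l i ^ (1 - p) * x i ^ p := by
        rw [Real.mul_rpow (Real.rpow_nonneg hl0 _) (Real.rpow_nonneg hR _), ← Real.rpow_mul hl0,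
          ← Real.rpow_mul hR, inv_mul_cancel₀ hp0.ne', Real.rpow_one]
        congr 2
        field_simp
    _ ≤ _ := by gcongr

/-- The integer points of the open square of side length `2 N`. -/
noncomputable def latticeBox (N : ℕ) : Finset (Fin 2 → ℤ) := Fintype.piFinset fun _ => Finset.Ioo (-(N : ℤ)) N

theorem mem_latticeBox {N : ℕ} {n : Fin 2 → ℤ} : n ∈ latticeBox N ↔ ∀ i, |n i| < N := by
  simp [latticeBox, Fintype.mem_piFinset, abs_lt]

/-- The dyadic shell of integer points with maximum norm in `[2 ^ j, 2 ^ (j + 1))`. -/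
noncomputable def latticeShell (j : ℕ) : Finset (Fin 2 → ℤ) := latticeBox (2 ^ (j + 1)) \ latticeBox (2 ^ j)

theorem latticeBox_mono : Monotone latticeBox := by
  intro N M h n hn
  rw [mem_latticeBox] at hn ⊢
  exact fun i => (hn i).trans_le (by exact_mod_cast h)

theorem card_latticeShell_le (j : ℕ) : ((latticeShell j).card : ℝ) ≤ 16 * 4 ^ j := by
  have h1 : (latticeShell j).card ≤ (latticeBox (2 ^ (j + 1))).card :=
    Finset.card_le_card Finset.sdiff_subset
  have h2 : (latticeBox (2 ^ (j + 1))).card ≤ 16 * 4 ^ j := by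
    rw [latticeBox, Fintype.card_piFinset_const, Int.card_Ioo]
    have h4 : (((2 ^ (j + 1) : ℕ) : ℤ) - -((2 ^ (j + 1) : ℕ) : ℤ) - 1).toNat ≤ 4 * 2 ^ j := by
      push_cast
      rw [Int.toNat_le]
      push_cast
      rw [pow_succ]; linarith
    calc _ ≤ (4 * 2 ^ j) ^ Fintype.card (Fin 2) := Nat.pow_le_pow_left h4 _
      _ = 16 * 4 ^ j := by
        rw [Fintype.card_fin, mul_pow, ← pow_mul, mul_comm j 2, pow_mul]; norm_num
  calc ((latticeShell j).card : ℝ) ≤ ((16 * 4 ^ j : ℕ) : ℝ) := by exact_mod_cast h1.trans h2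
    _ = 16 * 4 ^ j := by push_cast; ring

theorem sum_latticeBox_eq {E : Type*} [AddCommMonoid E] (f : (Fin 2 → ℤ) → E) (h0 : f 0 = 0)
    (J : ℕ) : ∑ n ∈ latticeBox (2 ^ J), f n = ∑ j ∈ Finset.range J, ∑ n ∈ latticeShell j, f n := by
  induction J with
  | zero =>
    rw [Finset.range_zero, Finset.sum_empty]
    apply Finset.sum_eq_zero
    intro n hn
    rw [mem_latticeBox] at hn
    have : n = 0 := by
      ext i
      have := hn i
      simp only [pow_zero, Nat.cast_one, Int.abs_lt_one_iff] at this
      simpa using this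
    rw [this, h0]
  | succ J ih =>
    rw [Finset.sum_range_succ, ← ih, latticeShell, add_comm (∑ n ∈ latticeBox (2 ^ J), f n), Finset.sum_sdiff]
    exact latticeBox_mono (Nat.pow_le_pow_right (by norm_num) (Nat.le_succ J))

theorem tendsto_latticeBox :
    Filter.Tendsto (fun J : ℕ => latticeBox (2 ^ J)) Filter.atTop Filter.atTop := by
  apply Filter.tendsto_atTop_finset_of_monotone
  · exact fun a b h => latticeBox_mono (Nat.pow_le_pow_right (by norm_num) h)
  · intro n
    refine ⟨max (n 0).natAbs (n 1).natAbs, mem_latticeBox.mpr fun i => ?_⟩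
    have h1 : (n i).natAbs ≤ max (n 0).natAbs (n 1).natAbs := by fin_cases i <;> simp
    have h2 : (n i).natAbs < 2 ^ (max (n 0).natAbs (n 1).natAbs) := h1.trans_lt Nat.lt_two_pow_self
    rw [Int.abs_eq_natAbs]
    exact_mod_cast h2

/-! ### `L ^ p` bounds on the torus from Fourier coefficients. -/

section Torus

noncomputable local instance : MeasureSpace UnitAddCircle := ⟨AddCircle.haarAddCircle⟩

local instance : Measure.IsAddHaarMeasure (volume : Measure UnitAddCircle) :=
  inferInstanceAs (Measure.IsAddHaarMeasure AddCircle.haarAddCircle)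

local instance : IsProbabilityMeasure (volume : Measure UnitAddCircle) :=
  inferInstanceAs (IsProbabilityMeasure AddCircle.haarAddCircle)

open UnitAddTorus

/-- The trigonometric polynomial with coefficients `a` and frequencies in `S`. -/
noncomputable def trigPoly (S : Finset (Fin 2 → ℤ)) (a : (Fin 2 → ℤ) → ℂ)
    (x : UnitAddTorus (Fin 2)) : ℂ := ∑ n ∈ S, a n * mFourier n x

theorem sum_mFourierLp_ae_eq (S : Finset (Fin 2 → ℤ)) (a : (Fin 2 → ℤ) → ℂ) :
    ((∑ n ∈ S, a n • mFourierLp 2 n : Lp ℂ 2 (volume : Measure (UnitAddTorus (Fin 2)))) :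
      UnitAddTorus (Fin 2) → ℂ) =ᵐ[volume] trigPoly S a := by
  have h1 : (∑ n ∈ S, a n • mFourierLp 2 n : Lp ℂ 2 (volume : Measure (UnitAddTorus (Fin 2)))) =
      ContinuousMap.toLp (E := ℂ) 2 volume ℂ (∑ n ∈ S, a n • mFourier n) := by
    rw [map_sum]
    simp [mFourierLp]
  rw [h1]
  refine (ContinuousMap.coeFn_toLp volume _).trans (Filter.Eventually.of_forall fun x => ?_)
  simp [trigPoly]

theorem continuous_trigPoly (S : Finset (Fin 2 → ℤ)) (a : (Fin 2 → ℤ) → ℂ) :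
    Continuous (trigPoly S a) := by
  unfold trigPoly
  fun_prop

theorem norm_trigPoly_le (S : Finset (Fin 2 → ℤ)) (a : (Fin 2 → ℤ) → ℂ) (x : UnitAddTorus (Fin 2)) :
    ‖trigPoly S a x‖ ≤ ∑ n ∈ S, ‖a n‖ := by
  refine (norm_sum_le _ _).trans (Finset.sum_le_sum fun n _ => ?_)
  rw [norm_mul]
  have : ‖mFourier n x‖ ≤ 1 := ((mFourier n).norm_coe_le_norm x).trans_eq mFourier_norm
  exact mul_le_of_le_one_right (norm_nonneg _) this

theorem lintegral_trigPoly_sq (S : Finset (Fin 2 → ℤ)) (a : (Fin 2 → ℤ) → ℂ) :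
    ∫⁻ x, ‖trigPoly S a x‖ₑ ^ (2 : ℝ) = ENNReal.ofReal (∑ n ∈ S, ‖a n‖ ^ 2) := by
  set g : Lp ℂ 2 (volume : Measure (UnitAddTorus (Fin 2))) := ∑ n ∈ S, a n • mFourierLp 2 n with hg
  have h1 : ‖g‖ ^ 2 = ∑ n ∈ S, ‖a n‖ ^ 2 := by
    have h2 := (orthonormal_mFourier (d := Fin 2)).inner_sum a a S
    rw [← hg, inner_self_eq_norm_sq_to_K] at h2
    have h3 : ((‖g‖ ^ 2 : ℝ) : ℂ) = ((∑ n ∈ S, ‖a n‖ ^ 2 : ℝ) : ℂ) := by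
      push_cast
      rw [show ((‖g‖ : ℂ) ^ 2) = _ from h2]
      exact Finset.sum_congr rfl fun n _ => Complex.conj_mul' (a n)
    exact_mod_cast h3
  have h4 : eLpNorm g 2 volume = ENNReal.ofReal ‖g‖ := by
    rw [Lp.norm_def, ENNReal.ofReal_toReal (Lp.eLpNorm_ne_top g)]
  rw [eLpNorm_congr_ae (sum_mFourierLp_ae_eq S a),
    eLpNorm_eq_lintegral_rpow_enorm_toReal (by norm_num) (by norm_num)] at h4
  simp only [ENNReal.toReal_ofNat] at h4
  rw [← h1, ← Real.rpow_two, ← ENNReal.ofReal_rpow_of_nonneg (norm_nonneg _) (by norm_num), ← h4,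
    ← ENNReal.rpow_mul]
  norm_num

/-- Interpolation by hand: `|T| ^ p ≤ |T| ^ 2 (∑ |a n|) ^ (p - 2)`, then Parseval. The result is
what Hausdorff–Young followed by Hölder would give. -/
theorem lintegral_trigPoly_rpow_le (S : Finset (Fin 2 → ℤ)) (a : (Fin 2 → ℤ) → ℂ) {b : (Fin 2 → ℤ) → ℝ}
    (hb : ∀ n ∈ S, ‖a n‖ ≤ b n) {p : ℝ} (hp : 2 ≤ p) :
    ∫⁻ x, ‖trigPoly S a x‖ₑ ^ p ≤
      ENNReal.ofReal ((S.card : ℝ) ^ (p - 2) * ∑ n ∈ S, b n ^ p) := by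
  have hs : 0 ≤ ∑ n ∈ S, ‖a n‖ := Finset.sum_nonneg fun n _ => norm_nonneg _
  calc ∫⁻ x, ‖trigPoly S a x‖ₑ ^ p ≤
      ∫⁻ x, ‖trigPoly S a x‖ₑ ^ (2 : ℝ) * ENNReal.ofReal ((∑ n ∈ S, ‖a n‖) ^ (p - 2)) := by
        refine lintegral_mono fun x => ?_
        have h1 : ‖trigPoly S a x‖ₑ ^ p = ‖trigPoly S a x‖ₑ ^ (2 : ℝ) * ‖trigPoly S a x‖ₑ ^ (p - 2) := by
          rw [← ENNReal.rpow_add_of_nonneg _ _ (by norm_num) (by linarith)]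
          congr 1; ring
        rw [h1, ← ENNReal.ofReal_rpow_of_nonneg hs (by linarith), ← ofReal_norm]
        gcongr
        exact norm_trigPoly_le S a x
    _ = ENNReal.ofReal ((∑ n ∈ S, ‖a n‖ ^ 2) * (∑ n ∈ S, ‖a n‖) ^ (p - 2)) := by
        rw [lintegral_mul_const' _ _ ENNReal.ofReal_ne_top, lintegral_trigPoly_sq,
          ← ENNReal.ofReal_mul (Finset.sum_nonneg fun n _ => sq_nonneg _)]
    _ ≤ _ := by
        apply ENNReal.ofReal_le_ofReal
        refine (sum_sq_mul_rpow_sum_le S (fun n => ‖a n‖) (fun n _ => norm_nonneg _) hp).trans ?_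
        gcongr with n hn
        exact hb n hn

/-- Partial sums over boxes converge in `L²`, hence almost everywhere along a subsequence, and
Fatou's lemma passes the bound to the limit. -/
theorem lintegral_rpow_le_of_partial_sums {F : UnitAddTorus (Fin 2) → ℂ} (hF : MemLp F 2 volume)
    {p : ℝ} {B : ENNReal}
    (hB : ∀ J : ℕ, ∫⁻ x, ‖trigPoly (latticeBox (2 ^ J)) (mFourierCoeff F) x‖ₑ ^ p ≤ B) :
    ∫⁻ x, ‖F x‖ₑ ^ p ≤ B := by
  set f : Lp ℂ 2 (volume : Measure (UnitAddTorus (Fin 2))) := hF.toLp F with hf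
  have hfF : f =ᵐ[volume] F := hF.coeFn_toLp
  have hcoef : ∀ n, mFourierCoeff f n = mFourierCoeff F n := by
    intro n
    apply integral_congr_ae
    filter_upwards [hfF] with x hx
    rw [hx]
  have hsum := hasSum_mFourier_series_L2 f
  simp_rw [hcoef] at hsum
  rw [HasSum, SummationFilter.unconditional_filter] at hsum
  have htend : Filter.Tendsto (fun J : ℕ => ∑ n ∈ latticeBox (2 ^ J), mFourierCoeff F n • mFourierLp 2 n)
      Filter.atTop (nhds f) := hsum.comp tendsto_latticeBox
  obtain ⟨ns, -, hns⟩ := (tendstoInMeasure_of_tendsto_Lp htend).exists_seq_tendsto_ae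
  have hae : ∀ᵐ x, ∀ J, (∑ n ∈ latticeBox (2 ^ J), mFourierCoeff F n • mFourierLp 2 n :
      Lp ℂ 2 (volume : Measure (UnitAddTorus (Fin 2)))) x =
        trigPoly (latticeBox (2 ^ J)) (mFourierCoeff F) x :=
    ae_all_iff.mpr fun J => sum_mFourierLp_ae_eq _ _
  have hlim : ∀ᵐ x, ‖F x‖ₑ ^ p = Filter.liminf (fun k =>
      ‖trigPoly (latticeBox (2 ^ ns k)) (mFourierCoeff F) x‖ₑ ^ p) Filter.atTop := by
    filter_upwards [hns, hae, hfF] with x h1 h2 h3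
    simp_rw [h2, h3] at h1
    exact (((ENNReal.continuous_rpow_const (y := p)).tendsto _).comp h1.enorm).liminf_eq.symm
  rw [lintegral_congr_ae hlim]
  refine (lintegral_liminf_le fun k => ?_).trans ?_
  · have : Continuous fun x => ‖trigPoly (latticeBox (2 ^ ns k)) (mFourierCoeff F) x‖ₑ ^ p :=
      ENNReal.continuous_rpow_const.comp (continuous_trigPoly _ _).enorm
    exact this.measurable
  · apply Filter.liminf_le_of_le
    · isBoundedDefault
    · intro b hb
      obtain ⟨k, hk⟩ := hb.exists
      exact hk.trans (hB _)

/-- Exponent count, with `e = (4 - p) / (2 p)`: cardinality contributes `2 (p - 2)`, coefficients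
`-3 p / 2`, and the weight `e (p - 1)`, for a total of `-(2 + e)`. The `2` pays for the number of
terms in a shell. -/
theorem dyadic_term_le {p A G N : ℝ} (hp2 : 2 ≤ p) (hA : 0 ≤ A) (hG : 0 ≤ G) (hN : 0 ≤ N) (j : ℕ)
    (hNj : N ≤ 16 * 4 ^ j) :
    ((2 : ℝ) ^ (-((4 - p) / (2 * p)) * j)) ^ (1 - p) *
        (N ^ (p - 2) * ((A * 2 ^ (-(3 / 2 : ℝ) * j)) ^ p * G)) ≤
      16 ^ (p - 2) * A ^ p * (2 ^ (-(2 + (4 - p) / (2 * p)) * j) * G) := by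
  have h2 : (0 : ℝ) ≤ 2 := by norm_num
  have h1 : N ^ (p - 2) ≤ 16 ^ (p - 2) * 2 ^ (2 * (p - 2) * j) := by
    calc N ^ (p - 2) ≤ (16 * 4 ^ j) ^ (p - 2) := by gcongr
      _ = 16 ^ (p - 2) * 2 ^ (2 * (p - 2) * j) := by
        rw [Real.mul_rpow (by norm_num) (by positivity)]
        congr 1
        have : (4 : ℝ) ^ j = 2 ^ (2 * (j : ℝ)) := by
          rw [Real.rpow_mul h2, Real.rpow_natCast]; norm_num
        rw [this, ← Real.rpow_mul h2]
        congr 1; ring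
  calc _ ≤ ((2 : ℝ) ^ (-((4 - p) / (2 * p)) * j)) ^ (1 - p) *
        ((16 ^ (p - 2) * 2 ^ (2 * (p - 2) * j)) * ((A * 2 ^ (-(3 / 2 : ℝ) * j)) ^ p * G)) := by gcongr
    _ = 16 ^ (p - 2) * A ^ p * (((2 : ℝ) ^ (-((4 - p) / (2 * p)) * j * (1 - p)) *
          2 ^ (2 * (p - 2) * j) * 2 ^ (-(3 / 2 : ℝ) * j * p)) * G) := by
        rw [Real.mul_rpow hA (by positivity), ← Real.rpow_mul h2, ← Real.rpow_mul h2]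
        ring
    _ = _ := by
        rw [← Real.rpow_add (by norm_num), ← Real.rpow_add (by norm_num)]
        congr 3
        field_simp
        ring

/-- An `L^p` bound, `2 ≤ p < 4`, for a function on the two-dimensional torus in terms of bounds for
its Fourier coefficients on dyadic shells. -/
theorem exists_lintegral_torus_le {p : ℝ} (hp2 : 2 ≤ p) (hp4 : p < 4) :
    ∃ K : ℝ, 0 ≤ K ∧ ∀ (F : UnitAddTorus (Fin 2) → ℂ), MemLp F 2 volume → mFourierCoeff F 0 = 0 →
      ∀ (A : ℝ) (g : (Fin 2 → ℤ) → ℝ), 0 ≤ A → (∀ n, 0 ≤ g n) →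
      (∀ j, ∀ n ∈ latticeShell j, ‖mFourierCoeff F n‖ ≤ A * 2 ^ (-(3 / 2 : ℝ) * j) * g n) →
      ∫⁻ x, ‖F x‖ₑ ^ p ≤ ENNReal.ofReal (K * A ^ p) *
        ∑' j : ℕ, ENNReal.ofReal (2 ^ (-(2 + (4 - p) / (2 * p)) * j)) *
          ∑ n ∈ latticeShell j, ENNReal.ofReal (g n ^ p) := by
  have hp0 : 0 < p := by linarith
  set e := (4 - p) / (2 * p) with he
  have he0 : 0 < e := div_pos (by linarith) (by linarith)
  -- Summing over shells by weighted convexity spends `e (p - 1)` of the available decay `e p = (4 -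
  -- p) / 2`, leaving `e > 0` for the final geometric series.
  set l : ℕ → ℝ := fun j => 2 ^ (-e * j) with hl
  have hlpos : ∀ j, 0 < l j := fun j => by positivity
  have hlgeom : ∀ j, l j = ((2 : ℝ) ^ (-e)) ^ j := fun j => by
    simp only [hl]
    rw [Real.rpow_mul (by norm_num), Real.rpow_natCast]
  have hsummable : Summable l := by
    simp_rw [funext hlgeom]
    apply summable_geometric_of_lt_one (by positivity)
    exact Real.rpow_lt_one_of_one_lt_of_neg (by norm_num) (by linarith)
  set L := ∑' j, l j with hL
  have hL0 : 0 ≤ L := tsum_nonneg fun j => (hlpos j).le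
  refine ⟨L ^ (p - 1) * 16 ^ (p - 2), by positivity, fun F hF h0 A g hA hg hbound => ?_⟩
  apply lintegral_rpow_le_of_partial_sums hF
  intro J
  set a := mFourierCoeff F with ha
  set T : ℕ → UnitAddTorus (Fin 2) → ℂ := fun j => trigPoly (latticeShell j) a with hT
  have hdecomp : ∀ x, trigPoly (latticeBox (2 ^ J)) a x = ∑ j ∈ Finset.range J, T j x := by
    intro x
    simp only [trigPoly, hT]
    exact sum_latticeBox_eq (fun n => a n * mFourier n x) (by rw [h0, zero_mul]) J
  have hpt : ∀ x, ‖trigPoly (latticeBox (2 ^ J)) a x‖ₑ ^ p ≤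
      ENNReal.ofReal (L ^ (p - 1)) *
        ∑ j ∈ Finset.range J, ENNReal.ofReal (l j ^ (1 - p)) * ‖T j x‖ₑ ^ p := by
    intro x
    have h1 : ‖trigPoly (latticeBox (2 ^ J)) a x‖ ≤ ∑ j ∈ Finset.range J, ‖T j x‖ := by
      rw [hdecomp]; exact norm_sum_le _ _
    have h2 : ‖trigPoly (latticeBox (2 ^ J)) a x‖ ^ p ≤
        L ^ (p - 1) * ∑ j ∈ Finset.range J, l j ^ (1 - p) * ‖T j x‖ ^ p :=
      (Real.rpow_le_rpow (norm_nonneg _) h1 hp0.le).trans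
        (rpow_sum_le_weighted _ hlpos (fun j => norm_nonneg _) (by linarith)
          (hsummable.sum_le_tsum _ fun j _ => (hlpos j).le))
    rw [← ofReal_norm, ENNReal.ofReal_rpow_of_nonneg (norm_nonneg _) hp0.le]
    refine (ENNReal.ofReal_le_ofReal h2).trans (le_of_eq ?_)
    have hnn : ∀ j ∈ Finset.range J, 0 ≤ l j ^ (1 - p) * ‖T j x‖ ^ p := fun j _ => by
      have := hlpos j
      positivity
    rw [ENNReal.ofReal_mul (by positivity), ENNReal.ofReal_sum_of_nonneg hnn]
    congr 1
    refine Finset.sum_congr rfl fun j _ => ?_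
    rw [ENNReal.ofReal_mul (Real.rpow_nonneg (hlpos j).le _), ← ofReal_norm,
      ENNReal.ofReal_rpow_of_nonneg (norm_nonneg _) hp0.le]
  have hmeas : ∀ j, Measurable fun x => ‖T j x‖ₑ ^ p := fun j =>
    (ENNReal.continuous_rpow_const.comp (continuous_trigPoly _ _).enorm).measurable
  have hterm : ∀ j, ENNReal.ofReal (l j ^ (1 - p)) * ∫⁻ x, ‖T j x‖ₑ ^ p ≤
      ENNReal.ofReal (16 ^ (p - 2) * A ^ p) * (ENNReal.ofReal (2 ^ (-(2 + e) * j)) *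
        ∑ n ∈ latticeShell j, ENNReal.ofReal (g n ^ p)) := by
    intro j
    have hgp : ∀ n ∈ latticeShell j, 0 ≤ g n ^ p := fun n _ => Real.rpow_nonneg (hg n) _
    have h1 := lintegral_trigPoly_rpow_le (latticeShell j) a (hbound j) hp2
    have h2 : ∑ n ∈ latticeShell j, (A * 2 ^ (-(3 / 2 : ℝ) * j) * g n) ^ p =
        (A * 2 ^ (-(3 / 2 : ℝ) * j)) ^ p * ∑ n ∈ latticeShell j, g n ^ p := by
      rw [Finset.mul_sum]
      exact Finset.sum_congr rfl fun n _ => Real.mul_rpow (by positivity) (hg n)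
    rw [h2] at h1
    calc _ ≤ ENNReal.ofReal (l j ^ (1 - p)) * ENNReal.ofReal (((latticeShell j).card : ℝ) ^ (p - 2) *
          ((A * 2 ^ (-(3 / 2 : ℝ) * j)) ^ p * ∑ n ∈ latticeShell j, g n ^ p)) := by gcongr
      _ ≤ ENNReal.ofReal (16 ^ (p - 2) * A ^ p * (2 ^ (-(2 + e) * j) *
          ∑ n ∈ latticeShell j, g n ^ p)) := by
        rw [← ENNReal.ofReal_mul (Real.rpow_nonneg (hlpos j).le _)]
        apply ENNReal.ofReal_le_ofReal
        exact dyadic_term_le hp2 hA (Finset.sum_nonneg hgp) (Nat.cast_nonneg _) j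
          (card_latticeShell_le j)
      _ = _ := by
        rw [ENNReal.ofReal_mul (by positivity : 0 ≤ 16 ^ (p - 2) * A ^ p),
          ENNReal.ofReal_mul (by positivity : (0 : ℝ) ≤ 2 ^ (-(2 + e) * j)),
          ENNReal.ofReal_sum_of_nonneg hgp]
  calc ∫⁻ x, ‖trigPoly (latticeBox (2 ^ J)) a x‖ₑ ^ p ≤ ∫⁻ x, ENNReal.ofReal (L ^ (p - 1)) *
        ∑ j ∈ Finset.range J, ENNReal.ofReal (l j ^ (1 - p)) * ‖T j x‖ₑ ^ p := lintegral_mono hpt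
    _ = ENNReal.ofReal (L ^ (p - 1)) *
        ∑ j ∈ Finset.range J, ENNReal.ofReal (l j ^ (1 - p)) * ∫⁻ x, ‖T j x‖ₑ ^ p := by
        rw [lintegral_const_mul' _ _ ENNReal.ofReal_ne_top,
          lintegral_finsetSum _ fun j _ => (hmeas j).const_mul _]
        simp_rw [lintegral_const_mul' _ _ ENNReal.ofReal_ne_top]
    _ ≤ ENNReal.ofReal (L ^ (p - 1)) * ∑ j ∈ Finset.range J, ENNReal.ofReal (16 ^ (p - 2) * A ^ p) *
        (ENNReal.ofReal (2 ^ (-(2 + e) * j)) * ∑ n ∈ latticeShell j, ENNReal.ofReal (g n ^ p)) := by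
        exact mul_le_mul_right (Finset.sum_le_sum fun j _ => hterm j) _
    _ = ENNReal.ofReal (L ^ (p - 1) * 16 ^ (p - 2) * A ^ p) * ∑ j ∈ Finset.range J,
        (ENNReal.ofReal (2 ^ (-(2 + e) * j)) * ∑ n ∈ latticeShell j, ENNReal.ofReal (g n ^ p)) := by
        rw [← Finset.mul_sum, ← mul_assoc, ← ENNReal.ofReal_mul (by positivity), mul_assoc (L ^ (p - 1))]
    _ ≤ _ := by
        gcongr
        exact ENNReal.sum_le_tsum _

/-- The unit cube `(-1/2, 1/2]²` in coordinates. -/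
def unitCube : Set (Fin 2 → ℝ) := {x | ∀ i, x i ∈ Ioc (-1 / 2 : ℝ) (-1 / 2 + 1)}

theorem measurableSet_unitCube : MeasurableSet unitCube := by
  have : unitCube = Set.pi univ fun _ => Ioc (-1 / 2 : ℝ) (-1 / 2 + 1) := by
    ext x; simp [unitCube]
  rw [this]
  exact MeasurableSet.univ_pi fun _ => measurableSet_Ioc

theorem volume_unitCube : volume unitCube = 1 := by
  have : unitCube = Set.pi univ fun _ => Ioc (-1 / 2 : ℝ) (-1 / 2 + 1) := by
    ext x; simp [unitCube]
  rw [this, volume_pi_pi]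
  simp

/-- The character `x ↦ exp (2 π i ⟨n, x⟩)`. -/
noncomputable def planeChar (n : Fin 2 → ℤ) (x : Fin 2 → ℝ) : ℂ :=
  Complex.exp (((2 * Real.pi * (n 0 * x 0 + n 1 * x 1) : ℝ) : ℂ) * Complex.I)

theorem continuous_planeChar (n : Fin 2 → ℤ) : Continuous (planeChar n) := by
  unfold planeChar
  fun_prop

theorem norm_planeChar (n : Fin 2 → ℤ) (x : Fin 2 → ℝ) : ‖planeChar n x‖ = 1 :=
  Complex.norm_exp_ofReal_mul_I _

theorem mFourier_coe_eq_planeChar (n : Fin 2 → ℤ) (x : Fin 2 → ℝ) :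
    mFourier n (fun i => (x i : UnitAddCircle)) = planeChar n x := by
  simp only [mFourier, ContinuousMap.coe_mk, Fin.prod_univ_two, fourier_coe_apply, planeChar]
  rw [← Complex.exp_add]
  congr 1
  push_cast
  ring

theorem integral_planeChar_eq_zero {n : Fin 2 → ℤ} (hn : n ≠ 0) : ∫ x in unitCube, planeChar n x = 0 := by
  have h1 : ∫ x : UnitAddTorus (Fin 2), mFourier n x = ∫ x in unitCube, planeChar n x := by
    rw [integral_preimage _ fun _ => (-1 / 2 : ℝ)]
    simp_rw [mFourier_coe_eq_planeChar]
    rfl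
  have h2 := (orthonormal_mFourier (d := Fin 2)).2 (Ne.symm hn)
  rw [← h1]
  simp only [ContinuousMap.inner_toLp, ← mFourier_neg, ← mFourier_add] at h2
  simpa using h2

/-- An `L^p` bound, `2 ≤ p < 4`, for a function on the unit cube in terms of bounds for its Fourier
coefficients on dyadic shells. -/
theorem exists_lintegral_unitCube_le {p : ℝ} (hp2 : 2 ≤ p) (hp4 : p < 4) :
    ∃ K : ℝ, 0 ≤ K ∧ ∀ (D : (Fin 2 → ℝ) → ℂ), Measurable D → (∃ M : ℝ, ∀ x, ‖D x‖ ≤ M) →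
      ∫ x in unitCube, D x = 0 →
      ∀ (A : ℝ) (g : (Fin 2 → ℤ) → ℝ), 0 ≤ A → (∀ n, 0 ≤ g n) →
      (∀ j, ∀ n ∈ latticeShell j,
        ‖∫ x in unitCube, planeChar (-n) x * D x‖ ≤ A * 2 ^ (-(3 / 2 : ℝ) * j) * g n) →
      ∫⁻ x in unitCube, ‖D x‖ₑ ^ p ≤ ENNReal.ofReal (K * A ^ p) *
        ∑' j : ℕ, ENNReal.ofReal (2 ^ (-(2 + (4 - p) / (2 * p)) * j)) *
          ∑ n ∈ latticeShell j, ENNReal.ofReal (g n ^ p) := by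
  obtain ⟨K, hK, h⟩ := exists_lintegral_torus_le hp2 hp4
  refine ⟨K, hK, fun D hD ⟨M, hM⟩ hD0 A g hA hg hbound => ?_⟩
  set F : UnitAddTorus (Fin 2) → ℂ := fun y => D (measurableEquivPiIoc (fun _ => (-1 / 2 : ℝ)) y).1
    with hF
  have hFx : ∀ x ∈ unitCube, F (fun i => (x i : UnitAddCircle)) = D x := by
    intro x hx
    have h1 : (fun i => (x i : UnitAddCircle)) =
      (measurableEquivPiIoc (fun _ => (-1 / 2 : ℝ))).symm ⟨x, hx⟩ := rfl
    simp only [hF]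
    rw [h1, MeasurableEquiv.apply_symm_apply]
  have hFm : Measurable F :=
    hD.comp (measurable_subtype_coe.comp (measurableEquivPiIoc (fun _ => (-1 / 2 : ℝ))).measurable)
  have hF2 : MemLp F 2 volume :=
    MemLp.of_bound hFm.aestronglyMeasurable M (Filter.Eventually.of_forall fun y => hM _)
  have hcoef : ∀ n, mFourierCoeff F n = ∫ x in unitCube, planeChar (-n) x * D x := by
    intro n
    rw [mFourierCoeff_eq_integral F n fun _ => (-1 / 2 : ℝ)]
    apply setIntegral_congr_fun measurableSet_unitCube
    intro x hx
    simp only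
    rw [hFx x hx, mFourier_coe_eq_planeChar, smul_eq_mul]
  have h0 : mFourierCoeff F 0 = 0 := by
    rw [hcoef, ← hD0]
    congr 1
    ext x
    simp [planeChar]
  have := h F hF2 h0 A g hA hg (fun j n hn => by rw [hcoef]; exact hbound j n hn)
  refine le_trans (le_of_eq ?_) this
  rw [lintegral_preimage _ fun _ => (-1 / 2 : ℝ)]
  apply setLIntegral_congr_fun measurableSet_unitCube
  intro x hx
  simp only
  rw [hFx x hx]

end Torus

/-! ### Periodization and the lattice point count. -/

/-- The number of integer points `n` of the box with `n - x ∈ K`. -/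
noncomputable def latticeCount (K : Set (Fin 2 → ℝ)) (M : ℕ) (x : Fin 2 → ℝ) : ℝ :=
  ∑ n ∈ latticeBox M, K.indicator 1 ((fun i => (n i : ℝ)) - x)

section Count

variable {K : Set (Fin 2 → ℝ)} {M : ℕ}

theorem measurable_latticeCount (hK : MeasurableSet K) : Measurable (latticeCount K M) := by
  unfold latticeCount
  refine Finset.measurable_sum _ fun n _ => ?_
  exact (measurable_one.indicator hK).comp (measurable_const.sub measurable_id)

theorem latticeCount_nonneg (x : Fin 2 → ℝ) : 0 ≤ latticeCount K M x :=
  Finset.sum_nonneg fun _ _ => indicator_nonneg (fun _ _ => zero_le_one) _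

theorem latticeCount_le (x : Fin 2 → ℝ) : latticeCount K M x ≤ (latticeBox M).card := by
  have : ∀ n ∈ latticeBox M, K.indicator 1 ((fun i => (n i : ℝ)) - x) ≤ (1 : ℝ) := fun n _ =>
    indicator_le_self' (fun _ _ => zero_le_one) _
  refine (Finset.sum_le_sum this).trans (le_of_eq ?_)
  simp

theorem planeChar_neg_sub (n m : Fin 2 → ℤ) (y : Fin 2 → ℝ) :
    planeChar (-n) y = planeChar n ((fun i => (m i : ℝ)) - y) := by
  unfold planeChar
  have h : ((2 * Real.pi * (n 0 * (((fun i => (m i : ℝ)) - y) 0) + n 1 * (((fun i => (m i : ℝ)) - y) 1)) : ℝ) : ℂ) *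
      Complex.I = ((2 * Real.pi * (((-n) 0 : ℤ) * y 0 + ((-n) 1 : ℤ) * y 1) : ℝ) : ℂ) * Complex.I +
        ((n 0 * m 0 + n 1 * m 1 : ℤ) : ℂ) * (2 * Real.pi * Complex.I) := by
    simp only [Pi.sub_apply, Pi.neg_apply]
    push_cast
    ring
  rw [h, Complex.exp_add, Complex.exp_int_mul_two_pi_mul_I, mul_one]

/-- The Fourier coefficients of the periodization of an indicator function. -/
theorem integral_planeChar_mul_latticeCount (hK : MeasurableSet K) (hfin : volume K ≠ ⊤)
    (hKM : ∀ y ∈ K, ∀ i, |y i| ≤ (M : ℝ) - 1) (n : Fin 2 → ℤ) :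
    ∫ x in unitCube, planeChar (-n) x * (latticeCount K M x : ℂ) = ∫ y in K, planeChar n y := by
  set f : (Fin 2 → ℝ) → ℂ := K.indicator (planeChar n) with hf
  have hfint : Integrable f := by
    rw [hf, integrable_indicator_iff hK]
    exact Measure.integrableOn_of_bounded (M := 1) hfin
      (continuous_planeChar n).aestronglyMeasurable
      (Filter.Eventually.of_forall fun y => (norm_planeChar n y).le)
  -- Unfolding: these reflected unit cells are disjoint, and those indexed by the box cover `K`. The
  -- cell of `y` has index `⌊y i + 1/2⌋`, which matches the half-open cube and is below `M` in
  -- modulus since `|y i| ≤ M - 1`.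
  set S : (Fin 2 → ℤ) → Set (Fin 2 → ℝ) := fun m => {y | (fun i => (m i : ℝ)) - y ∈ unitCube} with hS
  have hSm : ∀ m, MeasurableSet (S m) := fun m =>
    (measurable_const.sub measurable_id) measurableSet_unitCube
  have h1 : ∀ x, planeChar (-n) x * (latticeCount K M x : ℂ) =
      ∑ m ∈ latticeBox M, f ((fun i => (m i : ℝ)) - x) := by
    intro x
    rw [latticeCount, Complex.ofReal_sum, Finset.mul_sum]
    refine Finset.sum_congr rfl fun m _ => ?_
    rw [planeChar_neg_sub n m x, hf]
    by_cases hm : (fun i => (m i : ℝ)) - x ∈ K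
    · rw [indicator_of_mem hm, indicator_of_mem hm]; simp
    · rw [indicator_of_notMem hm, indicator_of_notMem hm]; simp
  have hsub : ∀ m : Fin 2 → ℤ, MeasurePreserving (fun x : Fin 2 → ℝ => (fun i => (m i : ℝ)) - x) :=
    fun m => Measure.measurePreserving_sub_left volume _
  have h2 : ∀ m : Fin 2 → ℤ, ∫ x in unitCube, f ((fun i => (m i : ℝ)) - x) = ∫ y in S m, f y := by
    intro m
    have hemb : MeasurableEmbedding (fun x : Fin 2 → ℝ => (fun i => (m i : ℝ)) - x) :=
      (MeasurableEquiv.subLeft (fun i => (m i : ℝ))).measurableEmbedding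
    rw [← (hsub m).setIntegral_preimage_emb hemb f (S m)]
    congr 2
    ext x
    simp [hS]
  have hdisj : Set.Pairwise (latticeBox M : Set (Fin 2 → ℤ)) (Function.onFun Disjoint S) := by
    intro m _ m' _ hmm
    refine Set.disjoint_left.mpr fun y hy hy' => hmm ?_
    ext i
    have h3 := hy i
    have h4 := hy' i
    simp only [Pi.sub_apply] at h3 h4
    have h5 : (m i : ℝ) < m' i + 1 := by linarith [h3.2, h4.1]
    have h6 : (m' i : ℝ) < m i + 1 := by linarith [h3.1, h4.2]
    have h5' : m i < m' i + 1 := by exact_mod_cast h5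
    have h6' : m' i < m i + 1 := by exact_mod_cast h6
    omega
  have hcover : ∀ y, y ∉ ⋃ m ∈ latticeBox M, S m → f y = 0 := by
    intro y hy
    rw [hf]
    apply indicator_of_notMem
    intro hyK
    apply hy
    have hfl : ∀ i, (⌊y i + 1 / 2⌋ : ℝ) ≤ y i + 1 / 2 ∧ y i + 1 / 2 < ⌊y i + 1 / 2⌋ + 1 :=
      fun i => ⟨Int.floor_le _, Int.lt_floor_add_one _⟩
    refine mem_iUnion₂.mpr ⟨fun i => ⌊y i + 1 / 2⌋, mem_latticeBox.mpr fun i => ?_, fun i => ?_⟩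
    · have h3 := abs_le.mp (hKM y hyK i)
      have h4 : |(⌊y i + 1 / 2⌋ : ℝ)| < M := by
        rw [abs_lt]
        constructor <;> linarith [(hfl i).1, (hfl i).2]
      exact_mod_cast h4
    · simp only [Pi.sub_apply]
      constructor <;> linarith [(hfl i).1, (hfl i).2]
  simp_rw [h1]
  rw [integral_finsetSum]
  · simp_rw [h2]
    rw [← integral_biUnion_finset _ (fun m _ => hSm m) hdisj fun m _ => hfint.integrableOn,
      setIntegral_eq_integral_of_forall_compl_eq_zero hcover, hf, integral_indicator hK]
  · intro m _
    exact ((hsub m).integrable_comp_of_integrable hfint).integrableOn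

end Count

section Body

variable {C : Set Plane}

/-- The set `R σ(C)` in coordinates, where `σ` is the rotation by `θ`. -/
def rotatedBody (C : Set Plane) (R θ : ℝ) : Set (Fin 2 → ℝ) :=
  {y | WithLp.toLp 2 y ∈ (fun x : Plane => R • rot θ x) '' C}

theorem isCompact_rotatedBody (hC : IsCompact C) (R θ : ℝ) : IsCompact (rotatedBody C R θ) := by
  have hc : Continuous fun x : Plane => R • rot θ x := by unfold rot; fun_prop
  have h : rotatedBody C R θ = (fun z : Plane => (z : Fin 2 → ℝ)) ''
      ((fun x : Plane => R • rot θ x) '' C) := by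
    ext y
    constructor
    · intro hy
      exact ⟨_, hy, rfl⟩
    · rintro ⟨z, hz, rfl⟩
      exact hz
  rw [h]
  exact (hC.image hc).image (by fun_prop)

theorem abs_le_of_mem_rotatedBody (hbox : ∀ x ∈ C, ∀ i, x i ∈ Ioo (-1 / 2 : ℝ) (1 / 2)) {R : ℝ}
    (hR : 0 ≤ R) {θ : ℝ} {y : Fin 2 → ℝ} (hy : y ∈ rotatedBody C R θ) (i : Fin 2) : |y i| ≤ R := by
  obtain ⟨x, hx, hxy⟩ := hy
  have h0 := hbox x hx 0
  have h1 := hbox x hx 1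
  have ha0 : |x 0| ≤ 1 / 2 := abs_le.mpr ⟨by linarith [h0.1], h0.2.le⟩
  have ha1 : |x 1| ≤ 1 / 2 := abs_le.mpr ⟨by linarith [h1.1], h1.2.le⟩
  have hy : ∀ i, y i = R * rot θ x i := by
    intro i
    have := congrArg (fun z : Plane => z i) hxy
    simpa using this.symm
  have hc := Real.abs_cos_le_one θ
  have hs := Real.abs_sin_le_one θ
  have hrot : |rot θ x i| ≤ 1 := by
    have hp : ∀ a b c d : ℝ, |a| ≤ 1 → |b| ≤ 1 / 2 → |c| ≤ 1 → |d| ≤ 1 / 2 → |a * b| + |c * d| ≤ 1 := by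
      intro a b c d ha hb hc hd
      rw [abs_mul, abs_mul]
      nlinarith [abs_nonneg a, abs_nonneg b, abs_nonneg c, abs_nonneg d]
    fin_cases i
    · simp only [rot, Fin.zero_eta, Matrix.cons_val_zero]
      exact (abs_sub _ _).trans (hp _ _ _ _ hc ha0 hs ha1)
    · simp only [rot, Fin.mk_one, Matrix.cons_val_one, Matrix.cons_val_fin_one]
      exact (abs_add_le _ _).trans (hp _ _ _ _ hs ha0 hc ha1)
  rw [hy i, abs_mul, abs_of_nonneg hR]
  exact mul_le_of_le_one_right hR hrot

open scoped Pointwise in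
theorem setIntegral_rotatedBody {R : ℝ} (hR : 0 < R) (θ : ℝ) (n : Fin 2 → ℤ) :
    ∫ y in rotatedBody C R θ, planeChar n y =
      (R ^ 2 : ℝ) • ∫ x in C, planeChar n (R • rot θ x : Plane) := by
  have h1 : ∫ y in rotatedBody C R θ, planeChar n y =
      ∫ z in (fun x : Plane => R • rot θ x) '' C, planeChar n (z : Plane) := by
    have hmp := PiLp.volume_preserving_ofLp (Fin 2)
    have hemb : MeasurableEmbedding (@WithLp.ofLp 2 (Fin 2 → ℝ)) :=
      (MeasurableEquiv.toLp 2 (Fin 2 → ℝ)).symm.measurableEmbedding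
    exact (hmp.setIntegral_preimage_emb hemb (planeChar n) (rotatedBody C R θ)).symm
  have h2 : (fun x : Plane => R • rot θ x) '' C = R • (rot θ '' C) := by
    rw [← image_smul, image_image]
  have h3 := Measure.setIntegral_comp_smul (volume : Measure Plane)
    (fun z : Plane => planeChar n z) (s := rot θ '' C) hR.ne'
  have h4 : ∫ z in rot θ '' C, planeChar n (R • z : Plane) = ∫ x in C, planeChar n (R • rot θ x : Plane) := by
    have := (rotIso θ).measurePreserving.setIntegral_preimage_emb
      (rotIso θ).toHomeomorph.measurableEmbedding (fun z => planeChar n (R • z : Plane)) (rot θ '' C)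
    rw [← this]
    have hpre : ⇑(rotIso θ) ⁻¹' (rot θ '' C) = C :=
      preimage_image_eq C (rotIso θ).injective
    rw [hpre]
    rfl
  rw [h1, h2]
  rw [h4, finrank_euclideanSpace_fin, abs_of_pos (by positivity)] at h3
  rw [h3, smul_smul, mul_inv_cancel₀ (by positivity), one_smul]

/-- An integer point counted is within `R + 1/2 < M` of the origin in each coordinate, so truncating
to the box loses nothing. -/
theorem discrepancy_eq_latticeCount (hbox : ∀ x ∈ C, ∀ i, x i ∈ Ioo (-1 / 2 : ℝ) (1 / 2)) {R : ℝ}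
    (hR : 0 ≤ R) {M : ℕ} (hM : R ≤ (M : ℝ) - 1) (θ : ℝ) {x : Fin 2 → ℝ} (hx : x ∈ unitCube) :
    discrepancy C R θ (WithLp.toLp 2 x) =
      latticeCount (rotatedBody C R θ) M x - R ^ 2 * volume.real C := by
  classical
  have hset : (fun z : Plane => R • rot θ z + WithLp.toLp 2 x) '' C ∩ integerPoints =
      (fun n : Fin 2 → ℤ => (WithLp.toLp 2 (fun i => (n i : ℝ)) : Plane)) ''
        ((latticeBox M).filter fun n => (fun i => (n i : ℝ)) - x ∈ rotatedBody C R θ :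
          Finset (Fin 2 → ℤ)) := by
    ext z
    simp only [mem_inter_iff, mem_image, Finset.coe_filter, mem_ofPred_eq]
    constructor
    · rintro ⟨⟨w, hw, rfl⟩, hint⟩
      choose n hn using hint
      have hn' : (WithLp.toLp 2 (fun i => (n i : ℝ)) : Plane) = R • rot θ w + WithLp.toLp 2 x := by
        ext i
        exact (hn i).symm
      have hmem : (fun i => (n i : ℝ)) - x ∈ rotatedBody C R θ := by
        refine ⟨w, hw, ?_⟩
        ext i
        have := hn i
        simp only [PiLp.add_apply] at this
        simp only [Pi.sub_apply]
        linarith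
      refine ⟨n, ⟨mem_latticeBox.mpr fun i => ?_, hmem⟩, hn'⟩
      have h1 := abs_le.mp (abs_le_of_mem_rotatedBody hbox hR hmem i)
      simp only [Pi.sub_apply] at h1
      have h2 := hx i
      have h3 : |(n i : ℝ)| < M := by
        rw [abs_lt]
        constructor <;> linarith [h2.1, h2.2]
      exact_mod_cast h3
    · rintro ⟨n, ⟨-, w, hw, hwn⟩, rfl⟩
      refine ⟨⟨w, hw, ?_⟩, fun i => ⟨n i, rfl⟩⟩
      simp only at hwn
      rw [hwn]
      ext i
      simp
  have hinj : Function.Injective (fun n : Fin 2 → ℤ => (WithLp.toLp 2 (fun i => (n i : ℝ)) : Plane)) := by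
    intro n m h
    ext i
    have := congrArg (fun z : Plane => z i) h
    simpa using this
  rw [discrepancy, hset, ncard_image_of_injective _ hinj, ncard_coe_finset, latticeCount,
    Finset.card_filter]
  push_cast
  rw [neg_add_eq_sub]
  rfl

end Body

/-! ### Averages of negative powers of the cosine over rotations. -/

theorem integrableOn_abs_rpow {r : ℝ} (hr : -1 < r) {M : ℝ} (hM : 0 ≤ M) :
    IntegrableOn (fun x : ℝ => |x| ^ r) (Icc (-M) M) := by
  have h1 : IntervalIntegrable (fun x : ℝ => |x| ^ r) volume 0 M := by
    refine (intervalIntegral.intervalIntegrable_rpow' hr).congr fun x hx => ?_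
    rw [uIoc_of_le hM] at hx
    rw [abs_of_pos hx.1]
  have h2 : IntervalIntegrable (fun x : ℝ => |x| ^ r) volume (-M) 0 := by
    have := ((IntervalIntegrable.iff_comp_neg (f := fun x : ℝ => |x| ^ r)).mp h1).symm
    simpa using this
  have h3 := h2.trans h1
  rwa [intervalIntegrable_iff_integrableOn_Icc_of_le (by linarith)] at h3

/-- Jordan's inequality for the sine at the nearest zero of the cosine, found by rounding. -/
theorem exists_abs_cos_ge (u : ℝ) :
    ∃ k : ℤ, |u - (Real.pi / 2 + k * Real.pi)| ≤ Real.pi / 2 ∧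
      2 / Real.pi * |u - (Real.pi / 2 + k * Real.pi)| ≤ |Real.cos u| := by
  have hpi := Real.pi_pos
  set k := round ((u - Real.pi / 2) / Real.pi) with hk
  have h1 := abs_sub_round ((u - Real.pi / 2) / Real.pi)
  rw [← hk] at h1
  have h2 : u - (Real.pi / 2 + k * Real.pi) = ((u - Real.pi / 2) / Real.pi - k) * Real.pi := by
    field_simp
    ring
  have h3 : |u - (Real.pi / 2 + k * Real.pi)| ≤ Real.pi / 2 := by
    rw [h2, abs_mul, abs_of_pos hpi]
    nlinarith
  refine ⟨k, h3, (Real.mul_abs_le_abs_sin h3).trans (le_of_eq ?_)⟩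
  have h4 : u - (Real.pi / 2 + k * Real.pi) = (u - Real.pi / 2) - k * Real.pi := by ring
  rw [h4, Real.sin_sub_int_mul_pi, abs_mul, abs_zpow, abs_neg, abs_one, one_zpow, one_mul,
    Real.sin_sub_pi_div_two, abs_neg]

/-- Integrability of negative powers of the cosine. -/
theorem lintegral_abs_cos_rpow_lt_top {q : ℝ} (hq0 : 0 < q) (hq : q < 1) :
    ∫⁻ u in Icc (-3 * Real.pi) Real.pi, ENNReal.ofReal (|Real.cos u| ^ (-q)) < ⊤ := by
  have hpi := Real.pi_pos
  set M := 10 * Real.pi with hM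
  have hM0 : 0 ≤ M := by positivity
  set z : ℤ → ℝ := fun k => Real.pi / 2 + k * Real.pi with hz
  -- Near each zero of the cosine the integrand is dominated by a translate of `|v| ^ (-q)`; the
  -- index range and `M` are generous choices covering every zero that can occur.
  have hpt : ∀ u ∈ Icc (-3 * Real.pi) Real.pi, ENNReal.ofReal (|Real.cos u| ^ (-q)) ≤
      ∑ k ∈ Finset.Icc (-5 : ℤ) 5, (Icc (-M) M).indicator
        (fun v => ENNReal.ofReal ((2 / Real.pi) ^ (-q) * |v| ^ (-q))) (u - z k) := by
    intro u hu
    obtain ⟨k, hk1, hk2⟩ := exists_abs_cos_ge u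
    have hk := abs_le.mp hk1
    have hk3 : k ∈ Finset.Icc (-5 : ℤ) 5 := by
      rw [Finset.mem_Icc]
      have h5 : (k : ℝ) * Real.pi ≤ 1 * Real.pi := by linarith [hu.2, hk.1]
      have h6 : (-5 : ℝ) * Real.pi ≤ k * Real.pi := by linarith [hu.1, hk.2]
      have h7 := le_of_mul_le_mul_right h5 hpi
      have h8 := le_of_mul_le_mul_right h6 hpi
      constructor
      · exact_mod_cast h8
      · have : k ≤ 1 := by exact_mod_cast h7
        omega
    refine le_trans ?_ (Finset.single_le_sum (fun i _ => zero_le) hk3)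
    rw [indicator_of_mem (by constructor <;> simp only [hz, hM] <;> linarith [hk.1, hk.2])]
    apply ENNReal.ofReal_le_ofReal
    rw [← Real.mul_rpow (by positivity) (abs_nonneg _)]
    rcases (abs_nonneg (u - z k)).eq_or_lt with h0 | h0
    · have hu0 : u - z k = 0 := abs_eq_zero.mp h0.symm
      have hcos : Real.cos u = 0 := by
        rw [Real.cos_eq_zero_iff]
        refine ⟨k, ?_⟩
        simp only [hz] at hu0
        linarith
      -- At a zero of the cosine the convention `0 ^ (-q) = 0` makes the bound trivial.
      rw [hcos, abs_zero, Real.zero_rpow (by linarith)]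
      positivity
    · exact Real.rpow_le_rpow_of_nonpos (by positivity) hk2 (by linarith)
  have hmeas : Measurable ((Icc (-M) M).indicator
      (fun v : ℝ => ENNReal.ofReal ((2 / Real.pi) ^ (-q) * |v| ^ (-q)))) := by
    apply Measurable.indicator _ measurableSet_Icc
    fun_prop
  have hfin : ∫⁻ v, (Icc (-M) M).indicator
      (fun v => ENNReal.ofReal ((2 / Real.pi) ^ (-q) * |v| ^ (-q))) v < ⊤ := by
    rw [lintegral_indicator measurableSet_Icc]
    exact ((integrableOn_abs_rpow (by linarith : -1 < -q) hM0).const_mul _).lintegral_lt_top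
  calc ∫⁻ u in Icc (-3 * Real.pi) Real.pi, ENNReal.ofReal (|Real.cos u| ^ (-q)) ≤
      ∫⁻ u in Icc (-3 * Real.pi) Real.pi, ∑ k ∈ Finset.Icc (-5 : ℤ) 5, (Icc (-M) M).indicator
        (fun v => ENNReal.ofReal ((2 / Real.pi) ^ (-q) * |v| ^ (-q))) (u - z k) :=
        setLIntegral_mono' measurableSet_Icc hpt
    _ ≤ ∫⁻ u, ∑ k ∈ Finset.Icc (-5 : ℤ) 5, (Icc (-M) M).indicator
        (fun v => ENNReal.ofReal ((2 / Real.pi) ^ (-q) * |v| ^ (-q))) (u - z k) :=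
        setLIntegral_le_lintegral _ _
    _ = ∑ k ∈ Finset.Icc (-5 : ℤ) 5, ∫⁻ u, (Icc (-M) M).indicator
        (fun v => ENNReal.ofReal ((2 / Real.pi) ^ (-q) * |v| ^ (-q))) (u - z k) :=
        lintegral_finsetSum _ fun k _ => hmeas.comp (measurable_id.sub_const _)
    _ = ∑ k ∈ Finset.Icc (-5 : ℤ) 5, ∫⁻ u, (Icc (-M) M).indicator
        (fun v => ENNReal.ofReal ((2 / Real.pi) ^ (-q) * |v| ^ (-q))) u := by
        simp_rw [lintegral_sub_right_eq_self]
    _ < ⊤ := by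
        rw [Finset.sum_const, nsmul_eq_mul]
        exact ENNReal.mul_lt_top (by simp) hfin

theorem angleMeasure_univ : angleMeasure univ = 1 := by
  have hpi := Real.two_pi_pos
  rw [angleMeasure, Measure.smul_apply, Measure.restrict_apply_univ, Real.volume_Ico, sub_zero,
    smul_eq_mul]
  exact ENNReal.inv_mul_cancel (by simpa using hpi) ENNReal.ofReal_ne_top

theorem lintegral_angleMeasure_le (f : ℝ → ENNReal) :
    ∫⁻ θ, f θ ∂angleMeasure ≤ ∫⁻ θ in Icc 0 (2 * Real.pi), f θ := by
  rw [angleMeasure, lintegral_smul_measure, smul_eq_mul]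
  have h1 : (ENNReal.ofReal (2 * Real.pi))⁻¹ ≤ 1 := by
    rw [ENNReal.inv_le_one, ← ENNReal.ofReal_one]
    apply ENNReal.ofReal_le_ofReal
    linarith [Real.pi_gt_three]
  calc _ ≤ 1 * ∫⁻ θ in Icc 0 (2 * Real.pi), f θ := by
        gcongr
        exact Ico_subset_Icc_self
    _ = _ := one_mul _

/-- For `φ` in `[-π, π]` and `θ` in `[0, 2π]` the difference stays in `[-3π, π]`, so one integral
bounds all frequencies uniformly. -/
theorem exists_lintegral_angle_le {q : ℝ} (hq0 : 0 < q) (hq : q < 1) :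
    ∃ I : ENNReal, I < ⊤ ∧ ∀ φ ∈ Icc (-Real.pi) Real.pi,
      ∫⁻ θ, ENNReal.ofReal (|Real.cos (φ - θ)| ^ (-q)) ∂angleMeasure ≤ I := by
  refine ⟨_, lintegral_abs_cos_rpow_lt_top hq0 hq, fun φ hφ => ?_⟩
  refine (lintegral_angleMeasure_le _).trans ?_
  set G : ℝ → ENNReal := (Icc (-3 * Real.pi) Real.pi).indicator
    fun u => ENNReal.ofReal (|Real.cos u| ^ (-q)) with hG
  calc ∫⁻ θ in Icc 0 (2 * Real.pi), ENNReal.ofReal (|Real.cos (φ - θ)| ^ (-q))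
      ≤ ∫⁻ θ in Icc 0 (2 * Real.pi), G (φ - θ) := by
        apply setLIntegral_mono' measurableSet_Icc
        intro θ hθ
        rw [hG, indicator_of_mem (show φ - θ ∈ Icc (-3 * Real.pi) Real.pi from
          ⟨by linarith [hφ.1, hθ.2], by linarith [hφ.2, hθ.1]⟩)]
    _ ≤ ∫⁻ θ, G (φ - θ) := setLIntegral_le_lintegral _ _
    _ = ∫⁻ u, G u := lintegral_sub_left_eq_self G φ
    _ = _ := lintegral_indicator measurableSet_Icc _

/-- Rotations aligning the flat normal with a lattice direction are discarded: there the quadratic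
constant vanishes and `0 ^ (-q) = 0` would not be a valid bound. They are countably many. -/
theorem ae_angleMeasure_cos_ne_zero {ι : Type*} [Countable ι] (φ : ι → ℝ) :
    ∀ᵐ θ ∂angleMeasure, ∀ i, Real.cos (φ i - θ) ≠ 0 := by
  have hac : angleMeasure ≪ volume :=
    Measure.absolutelyContinuous_of_le_smul (c := (ENNReal.ofReal (2 * Real.pi))⁻¹)
      (by unfold angleMeasure; gcongr; exact Measure.restrict_le_self)
  refine hac.ae_le (show ∀ᵐ θ : ℝ, ∀ i, Real.cos (φ i - θ) ≠ 0 from ?_)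
  rw [ae_all_iff]
  intro i
  have hc : (range fun k : ℤ => φ i - (2 * k + 1) * Real.pi / 2).Countable := countable_range _
  filter_upwards [hc.ae_notMem volume] with θ hθ hcos
  obtain ⟨k, hk⟩ := Real.cos_eq_zero_iff.mp hcos
  exact hθ ⟨k, by simp only; linarith⟩

/-! ### Fourier coefficients of the discrepancy and the averaged bound. -/

/-- The complex number `-(n 0 + n 1 i)`. -/
noncomputable def negLatticeComplex (n : Fin 2 → ℤ) : ℂ := ⟨-(n 0 : ℝ), -(n 1 : ℝ)⟩

/-- The polar angle of `-n`. -/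
noncomputable def latticeAngle (n : Fin 2 → ℤ) : ℝ := (negLatticeComplex n).arg

theorem two_pow_le_norm_of_mem_latticeShell {j : ℕ} {n : Fin 2 → ℤ} (hn : n ∈ latticeShell j) :
    (2 : ℝ) ^ j ≤ ‖negLatticeComplex n‖ := by
  rw [latticeShell, Finset.mem_sdiff, mem_latticeBox, mem_latticeBox] at hn
  obtain ⟨i, hi⟩ := not_forall.mp hn.2
  push Not at hi
  have h1 : (2 : ℝ) ^ j ≤ |(n i : ℝ)| := by exact_mod_cast hi
  refine h1.trans ?_
  fin_cases i
  · simpa [negLatticeComplex] using Complex.abs_re_le_norm (negLatticeComplex n)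
  · simpa [negLatticeComplex] using Complex.abs_im_le_norm (negLatticeComplex n)

theorem ne_zero_of_mem_latticeShell {j : ℕ} {n : Fin 2 → ℤ} (hn : n ∈ latticeShell j) : n ≠ 0 := by
  rintro rfl
  rw [latticeShell, Finset.mem_sdiff, mem_latticeBox, mem_latticeBox] at hn
  exact hn.2 fun i => by simp

/-- The rotation is moved from `x` onto the frequency. The polar angle of `-n` rather than `n`
appears because the decay estimate is stated for the phase with a minus sign. -/
theorem planeChar_smul_rot (n : Fin 2 → ℤ) (R θ : ℝ) (x : Plane) :
    planeChar n (R • rot θ x : Plane) =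
      Complex.exp (((-2 * Real.pi * (R * ‖negLatticeComplex n‖) *
        (x 0 * Real.cos (latticeAngle n - θ) + x 1 * Real.sin (latticeAngle n - θ)) : ℝ) : ℂ) *
          Complex.I) := by
  have h0 : (n 0 : ℝ) = -(‖negLatticeComplex n‖ * Real.cos (latticeAngle n)) := by
    rw [latticeAngle, Complex.norm_mul_cos_arg]; simp [negLatticeComplex]
  have h1 : (n 1 : ℝ) = -(‖negLatticeComplex n‖ * Real.sin (latticeAngle n)) := by
    rw [latticeAngle, Complex.norm_mul_sin_arg]; simp [negLatticeComplex]
  unfold planeChar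
  congr 3
  rw [h0, h1, Real.cos_sub, Real.sin_sub]
  simp only [rot, PiLp.smul_apply, smul_eq_mul, Matrix.cons_val_zero, Matrix.cons_val_one,
    Matrix.cons_val_fin_one]
  ring

theorem sq_mul_decay_le {R N : ℝ} (hR : 0 < R) {j : ℕ} (hN : (2 : ℝ) ^ j ≤ N) :
    R ^ 2 * (1 / (R * N) * √(1 / (R * N))) ≤ √R * 2 ^ (-(3 / 2 : ℝ) * j) := by
  have ht : (0 : ℝ) < 2 ^ j := by positivity
  have h1 : (2 : ℝ) ^ (-(3 / 2 : ℝ) * j) = 1 / (2 ^ j * √(2 ^ j)) := by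
    rw [neg_mul, Real.rpow_neg (by norm_num), one_div]
    congr 1
    rw [Real.sqrt_eq_rpow, ← Real.rpow_natCast, ← Real.rpow_mul (by norm_num),
      ← Real.rpow_add (by norm_num)]
    congr 1; ring
  generalize (2 : ℝ) ^ j = t at *
  calc R ^ 2 * (1 / (R * N) * √(1 / (R * N))) ≤ R ^ 2 * (1 / (R * t) * √(1 / (R * t))) := by gcongr
    _ = √R * (1 / (t * √t)) := by
      rw [Real.sqrt_div zero_le_one, Real.sqrt_one, Real.sqrt_mul hR.le]
      have hs : √R * √R = R := Real.mul_self_sqrt hR.le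
      have hs0 : 0 < √R := Real.sqrt_pos.mpr hR
      field_simp
      nlinarith
    _ = _ := by rw [h1]

section Body

variable {C : Set Plane}

/-- Opposite directions share the constant `c |cos| ^ e`, since `|cos|` has period `π`; its inverse
square root is the angular factor. Dilation turns `R ^ 2 (R |n|) ^ (-3/2)` into the power `√R`. -/
theorem norm_setIntegral_rotatedBody_le (hC : IsCompact C) (hconv : Convex ℝ C) {c e : ℝ}
    (hc : 0 < c) (hq : ∀ θ, QuadSupport C θ (c * |Real.cos θ| ^ e)) {R θ : ℝ} (hR : 0 < R) {j : ℕ}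
    {n : Fin 2 → ℤ} (hn : n ∈ latticeShell j) (hcos : Real.cos (latticeAngle n - θ) ≠ 0) :
    ‖∫ y in rotatedBody C R θ, planeChar n y‖ ≤
      8 / √c * √R * 2 ^ (-(3 / 2 : ℝ) * j) * |Real.cos (latticeAngle n - θ)| ^ (-(e / 2)) := by
  have hN := two_pow_le_norm_of_mem_latticeShell hn
  have hN0 : 0 < ‖negLatticeComplex n‖ := lt_of_lt_of_le (by positivity) hN
  have ha : 0 < |Real.cos (latticeAngle n - θ)| := abs_pos.mpr hcos
  set a := |Real.cos (latticeAngle n - θ)| with hadef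
  have hb : 0 < c * a ^ e := by positivity
  have hq' : QuadSupport C (latticeAngle n - θ + Real.pi) (c * a ^ e) := by
    have := hq (latticeAngle n - θ + Real.pi)
    rwa [Real.cos_add_pi, abs_neg] at this
  have key := norm_setIntegral_exp_le hC hconv hb (mul_pos hR hN0) (hq _) hq'
  rw [setIntegral_rotatedBody hR]
  simp_rw [planeChar_smul_rot]
  rw [norm_smul, Real.norm_of_nonneg (by positivity)]
  have hsq : 8 / √(c * a ^ e) = 8 / √c * a ^ (-(e / 2)) := by
    rw [Real.sqrt_mul hc.le, Real.rpow_neg ha.le, Real.sqrt_eq_rpow (a ^ e), ← Real.rpow_mul ha.le,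
      mul_one_div, div_mul_eq_div_div]
    rfl
  rw [hsq] at key
  have hdec := sq_mul_decay_le hR hN
  have hnn : 0 ≤ 8 / √c * a ^ (-(e / 2)) := by positivity
  calc _ ≤ R ^ 2 * (8 / √c * a ^ (-(e / 2)) / (R * ‖negLatticeComplex n‖) *
        √(1 / (R * ‖negLatticeComplex n‖))) := by gcongr
    _ = 8 / √c * a ^ (-(e / 2)) * (R ^ 2 * (1 / (R * ‖negLatticeComplex n‖) *
        √(1 / (R * ‖negLatticeComplex n‖)))) := by ring
    _ ≤ 8 / √c * a ^ (-(e / 2)) * (√R * 2 ^ (-(3 / 2 : ℝ) * j)) := by gcongr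
    _ = _ := by ring

theorem setLIntegral_unitSquare (f : Plane → ENNReal) :
    ∫⁻ t in unitSquare, f t = ∫⁻ x in unitCube, f (WithLp.toLp 2 x) := by
  have hmp := PiLp.volume_preserving_toLp (Fin 2)
  have hemb : MeasurableEmbedding (@WithLp.toLp 2 (Fin 2 → ℝ)) :=
    (MeasurableEquiv.toLp 2 (Fin 2 → ℝ)).measurableEmbedding
  rw [← hmp.setLIntegral_comp_preimage_emb hemb f unitSquare]
  apply setLIntegral_congr
  have h1 : (WithLp.toLp 2 ⁻¹' unitSquare : Set (Fin 2 → ℝ)) =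
      Set.pi univ fun _ => Ico (-1 / 2 : ℝ) (1 / 2) := by
    ext x; simp [unitSquare]
  have h2 : unitCube = Set.pi univ fun _ => Ioc (-1 / 2 : ℝ) (1 / 2) := by
    ext x; simp [unitCube]; norm_num
  rw [h1, h2, volume_pi]
  exact (Measure.univ_pi_Ico_ae_eq_Icc (f := fun _ => (-1 / 2 : ℝ)) (g := fun _ => 1 / 2)).trans
    (Measure.univ_pi_Ioc_ae_eq_Icc (f := fun _ => (-1 / 2 : ℝ)) (g := fun _ => 1 / 2)).symm

theorem setIntegral_planeChar_zero_rotatedBody {R : ℝ} (hR : 0 < R) (θ : ℝ) :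
    ∫ y in rotatedBody C R θ, planeChar 0 y = ((R ^ 2 * volume.real C : ℝ) : ℂ) := by
  rw [setIntegral_rotatedBody hR]
  simp [planeChar]

/-- The `L^p` norm of the discrepancy in the translation variable, for a fixed rotation. -/
theorem exists_lintegral_discrepancy_le (hC : IsCompact C) (hconv : Convex ℝ C)
    (hbox : ∀ x ∈ C, ∀ i, x i ∈ Ioo (-1 / 2 : ℝ) (1 / 2)) {c e : ℝ} (hc : 0 < c)
    (hq : ∀ θ, QuadSupport C θ (c * |Real.cos θ| ^ e)) {p : ℝ} (hp2 : 2 ≤ p) (hp4 : p < 4) :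
    ∃ K : ℝ, 0 ≤ K ∧ ∀ R θ : ℝ, 0 < R → (∀ n, Real.cos (latticeAngle n - θ) ≠ 0) →
      ∫⁻ t in unitSquare, ‖discrepancy C R θ t‖ₑ ^ p ≤ ENNReal.ofReal (K * R ^ (p / 2)) *
        ∑' j : ℕ, ENNReal.ofReal (2 ^ (-(2 + (4 - p) / (2 * p)) * j)) *
          ∑ n ∈ latticeShell j,
            ENNReal.ofReal (|Real.cos (latticeAngle n - θ)| ^ (-(e / 2 * p))) := by
  obtain ⟨K, hK, h⟩ := exists_lintegral_unitCube_le hp2 hp4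
  refine ⟨K * (8 / √c) ^ p, by positivity, fun R θ hR hcos => ?_⟩
  obtain ⟨M, hM⟩ := exists_nat_ge (R + 1)
  have hM' : R ≤ (M : ℝ) - 1 := by linarith
  set B := rotatedBody C R θ with hB
  have hBc : IsCompact B := isCompact_rotatedBody hC R θ
  have hBm : MeasurableSet B := hBc.isClosed.measurableSet
  have hBfin : volume B ≠ ⊤ := hBc.measure_lt_top.ne
  have hBM : ∀ y ∈ B, ∀ i, |y i| ≤ (M : ℝ) - 1 := fun y hy i =>
    (abs_le_of_mem_rotatedBody hbox hR.le hy i).trans hM'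
  set v := R ^ 2 * volume.real C with hv
  set D : (Fin 2 → ℝ) → ℂ := fun x => (latticeCount B M x : ℂ) - (v : ℂ) with hD
  have hcm : Measurable fun x => (latticeCount B M x : ℂ) :=
    Complex.measurable_ofReal.comp (measurable_latticeCount hBm)
  have hDm : Measurable D := hcm.sub_const _
  have hcb : ∀ x, ‖(latticeCount B M x : ℂ)‖ ≤ (latticeBox M).card := by
    intro x
    rw [Complex.norm_real, Real.norm_of_nonneg (latticeCount_nonneg x)]
    exact latticeCount_le x
  have hDb : ∀ x, ‖D x‖ ≤ (latticeBox M).card + ‖(v : ℂ)‖ := fun x =>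
    (norm_sub_le _ _).trans (by gcongr; exact hcb x)
  have hcoef : ∀ n, ∫ x in unitCube, planeChar (-n) x * D x =
      (∫ y in B, planeChar n y) - (∫ x in unitCube, planeChar (-n) x) * v := by
    intro n
    have hi1 : IntegrableOn (fun x => planeChar (-n) x * (latticeCount B M x : ℂ)) unitCube := by
      refine Measure.integrableOn_of_bounded (M := (latticeBox M).card)
        (by rw [volume_unitCube]; simp)
        ((continuous_planeChar _).measurable.mul hcm).aestronglyMeasurable
        (Filter.Eventually.of_forall fun x => ?_)
      rw [norm_mul, norm_planeChar, one_mul]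
      exact hcb x
    have hi2 : IntegrableOn (fun x => planeChar (-n) x * (v : ℂ)) unitCube := by
      refine Measure.integrableOn_of_bounded (M := ‖(v : ℂ)‖) (by rw [volume_unitCube]; simp)
        ((continuous_planeChar _).measurable.mul_const _).aestronglyMeasurable
        (Filter.Eventually.of_forall fun x => ?_)
      rw [norm_mul, norm_planeChar, one_mul]
    simp only [hD, mul_sub]
    rw [integral_sub hi1 hi2, integral_planeChar_mul_latticeCount hBm hBfin hBM, integral_mul_const]
  -- Subtracting the area removes exactly the zero frequency, which the dyadic shells do not
  -- contain.
  have hD0 : ∫ x in unitCube, D x = 0 := by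
    have h1 := hcoef 0
    rw [hB, setIntegral_planeChar_zero_rotatedBody hR, ← hv] at h1
    have h2 : ∀ x, planeChar (-0) x = 1 := fun x => by simp [planeChar]
    simp only [h2, one_mul] at h1
    rw [h1]
    simp [measureReal_def, volume_unitCube]
  have hbound : ∀ j, ∀ n ∈ latticeShell j, ‖∫ x in unitCube, planeChar (-n) x * D x‖ ≤
      (8 / √c * √R) * 2 ^ (-(3 / 2 : ℝ) * j) * |Real.cos (latticeAngle n - θ)| ^ (-(e / 2)) := by
    intro j n hn
    rw [hcoef, integral_planeChar_eq_zero (neg_ne_zero.mpr (ne_zero_of_mem_latticeShell hn)),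
      zero_mul, sub_zero]
    exact norm_setIntegral_rotatedBody_le hC hconv hc hq hR hn (hcos n)
  have key := h D hDm ⟨_, hDb⟩ hD0 (8 / √c * √R)
    (fun n => |Real.cos (latticeAngle n - θ)| ^ (-(e / 2))) (by positivity)
    (fun n => by positivity) hbound
  have hA : K * (8 / √c * √R) ^ p = K * (8 / √c) ^ p * R ^ (p / 2) := by
    rw [Real.mul_rpow (by positivity) (by positivity), Real.sqrt_eq_rpow R, ← Real.rpow_mul hR.le,
      mul_assoc]
    congr 3
    ring
  have hg : ∀ n, (|Real.cos (latticeAngle n - θ)| ^ (-(e / 2))) ^ p =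
      |Real.cos (latticeAngle n - θ)| ^ (-(e / 2 * p)) := fun n => by
    rw [← Real.rpow_mul (abs_nonneg _), neg_mul]
  rw [hA] at key
  simp_rw [hg] at key
  refine le_trans (le_of_eq ?_) key
  rw [setLIntegral_unitSquare]
  apply setLIntegral_congr_fun measurableSet_unitCube
  intro x hx
  simp only
  rw [discrepancy_eq_latticeCount hbox hR.le hM' θ hx]
  congr 1
  rw [← ofReal_norm, ← ofReal_norm, hD, ← Complex.norm_real]
  simp [hv, hB]

/-- The averaged bound for `2 ≤ p < 4`. -/
theorem exists_lintegral_lintegral_discrepancy_le (hC : IsCompact C) (hconv : Convex ℝ C)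
    (hbox : ∀ x ∈ C, ∀ i, x i ∈ Ioo (-1 / 2 : ℝ) (1 / 2)) {c e : ℝ} (hc : 0 < c) (he : 0 < e)
    (he' : e ≤ 1 / 2)
    (hq : ∀ θ, QuadSupport C θ (c * |Real.cos θ| ^ e)) {p : ℝ} (hp2 : 2 ≤ p) (hp4 : p < 4) :
    ∃ B : ENNReal, B < ⊤ ∧ ∀ R : ℝ, 0 < R →
      ∫⁻ θ, ∫⁻ t in unitSquare, ‖discrepancy C R θ t‖ₑ ^ p ∂volume ∂angleMeasure ≤
        ENNReal.ofReal (R ^ (p / 2)) * B := by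
  obtain ⟨K, hK, h⟩ := exists_lintegral_discrepancy_le hC hconv hbox hc hq hp2 hp4
  -- Integrability needs `e p / 2 < 1`, which is where `e ≤ 1/2` and `p < 4` combine.
  obtain ⟨I, hI, hIφ⟩ := exists_lintegral_angle_le (q := e / 2 * p) (by positivity) (by nlinarith)
  set ε := (4 - p) / (2 * p) with hε
  have hε0 : 0 < ε := div_pos (by linarith) (by linarith)
  set r : ℝ := 2 ^ (-ε) with hr
  have hr0 : 0 < r := by positivity
  have hr1 : r < 1 := Real.rpow_lt_one_of_one_lt_of_neg (by norm_num) (by linarith)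
  -- The cardinality of the shell consumes `2 ^ (-2 j)`, leaving a convergent geometric series of
  -- ratio `2 ^ (-ε)`.
  have hw : ∀ j : ℕ, (2 : ℝ) ^ (-(2 + ε) * j) * (16 * 4 ^ j) = 16 * r ^ j := by
    intro j
    have h4 : (4 : ℝ) ^ j = 2 ^ (2 * (j : ℝ)) := by
      rw [Real.rpow_mul (by norm_num), Real.rpow_natCast]; norm_num
    rw [h4, mul_left_comm, ← Real.rpow_add (by norm_num), hr, ← Real.rpow_natCast,
      ← Real.rpow_mul (by norm_num)]
    congr 2
    ring
  have hmeas : ∀ n, Measurable fun θ =>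
      ENNReal.ofReal (|Real.cos (latticeAngle n - θ)| ^ (-(e / 2 * p))) := fun n => by fun_prop
  have hsum : ∫⁻ θ, ∑' j : ℕ, ENNReal.ofReal (2 ^ (-(2 + ε) * j)) * ∑ n ∈ latticeShell j,
      ENNReal.ofReal (|Real.cos (latticeAngle n - θ)| ^ (-(e / 2 * p))) ∂angleMeasure ≤
      (∑' j : ℕ, ENNReal.ofReal (16 * r ^ j)) * I := by
    rw [lintegral_tsum fun j =>
      ((Finset.measurable_sum _ fun n _ => hmeas n).const_mul _).aemeasurable, ← ENNReal.tsum_mul_right]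
    refine ENNReal.tsum_le_tsum fun j => ?_
    rw [lintegral_const_mul' _ _ ENNReal.ofReal_ne_top, lintegral_finsetSum _ fun n _ => hmeas n]
    have h1 : ∑ n ∈ latticeShell j, ∫⁻ θ, ENNReal.ofReal
        (|Real.cos (latticeAngle n - θ)| ^ (-(e / 2 * p))) ∂angleMeasure ≤
          ENNReal.ofReal (16 * 4 ^ j) * I := by
      calc _ ≤ ∑ n ∈ latticeShell j, I := Finset.sum_le_sum fun n _ =>
            hIφ _ (Ioc_subset_Icc_self (Complex.arg_mem_Ioc _))
        _ = ENNReal.ofReal ((latticeShell j).card : ℝ) * I := by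
            rw [Finset.sum_const, nsmul_eq_mul, ENNReal.ofReal_natCast]
        _ ≤ _ := by
            gcongr
            exact card_latticeShell_le j
    calc _ ≤ ENNReal.ofReal (2 ^ (-(2 + ε) * j)) * (ENNReal.ofReal (16 * 4 ^ j) * I) := by gcongr
      _ = _ := by rw [← mul_assoc, ← ENNReal.ofReal_mul (by positivity), hw]
  have hgeo : ∑' j : ℕ, ENNReal.ofReal (16 * r ^ j) < ⊤ := by
    rw [← ENNReal.ofReal_tsum_of_nonneg (fun j => by positivity)
      ((summable_geometric_of_lt_one hr0.le hr1).mul_left 16)]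
    exact ENNReal.ofReal_lt_top
  refine ⟨ENNReal.ofReal K * ((∑' j : ℕ, ENNReal.ofReal (16 * r ^ j)) * I),
    ENNReal.mul_lt_top ENNReal.ofReal_lt_top (ENNReal.mul_lt_top hgeo hI), fun R hR => ?_⟩
  have hae : ∀ᵐ θ ∂angleMeasure, ∫⁻ t in unitSquare, ‖discrepancy C R θ t‖ₑ ^ p ≤
      ENNReal.ofReal (K * R ^ (p / 2)) * ∑' j : ℕ, ENNReal.ofReal (2 ^ (-(2 + ε) * j)) *
        ∑ n ∈ latticeShell j, ENNReal.ofReal (|Real.cos (latticeAngle n - θ)| ^ (-(e / 2 * p))) := by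
    filter_upwards [ae_angleMeasure_cos_ne_zero latticeAngle] with θ hθ using h R θ hR hθ
  refine (lintegral_mono_ae hae).trans ?_
  rw [lintegral_const_mul' _ _ ENNReal.ofReal_ne_top, mul_comm K,
    ENNReal.ofReal_mul (by positivity), mul_assoc]
  gcongr

theorem volume_unitSquare : volume unitSquare = 1 := by
  have := setLIntegral_unitSquare fun _ => 1
  simpa [volume_unitCube] using this

/-- A pointwise replacement for Hölder's inequality, obtained by comparing `‖x‖` with the threshold
`s`. It lowers the exponent without requiring measurability of the discrepancy. -/
theorem enorm_rpow_le_add {p p' s : ℝ} (hp : 0 < p) (hpp : p ≤ p') (hs : 0 < s) (x : ℝ) :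
    ‖x‖ₑ ^ p ≤ ENNReal.ofReal (s ^ p) + ENNReal.ofReal (s ^ (p - p')) * ‖x‖ₑ ^ p' := by
  rw [← ofReal_norm, ENNReal.ofReal_rpow_of_nonneg (norm_nonneg _) hp.le,
    ENNReal.ofReal_rpow_of_nonneg (norm_nonneg _) (by linarith),
    ← ENNReal.ofReal_mul (by positivity), ← ENNReal.ofReal_add (by positivity) (by positivity)]
  apply ENNReal.ofReal_le_ofReal
  rcases le_or_gt ‖x‖ s with h | h
  · have h1 : ‖x‖ ^ p ≤ s ^ p := by gcongr
    have h2 : 0 ≤ s ^ (p - p') * ‖x‖ ^ p' := by positivity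
    linarith
  · have hx : 0 < ‖x‖ := hs.trans h
    have h1 : ‖x‖ ^ (p - p') ≤ s ^ (p - p') :=
      Real.rpow_le_rpow_of_nonpos hs h.le (by linarith)
    have h2 : ‖x‖ ^ p = ‖x‖ ^ (p - p') * ‖x‖ ^ p' := by
      rw [← Real.rpow_add hx]; congr 1; ring
    have h3 : 0 ≤ s ^ p := by positivity
    have h4 : ‖x‖ ^ (p - p') * ‖x‖ ^ p' ≤ s ^ (p - p') * ‖x‖ ^ p' := by gcongr
    linarith

end Body

theorem mainTheorem7 (γ : ℝ) (hγ : 2 < γ) (hγ' : γ ≤ 3) (p : ℝ) (hp : 0 < p) (hp' : p < 4)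
    (C : Set Plane) (hC : IsFlatBody γ C) :
    p ≤ (2 * γ - 2) / (γ - 2) ∧
    ∃ c : ℝ, 0 < c ∧ ∀ R : ℝ, 0 < R →
      (∫⁻ θ, ∫⁻ t in unitSquare, ‖discrepancy C R θ t‖ₑ ^ p ∂volume ∂angleMeasure) ^ (1 / p) ≤
        ENNReal.ofReal (c * R ^ (1 / 2 : ℝ)) := by
  refine ⟨by rw [le_div_iff₀ (by linarith)]; nlinarith, ?_⟩
  obtain ⟨c₀, hc₀, hq⟩ := hC.exists_quadSupport hγ
  obtain ⟨hcomp, hconv, hbox, -⟩ := hC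
  set p' := max p 2 with hp'def
  have hpp' : p ≤ p' := le_max_left _ _
  have he : 0 < (γ - 2) / (γ - 1) := div_pos (by linarith) (by linarith)
  -- Equivalent to `γ ≤ 3`.
  have he' : (γ - 2) / (γ - 1) ≤ 1 / 2 := by rw [div_le_div_iff₀ (by linarith) (by norm_num)]; linarith
  obtain ⟨B, hB, hbound⟩ := exists_lintegral_lintegral_discrepancy_le hcomp hconv hbox hc₀ he he' hq
    (le_max_right p 2) (max_lt hp' (by norm_num))
  -- The summand `1` comes from the threshold term at `s = R ^ (1/2)`; it also makes the final
  -- constant positive.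
  have hB1 : (1 + B) ^ (1 / p) ≠ ⊤ :=
    ENNReal.rpow_ne_top_of_nonneg (by positivity) (ENNReal.add_ne_top.mpr ⟨ENNReal.one_ne_top, hB.ne⟩)
  have hB2 : 1 ≤ (1 + B) ^ (1 / p) := by
    apply ENNReal.one_le_rpow le_self_add (by positivity)
  refine ⟨((1 + B) ^ (1 / p)).toReal, ENNReal.toReal_pos (by positivity) hB1, fun R hR => ?_⟩
  have hsR : 0 < R ^ (1 / 2 : ℝ) := by positivity
  have hpow : ∀ s : ℝ, (R ^ (1 / 2 : ℝ)) ^ s = R ^ (s / 2) := fun s => by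
    rw [← Real.rpow_mul hR.le]; congr 1; ring
  have hmain : ∫⁻ θ, ∫⁻ t in unitSquare, ‖discrepancy C R θ t‖ₑ ^ p ∂volume ∂angleMeasure ≤
      ENNReal.ofReal (R ^ (p / 2)) * (1 + B) := by
    calc _ ≤ ∫⁻ θ, ∫⁻ t in unitSquare, (ENNReal.ofReal (R ^ (p / 2)) +
          ENNReal.ofReal (R ^ ((p - p') / 2)) * ‖discrepancy C R θ t‖ₑ ^ p') ∂volume ∂angleMeasure := by
          refine lintegral_mono fun θ => lintegral_mono fun t => ?_
          have := enorm_rpow_le_add hp hpp' hsR (discrepancy C R θ t)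
          rwa [hpow, hpow] at this
      _ = ENNReal.ofReal (R ^ (p / 2)) + ENNReal.ofReal (R ^ ((p - p') / 2)) *
          ∫⁻ θ, ∫⁻ t in unitSquare, ‖discrepancy C R θ t‖ₑ ^ p' ∂volume ∂angleMeasure := by
          simp_rw [lintegral_add_left measurable_const,
            lintegral_const_mul' _ _ ENNReal.ofReal_ne_top]
          simp [volume_unitSquare, angleMeasure_univ]
      _ ≤ ENNReal.ofReal (R ^ (p / 2)) + ENNReal.ofReal (R ^ ((p - p') / 2)) *
          (ENNReal.ofReal (R ^ (p' / 2)) * B) := by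
          gcongr
          exact hbound R hR
      _ = _ := by
          rw [← mul_assoc, ← ENNReal.ofReal_mul (by positivity), ← Real.rpow_add hR]
          have : (p - p') / 2 + p' / 2 = p / 2 := by ring
          rw [this, mul_add, mul_one]
  calc _ ≤ (ENNReal.ofReal (R ^ (p / 2)) * (1 + B)) ^ (1 / p) := by gcongr
    _ = _ := by
      rw [ENNReal.mul_rpow_of_nonneg _ _ (by positivity),
        ENNReal.ofReal_rpow_of_nonneg (by positivity) (by positivity), ← Real.rpow_mul hR.le,
        mul_comm _ (R ^ (1 / 2 : ℝ)), ENNReal.ofReal_mul hsR.le, ENNReal.ofReal_toReal hB1]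
      congr 3
      field_simp
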